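/- Let $\Bbbk$ be a field of characteristic $p\ge 0$ and let $B$ be a bialgebra over $\Bbbk$, with coproduct $\Delta$, counit $\epsilon$ and unit map $u$. Put $J:=\mathrm{Ker}(\epsilon)$; the $\epsilon$-filtration of $B$ is $J_{-n}:=J^n$, $J_n:=B$ ($n\ge 0$, $J^0:=B$). Let $\delta_n:=(\mathrm{id}-u\circ\epsilon)^{\otimes n}\circ\Delta^n:B\to B^{\otimes n}$, where $\Delta^n$ is the iterated coproduct ($\Delta^1=\mathrm{id}$, $\Delta^2=\Delta$); the $\delta_\bullet$-filtration of $B$ is $D_n:=\mathrm{Ker}(\delta_{n+1})$ for $n\ge 0$, $D_n:=0$ for $n<0$. Both are bialgebra filtrations, so the associated graded spaces $$\widehat B:=G_{\underline J}(B)=\bigoplus_{n\ge 0}J^n/J^{n+1},\qquad \widetilde B:=G_{\underline D}(B)=\bigoplus_{n\ge 0}D_n/D_{n-1}$$ are graded bialgebras (the $n$-th summand being given degree $n$). Conventions. Poisson Hopf algebras are commutative and co-Poisson Hopf algebras are cocommutative; the bracket and cobracket are Lie, satisfy the (co-)Leibniz identities, and are compatible with coproduct (resp. product), counit and antipode. A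 graded Poisson bracket has degree $-1$, a graded co-Poisson cobracket has degree $+1$. "Restricted Lie algebra" means a $p$-Lie algebra if $p>0$ and just a Lie algebra if $p=0$. A restricted Lie bialgebra is a restricted Lie algebra $\mathfrak g$ with a Lie cobracket $\delta$ that is a $1$-cocycle and satisfies $\delta(x^{[p]})=(\mathrm{ad}_x\otimes 1+1\otimes \mathrm{ad}_x)^{p-1}(\delta(x))$ if $p>0$. $\mathcal U(\mathfrak g)$ is the universal enveloping algebra if $p=0$ and the restricted one if $p>0$, with its standard Hopf structure; its cobracket is the one extending that of $\mathfrak g$. An algebraic group $G$ is a (pro)affine group scheme over $\Bbbk$, given by its commutative Hopf algebra $F[G]$ of regular functions; it is a Poisson group if $F[G]$ is a Poisson Hopf algebra, and connected if $F[G]$ has no idempotents other than $0$ and $1$. **(a)** $\widehat B$ is a graded cocommutative co-Poisson Hopf algebra, with cobracket induced by $\Delta-\Delta^{\mathrm{op}}$ (for $x\in J^n$, the class of $x$ in $J^n/J^{n+1}$ goes to the class of $\Delta(x)-\Delta^{\mathrm{op}}(x)$ in $\bigoplus_{r+s=n+1}J^r/J^{r+1}\otimes J^s/J^{s+1}$),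 and it is generated as an algebra by its primitive elements. Moreover $\widehat B\cong\mathcal U(\mathfrak g_-)$ as graded co-Poisson Hopf algebras for some graded restricted Lie bialgebra $\mathfrak g_-$ (the Lie bracket has degree $0$, the $p$-operation multiplies degrees by $p$, the cobracket has degree $+1$). If $p=0$ and $\dim B<\infty$, then $\widehat B=\Bbbk\cdot 1$ and $\mathfrak g_-=\{0\}$. **(b)** $\widetilde B$ is a graded commutative Poisson Hopf algebra, with bracket induced by the commutator of $B$ (for $x\in D_m$, $y\in D_n$, the bracket of the classes of $x$ and $y$ is the class of $xy-yx$ in $D_{m+n-1}/D_{m+n-2}$). Moreover $\widetilde B\cong F[G_+]$ as Poisson Hopf algebras for some connected algebraic Poisson group $G_+$ such that: * if $p=0$, then $F[G_+]\cong\Bbbk[\{x_i\}_{i\in I}]$ is a polynomial algebra for some set $I$, i.e. $G_+$ is a (pro)affine space as a variety; if moreover $\dim B<\infty$, then $\widetilde B=\Bbbk\cdot1$ and $G_+=\{1\}$; * if $p>0$, then $G_+$ has dimension $0$ (the Krull dimension of $F[G_+]$ is $0$) and height at most $1$ ($f^p=0$ for every $f\in F[G_+]$ with $\epsilon(f)=0$);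 if moreover $\Bbbk$ is perfect, then $F[G_+]\cong\Bbbk[\{x_i\}_{i\in I}]/(\{x_i^p\}_{i\in I})$ is a truncated polynomial algebra for some set $I$. -/

import Mathlib

universe u v w

open scoped TensorProduct DirectSum

noncomputable section

namespace CrystalDuality

section GradedObject

/-- The subspace `∑_{r+s=z} F_r ⊗ F_s` of `V ⊗ V`, for a family of subspaces `F_z` of `V`. -/
def tensorDegree {K : Type u} [Field K] {V : Type v} [AddCommGroup V] [Module K V]
    (F : ℤ → Submodule K V) (z : ℤ) : Submodule K (V ⊗[K] V) :=
  Submodule.span K {t | ∃ r s : ℤ, r + s = z ∧ ∃ x ∈ F r, ∃ y ∈ F s, t = x ⊗ₜ[K] y}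

variable {K : Type u} [Field K] {B : Type v} [Ring B] [Bialgebra K B]

/-- A (unital, counital) bialgebra filtration `⋯ ⊆ F_{z-1} ⊆ F_z ⊆ ⋯` of a bialgebra. -/
class IsBialgebraFiltration (F : ℤ → Submodule K B) : Prop where
  monotone : Monotone F
  mul_mem : ∀ {m n : ℤ} {x y : B}, x ∈ F m → y ∈ F n → x * y ∈ F (m + n)
  comul_mem : ∀ {z : ℤ} {x : B}, x ∈ F z →
    Coalgebra.comul (R := K) x ∈ tensorDegree F z
  one_mem : (1 : B) ∈ F 0
  counit_eq_zero : ∀ {x : B}, x ∈ F (-1) → Coalgebra.counit (R := K) x = 0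

/-- The graded piece `F_z / F_{z-1}`. -/
def GradedPiece (F : ℤ → Submodule K B) (z : ℤ) : Type v :=
  F z ⧸ (F (z - 1)).submoduleOf (F z)

instance (F : ℤ → Submodule K B) (z : ℤ) : AddCommGroup (GradedPiece F z) :=
  inferInstanceAs (AddCommGroup (F z ⧸ (F (z - 1)).submoduleOf (F z)))

instance (F : ℤ → Submodule K B) (z : ℤ) : Module K (GradedPiece F z) :=
  inferInstanceAs (Module K (F z ⧸ (F (z - 1)).submoduleOf (F z)))

/-- The projection `F_z → F_z / F_{z-1}`. -/
def GradedPiece.mk (F : ℤ → Submodule K B) (z : ℤ) : F z →ₗ[K] GradedPiece F z :=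
  Submodule.mkQ ((F (z - 1)).submoduleOf (F z))

/-- The associated graded vector space `G_F(B) = ⨁_z F_z / F_{z-1}`. -/
def AssocGraded (F : ℤ → Submodule K B) : Type v := ⨁ z : ℤ, GradedPiece F z

namespace AssocGraded

variable (F : ℤ → Submodule K B)

instance : AddCommGroup (AssocGraded F) :=
  inferInstanceAs (AddCommGroup (⨁ z : ℤ, GradedPiece F z))

instance : Module K (AssocGraded F) :=
  inferInstanceAs (Module K (⨁ z : ℤ, GradedPiece F z))

/-- The class in `F_z / F_{z-1} ⊆ G_F(B)` of an element of `F_z`. -/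
def symbol (z : ℤ) : F z →ₗ[K] AssocGraded F :=
  (DirectSum.lof K ℤ (GradedPiece F) z).comp (GradedPiece.mk F z)

/-- The homogeneous component of degree `z` of `G_F(B)`, as a subspace. -/
def piece (z : ℤ) : Submodule K (AssocGraded F) := LinearMap.range (symbol F z)

variable {F}

theorem symbol_congr {z z' : ℤ} (h : z = z') {x x' : B} (hx : x ∈ F z) (hx' : x' ∈ F z')
    (e : x = x') : symbol F z ⟨x, hx⟩ = symbol F z' ⟨x', hx'⟩ := by
  subst h; subst e; rfl

theorem symbol_eq_zero {z : ℤ} {x : B} (hx : x ∈ F z) (h : x ∈ F (z - 1)) :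
    symbol F z ⟨x, hx⟩ = 0 := by
  have : GradedPiece.mk F z ⟨x, hx⟩ = 0 := (Submodule.Quotient.mk_eq_zero _).2 h
  exact (congrArg (DirectSum.lof K ℤ (GradedPiece F) z) this).trans (map_zero _)

theorem hom_ext {M : Type w} [AddCommGroup M] [Module K M] {f g : AssocGraded F →ₗ[K] M}
    (h : ∀ (z : ℤ) (x : F z), f (symbol F z x) = g (symbol F z x)) : f = g := by
  refine DirectSum.linearMap_ext K fun z => ?_
  refine Submodule.linearMap_qext ((F (z - 1)).submoduleOf (F z)) ?_
  exact LinearMap.ext fun x => h z x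

theorem induction_on {P : AssocGraded F → Prop} (a : AssocGraded F)
    (h : ∀ (z : ℤ) (x : F z), P (symbol F z x)) (hadd : ∀ a b, P a → P b → P (a + b)) : P a := by
  induction a using DirectSum.induction_on with
  | zero => have := h 0 0; rw [map_zero] at this; exact this
  | of z x =>
    obtain ⟨y, rfl⟩ := Submodule.mkQ_surjective _ x
    exact h z y
  | add a b ha hb => exact hadd a b ha hb

/-- Construction of linear maps out of `G_F(B)`. -/
def lift {M : Type w} [AddCommGroup M] [Module K M] (f : ∀ z, F z →ₗ[K] M)
    (hf : ∀ (z : ℤ) (x : F z), (x : B) ∈ F (z - 1) → f z x = 0) : AssocGraded F →ₗ[K] M :=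
  DirectSum.toModule K ℤ M fun z =>
    Submodule.liftQ ((F (z - 1)).submoduleOf (F z)) (f z) fun x hx => hf z x hx

@[simp] theorem lift_symbol {M : Type w} [AddCommGroup M] [Module K M] (f : ∀ z, F z →ₗ[K] M)
    (hf : ∀ (z : ℤ) (x : F z), (x : B) ∈ F (z - 1) → f z x = 0) (z : ℤ) (x : F z) :
    lift f hf (symbol F z x) = f z x := by
  unfold lift symbol
  exact DirectSum.toModule_lof K z _

section Algebra

variable [IsBialgebraFiltration F]

variable (F) in
/-- The product of `G_F(B)`, as a bilinear map. -/
def mulHom : AssocGraded F →ₗ[K] AssocGraded F →ₗ[K] AssocGraded F :=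
  lift (fun m => LinearMap.flip (lift (fun n => LinearMap.flip (LinearMap.mk₂ K
      (fun (x : F m) (y : F n) =>
        symbol F (m + n) ⟨x * y, IsBialgebraFiltration.mul_mem x.2 y.2⟩)
      (fun x x' y => by
        rw [← map_add]; exact symbol_congr rfl _ _ (by simp [add_mul]))
      (fun c x y => by
        rw [← map_smul]; exact symbol_congr rfl _ _ (by simp))
      (fun x y y' => by
        rw [← map_add]; exact symbol_congr rfl _ _ (by simp [mul_add]))
      (fun c x y => by
        rw [← map_smul]; exact symbol_congr rfl _ _ (by simp))))
    (fun n y hy => by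
      ext x
      refine symbol_eq_zero _ ?_
      have := IsBialgebraFiltration.mul_mem (F := F) x.2 hy
      rwa [show m + (n - 1) = m + n - 1 by ring] at this)))
    (fun m x hx => by
      refine hom_ext fun n y => ?_
      simp only [LinearMap.flip_apply, lift_symbol, LinearMap.mk₂_apply, LinearMap.zero_apply]
      refine symbol_eq_zero _ ?_
      have := IsBialgebraFiltration.mul_mem (F := F) hx y.2
      rwa [show m - 1 + n = m + n - 1 by ring] at this)

theorem mulHom_symbol (m n : ℤ) (x : F m) (y : F n) :
    mulHom F (symbol F m x) (symbol F n y) =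
      symbol F (m + n) ⟨x * y, IsBialgebraFiltration.mul_mem x.2 y.2⟩ := by
  simp [mulHom]

instance : Ring (AssocGraded F) where
  __ := (inferInstance : AddCommGroup (AssocGraded F))
  mul a b := mulHom F a b
  one := symbol F 0 ⟨1, IsBialgebraFiltration.one_mem⟩
  left_distrib a b c := by simp [HMul.hMul]
  right_distrib a b c := by simp [HMul.hMul]
  zero_mul a := by simp [HMul.hMul]
  mul_zero a := by simp [HMul.hMul]
  mul_assoc := by
    intro a b c
    change mulHom F (mulHom F a b) c = mulHom F a (mulHom F b c)
    induction a using induction_on with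
    | hadd a a' h h' => simp only [map_add, LinearMap.add_apply, h, h']
    | h m x =>
    induction b using induction_on with
    | hadd a a' h h' => simp only [map_add, LinearMap.add_apply, h, h']
    | h n y =>
    induction c using induction_on with
    | hadd a a' h h' => simp only [map_add, h, h']
    | h k z =>
    simp only [mulHom_symbol]
    exact symbol_congr (add_assoc m n k) _ _ (mul_assoc _ _ _)
  one_mul := by
    have h : mulHom F (symbol F 0 ⟨1, IsBialgebraFiltration.one_mem⟩) = LinearMap.id :=
      hom_ext fun z x => by
        rw [mulHom_symbol]; exact symbol_congr (by simp) _ x.2 (by simp)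
    exact fun a => LinearMap.congr_fun h a
  mul_one := by
    have h : (mulHom F).flip (symbol F 0 ⟨1, IsBialgebraFiltration.one_mem⟩) = LinearMap.id :=
      hom_ext fun z x => by
        rw [LinearMap.flip_apply, mulHom_symbol]; exact symbol_congr (by simp) _ x.2 (by simp)
    exact fun a => LinearMap.congr_fun h a

theorem symbol_mul_symbol (m n : ℤ) (x : F m) (y : F n) :
    symbol F m x * symbol F n y =
      symbol F (m + n) ⟨x * y, IsBialgebraFiltration.mul_mem x.2 y.2⟩ :=
  mulHom_symbol m n x y

variable (F) in
theorem one_def : (1 : AssocGraded F) = symbol F 0 ⟨1, IsBialgebraFiltration.one_mem⟩ := rfl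

instance : Algebra K (AssocGraded F) :=
  Algebra.ofModule
    (fun c a b => by change mulHom F (c • a) b = c • mulHom F a b; simp)
    (fun c a b => by change mulHom F a (c • b) = c • mulHom F a b; simp)

end Algebra

/-! The coproduct: if `x ∈ F_z` and `Δ x = ∑ xᵢ ⊗ yᵢ` with `xᵢ ∈ F_{rᵢ}`, `yᵢ ∈ F_{sᵢ}`,
`rᵢ + sᵢ = z`, then the class of `x` in `F_z / F_{z-1}` is sent to the sum of the tensors of the
classes of `xᵢ` in `F_{rᵢ} / F_{rᵢ-1}` and of `yᵢ` in `F_{sᵢ} / F_{sᵢ-1}`. -/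

variable (F) in
/-- The pairs `(t, T)` where `t = ∑ xᵢ ⊗ yᵢ` with `xᵢ ∈ F_{rᵢ}`, `yᵢ ∈ F_{sᵢ}`, `rᵢ + sᵢ = z`, and
`T` is the corresponding sum of the tensors of the classes of `xᵢ` and `yᵢ` in `G_F(B)`; that is,
`T` is the class of `t ∈ (F ⊗ F)_z` in `(F ⊗ F)_z / (F ⊗ F)_{z-1} ⊆ G_F(B) ⊗ G_F(B)`. -/
def tensorSymbol (z : ℤ) : Submodule K ((B ⊗[K] B) × (AssocGraded F ⊗[K] AssocGraded F)) :=
  Submodule.span K {p | ∃ (r s : ℤ) (_ : r + s = z) (x : F r) (y : F s),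
    p = ((x : B) ⊗ₜ[K] (y : B), symbol F r x ⊗ₜ[K] symbol F s y)}

theorem exists_tensorSymbol {z : ℤ} {t : B ⊗[K] B} (ht : t ∈ tensorDegree F z) :
    ∃ T, (t, T) ∈ tensorSymbol F z := by
  induction ht using Submodule.span_induction with
  | mem t h =>
    obtain ⟨r, s, h, x, hx, y, hy, rfl⟩ := h
    exact ⟨_, Submodule.subset_span ⟨r, s, h, ⟨x, hx⟩, ⟨y, hy⟩, rfl⟩⟩
  | zero => exact ⟨0, zero_mem _⟩
  | add t t' _ _ h h' =>
    obtain ⟨T, h⟩ := h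
    obtain ⟨T', h'⟩ := h'
    exact ⟨T + T', add_mem h h'⟩
  | smul c t _ h =>
    obtain ⟨T, h⟩ := h
    exact ⟨c • T, Submodule.smul_mem _ c h⟩

/-- Elements of `(F ⊗ F)_{z-1}` have class zero in degree `z`. -/
theorem zero_mem_tensorSymbol {z : ℤ} (hF : Monotone F) {t : B ⊗[K] B}
    (ht : t ∈ tensorDegree F (z - 1)) : (t, 0) ∈ tensorSymbol F z := by
  induction ht using Submodule.span_induction with
  | mem t h =>
    obtain ⟨r, s, h, x, hx, y, hy, rfl⟩ := h
    refine Submodule.subset_span ⟨r + 1, s, by omega, ⟨x, hF (by omega) hx⟩, ⟨y, hy⟩, ?_⟩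
    rw [symbol_eq_zero _ (by simpa using hx), TensorProduct.zero_tmul]
  | zero => exact zero_mem _
  | add t t' _ _ h h' => simpa using add_mem h h'
  | smul c t _ h => simpa using Submodule.smul_mem _ c h

/-- Projection of `G_F(B)` onto its component of degree `r`. -/
def proj (F : ℤ → Submodule K B) (r : ℤ) : AssocGraded F →ₗ[K] AssocGraded F :=
  lift (fun z => if z = r then symbol F z else 0) fun z x hx => by
    split_ifs
    · exact symbol_eq_zero _ hx
    · rfl

theorem proj_symbol (r z : ℤ) (x : F z) :
    proj F r (symbol F z x) = if z = r then symbol F z x else 0 := by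
  rw [proj, lift_symbol]; split_ifs <;> rfl

/-- An extension to `B` of the map `F_r → G_F(B)`. -/
theorem exists_extend (F : ℤ → Submodule K B) (r : ℤ) :
    ∃ f : B →ₗ[K] AssocGraded F, ∀ x : F r, f x = symbol F r x := by
  obtain ⟨f, hf⟩ := LinearMap.exists_extend (symbol F r)
  exact ⟨f, fun x => LinearMap.congr_fun hf x⟩

/-- An auxiliary extension to `B` of the map `F_r → G_F(B)`. -/
def ext (F : ℤ → Submodule K B) (r : ℤ) : B →ₗ[K] AssocGraded F := (exists_extend F r).choose

theorem ext_apply (r : ℤ) (x : F r) : ext F r x = symbol F r x :=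
  (exists_extend F r).choose_spec x

theorem ext_eq (hF : Monotone F) {r z : ℤ} (hz : z ≤ r) (x : F z) :
    ext F r x = proj F r (symbol F z x) := by
  rw [proj_symbol]
  split_ifs with h
  · subst h; exact ext_apply _ x
  · exact (ext_apply r ⟨(x : B), hF hz x.2⟩).trans
      (symbol_eq_zero _ (hF (show z ≤ r - 1 by omega) x.2))

theorem exists_proj_sum (a : AssocGraded F) :
    ∃ T : Finset ℤ, ∀ T' : Finset ℤ, T ⊆ T' → ∑ r ∈ T', proj F r a = a := by
  classical
  induction a using induction_on with
  | h z x =>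
    refine ⟨{z}, fun T hT => ?_⟩
    simp only [proj_symbol]
    rw [Finset.sum_ite_eq, if_pos (hT (by simp))]
  | hadd a b ha hb =>
    obtain ⟨T, hT⟩ := ha
    obtain ⟨T', hT'⟩ := hb
    refine ⟨T ∪ T', fun T'' h => ?_⟩
    simp only [map_add, Finset.sum_add_distrib]
    rw [hT _ (Finset.union_subset_left h), hT' _ (Finset.union_subset_right h)]

/-- An element of `G_F(B) ⊗ M` is zero if all its components in the first factor are. -/
theorem eq_zero_of_rTensor {M : Type w} [AddCommGroup M] [Module K M]
    (t : AssocGraded F ⊗[K] M) (h : ∀ r, (proj F r).rTensor M t = 0) : t = 0 := by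
  have : ∃ T : Finset ℤ, ∀ T' : Finset ℤ, T ⊆ T' → ∑ r ∈ T', (proj F r).rTensor M t = t := by
    clear h
    classical
    induction t using TensorProduct.induction_on with
    | zero => exact ⟨∅, by simp⟩
    | tmul a m =>
      obtain ⟨T, hT⟩ := exists_proj_sum a
      refine ⟨T, fun T' h => ?_⟩
      simp only [LinearMap.rTensor_tmul]
      rw [← TensorProduct.sum_tmul, hT T' h]
    | add a b ha hb =>
      obtain ⟨T, hT⟩ := ha
      obtain ⟨T', hT'⟩ := hb
      refine ⟨T ∪ T', fun T'' h => ?_⟩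
      simp only [map_add, Finset.sum_add_distrib]
      rw [hT _ (Finset.union_subset_left h), hT' _ (Finset.union_subset_right h)]
  obtain ⟨T, hT⟩ := this
  rw [← hT T subset_rfl]
  simp [h]

theorem eq_zero_of_lTensor {M : Type w} [AddCommGroup M] [Module K M]
    (t : M ⊗[K] AssocGraded F) (h : ∀ r, (proj F r).lTensor M t = 0) : t = 0 := by
  have : TensorProduct.comm K _ _ t = 0 := eq_zero_of_rTensor _ fun r => by
    have e : (proj F r).rTensor M ∘ₗ (TensorProduct.comm K M (AssocGraded F)).toLinearMap =
        (TensorProduct.comm K M (AssocGraded F)).toLinearMap ∘ₗ (proj F r).lTensor M := by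
      ext; rfl
    have := LinearMap.congr_fun e t
    simpa [h r] using this
  simpa using this

theorem eq_zero_of_map (t : AssocGraded F ⊗[K] AssocGraded F)
    (h : ∀ r s, TensorProduct.map (proj F r) (proj F s) t = 0) : t = 0 := by
  refine eq_zero_of_rTensor _ fun r => eq_zero_of_lTensor _ fun s => ?_
  rw [← h r s, ← LinearMap.comp_apply, LinearMap.lTensor_comp_rTensor]

theorem eq_zero_of_map₃ (t : AssocGraded F ⊗[K] (AssocGraded F ⊗[K] AssocGraded F))
    (h : ∀ r s u, TensorProduct.map (proj F r) (TensorProduct.map (proj F s) (proj F u)) t = 0) :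
    t = 0 := by
  refine eq_zero_of_rTensor _ fun r => ?_
  apply (TensorProduct.assoc K _ _ _).symm.injective
  rw [map_zero]
  refine eq_zero_of_lTensor _ fun u => ?_
  apply (TensorProduct.assoc K _ _ _).injective
  rw [map_zero]
  apply (TensorProduct.leftComm K _ _ _).injective
  rw [map_zero]
  refine eq_zero_of_rTensor _ fun s => ?_
  have e : (proj F s).rTensor (AssocGraded F ⊗[K] AssocGraded F) ∘ₗ
      (TensorProduct.leftComm K _ _ _).toLinearMap ∘ₗ (TensorProduct.assoc K _ _ _).toLinearMap ∘ₗ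
      (proj F u).lTensor (AssocGraded F ⊗[K] AssocGraded F) ∘ₗ
      (TensorProduct.assoc K _ _ _).symm.toLinearMap ∘ₗ (proj F r).rTensor _ =
      (TensorProduct.leftComm K _ _ _).toLinearMap ∘ₗ
      TensorProduct.map (proj F r) (TensorProduct.map (proj F s) (proj F u)) := by
    refine TensorProduct.ext' fun a t => ?_
    induction t using TensorProduct.induction_on with
    | zero => simp
    | add t t' h h' => simp only [TensorProduct.tmul_add, map_add, h, h']
    | tmul b c => simp
  have := LinearMap.congr_fun e t
  simp only [LinearMap.comp_apply, h r s u, map_zero] at this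
  exact this

theorem map_proj_of_mem {z : ℤ} (hF : Monotone F) {t : B ⊗[K] B}
    {T : AssocGraded F ⊗[K] AssocGraded F} (h : (t, T) ∈ tensorSymbol F z) (r s : ℤ) :
    TensorProduct.map (proj F r) (proj F s) T =
      if r + s = z then TensorProduct.map (ext F r) (ext F s) t else 0 := by
  suffices H : tensorSymbol F z ≤ LinearMap.ker
      ((TensorProduct.map (proj F r) (proj F s)) ∘ₗ LinearMap.snd K _ _ -
        (if r + s = z then TensorProduct.map (ext F r) (ext F s) else 0) ∘ₗ
          LinearMap.fst K _ _) by
    have := H h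
    rw [LinearMap.mem_ker, LinearMap.sub_apply, sub_eq_zero] at this
    refine (this : TensorProduct.map (proj F r) (proj F s) T = _).trans ?_
    split_ifs <;> rfl
  refine Submodule.span_le.2 ?_
  rintro _ ⟨i, j, hij, x, y, rfl⟩
  simp only [SetLike.mem_coe, LinearMap.mem_ker, LinearMap.sub_apply, LinearMap.comp_apply,
    LinearMap.snd_apply, LinearMap.fst_apply, TensorProduct.map_tmul, sub_eq_zero]
  split_ifs with hrs
  · rw [TensorProduct.map_tmul]
    rcases lt_trichotomy i r with hi | hi | hi
    · rw [ext_eq hF hi.le, proj_symbol, if_neg hi.ne, TensorProduct.zero_tmul,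
        TensorProduct.zero_tmul]
    · rw [ext_eq hF hi.le, ext_eq hF (show j ≤ s by omega)]
    · rw [ext_eq hF (show j ≤ s by omega), proj_symbol s, if_neg (by omega),
        TensorProduct.tmul_zero, TensorProduct.tmul_zero]
  · rw [LinearMap.zero_apply]
    by_cases hi : i = r
    · rw [proj_symbol s, if_neg (by omega), TensorProduct.tmul_zero]
    · rw [proj_symbol r, if_neg hi, TensorProduct.zero_tmul]

/-- The class of an element of `(F ⊗ F)_z` in `G_F(B) ⊗ G_F(B)` is well defined. -/
theorem tensorSymbol_unique {z : ℤ} (hF : Monotone F) {t : B ⊗[K] B}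
    {T T' : AssocGraded F ⊗[K] AssocGraded F} (h : (t, T) ∈ tensorSymbol F z)
    (h' : (t, T') ∈ tensorSymbol F z) : T = T' := by
  refine sub_eq_zero.1 (eq_zero_of_map _ fun r s => ?_)
  rw [map_sub, map_proj_of_mem hF h, map_proj_of_mem hF h', sub_self]

theorem eq_of_mem_range {z : ℤ} {x : F z} {a : AssocGraded F}
    (h : ((x : B), a) ∈ LinearMap.range ((F z).subtype.prod (symbol F z))) : a = symbol F z x := by
  obtain ⟨y, hy⟩ := h
  have h1 : y = x := Subtype.ext (congrArg Prod.fst hy)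
  subst h1
  exact (congrArg Prod.snd hy).symm

section Coalgebra

variable [IsBialgebraFiltration F]

variable (F) in
/-- The class in `G_F(B) ⊗ G_F(B)` of the coproduct of an element of `F_z`. -/
def comulPiece (z : ℤ) (x : F z) : AssocGraded F ⊗[K] AssocGraded F :=
  (exists_tensorSymbol (IsBialgebraFiltration.comul_mem (F := F) x.2)).choose

theorem comulPiece_spec (z : ℤ) (x : F z) :
    (Coalgebra.comul (R := K) (x : B), comulPiece F z x) ∈ tensorSymbol F z :=
  (exists_tensorSymbol (IsBialgebraFiltration.comul_mem (F := F) x.2)).choose_spec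

theorem comulPiece_eq {z : ℤ} {x : F z} {T : AssocGraded F ⊗[K] AssocGraded F}
    (h : (Coalgebra.comul (R := K) (x : B), T) ∈ tensorSymbol F z) : comulPiece F z x = T :=
  tensorSymbol_unique IsBialgebraFiltration.monotone (comulPiece_spec z x) h

variable (F) in
/-- The coproduct of `G_F(B)`. -/
def comulHom : AssocGraded F →ₗ[K] AssocGraded F ⊗[K] AssocGraded F :=
  lift (fun z =>
    { toFun := comulPiece F z
      map_add' := fun x y => comulPiece_eq (by
        simpa using add_mem (comulPiece_spec z x) (comulPiece_spec z y))
      map_smul' := fun c x => comulPiece_eq (by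
        simpa using Submodule.smul_mem _ c (comulPiece_spec z x)) })
    fun z x hx => comulPiece_eq (zero_mem_tensorSymbol IsBialgebraFiltration.monotone
      (IsBialgebraFiltration.comul_mem hx))

theorem comulHom_spec (z : ℤ) (x : F z) :
    (Coalgebra.comul (R := K) (x : B), comulHom F (symbol F z x)) ∈ tensorSymbol F z := by
  rw [comulHom, lift_symbol]
  exact comulPiece_spec z x

variable (F) in
/-- The counit of `G_F(B)`: it is induced by the counit of `B` in degree `0`, and it vanishes in
all other degrees. -/
def counitHom : AssocGraded F →ₗ[K] K :=
  lift (fun z => if z = 0 then Coalgebra.counit.comp (F z).subtype else 0) fun z x hx => by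
    split_ifs with h
    · subst h; exact IsBialgebraFiltration.counit_eq_zero (F := F) hx
    · rfl

theorem counitHom_symbol (z : ℤ) (x : F z) :
    counitHom F (symbol F z x) = if z = 0 then Coalgebra.counit (R := K) (x : B) else 0 := by
  rw [counitHom, lift_symbol]; split_ifs <;> rfl

variable (F) in
/-- Three-fold analogue of `tensorSymbol`. -/
def tripleSymbol (z : ℤ) : Submodule K ((B ⊗[K] (B ⊗[K] B)) ×
    (AssocGraded F ⊗[K] (AssocGraded F ⊗[K] AssocGraded F))) :=
  Submodule.span K {p | ∃ (r s u : ℤ) (_ : r + s + u = z) (a : F r) (b : F s) (c : F u),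
    p = ((a : B) ⊗ₜ[K] ((b : B) ⊗ₜ[K] (c : B)),
      symbol F r a ⊗ₜ[K] (symbol F s b ⊗ₜ[K] symbol F u c))}

theorem tripleSymbol_unique {z : ℤ} (hF : Monotone F) {t : B ⊗[K] (B ⊗[K] B)}
    {T T' : AssocGraded F ⊗[K] (AssocGraded F ⊗[K] AssocGraded F)}
    (h : (t, T) ∈ tripleSymbol F z) (h' : (t, T') ∈ tripleSymbol F z) : T = T' := by
  have key : ∀ {t T}, (t, T) ∈ tripleSymbol F z → ∀ r s u : ℤ,
      TensorProduct.map (proj F r) (TensorProduct.map (proj F s) (proj F u)) T =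
        (if r + s + u = z then TensorProduct.map (ext F r) (TensorProduct.map (ext F s) (ext F u))
          else 0) t := by
    intro t T h r s u
    suffices H : tripleSymbol F z ≤ LinearMap.ker
        ((TensorProduct.map (proj F r) (TensorProduct.map (proj F s) (proj F u))) ∘ₗ
          LinearMap.snd K _ _ -
        (if r + s + u = z then TensorProduct.map (ext F r) (TensorProduct.map (ext F s) (ext F u))
          else 0) ∘ₗ LinearMap.fst K _ _) by
      have := H h
      rwa [LinearMap.mem_ker, LinearMap.sub_apply, sub_eq_zero] at this
    refine Submodule.span_le.2 ?_
    rintro _ ⟨i, j, k, hij, x, y, w, rfl⟩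
    simp only [SetLike.mem_coe, LinearMap.mem_ker, LinearMap.sub_apply, LinearMap.comp_apply,
      LinearMap.snd_apply, LinearMap.fst_apply, TensorProduct.map_tmul, sub_eq_zero]
    split_ifs with hrs
    · simp only [TensorProduct.map_tmul]
      by_cases hi : i < r
      · rw [ext_eq hF hi.le, proj_symbol, if_neg hi.ne, TensorProduct.zero_tmul,
          TensorProduct.zero_tmul]
      by_cases hj : j < s
      · rw [ext_eq hF hj.le, proj_symbol s, if_neg hj.ne, TensorProduct.zero_tmul,
          TensorProduct.zero_tmul, TensorProduct.tmul_zero, TensorProduct.tmul_zero]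
      by_cases hk : k < u
      · rw [ext_eq hF hk.le, proj_symbol u, if_neg hk.ne, TensorProduct.tmul_zero,
          TensorProduct.tmul_zero, TensorProduct.tmul_zero, TensorProduct.tmul_zero]
      rw [ext_eq hF (show i ≤ r by omega), ext_eq hF (show j ≤ s by omega),
        ext_eq hF (show k ≤ u by omega)]
    · rw [LinearMap.zero_apply]
      by_cases hi : i = r
      · by_cases hj : j = s
        · rw [proj_symbol u, if_neg (by omega), TensorProduct.tmul_zero, TensorProduct.tmul_zero]
        · rw [proj_symbol s, if_neg hj, TensorProduct.zero_tmul, TensorProduct.tmul_zero]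
      · rw [proj_symbol r, if_neg hi, TensorProduct.zero_tmul]
  refine sub_eq_zero.1 (eq_zero_of_map₃ _ fun r s u => ?_)
  rw [map_sub, key h, key h', sub_self]

theorem tmul_mem_tripleSymbol {r z : ℤ} (x : F r) {t : B ⊗[K] B}
    {T : AssocGraded F ⊗[K] AssocGraded F} (h : (t, T) ∈ tensorSymbol F z) :
    ((x : B) ⊗ₜ[K] t, symbol F r x ⊗ₜ[K] T) ∈ tripleSymbol F (r + z) := by
  suffices H : tensorSymbol F z ≤ (tripleSymbol F (r + z)).comap
      ((TensorProduct.mk K B (B ⊗[K] B) x).prodMap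
        (TensorProduct.mk K (AssocGraded F) (AssocGraded F ⊗[K] AssocGraded F)
          (symbol F r x))) from H h
  refine Submodule.span_le.2 ?_
  rintro _ ⟨i, j, rfl, y, w, rfl⟩
  exact Submodule.subset_span ⟨r, i, j, by ring, x, y, w, rfl⟩

theorem assoc_tmul_mem_tripleSymbol {r z : ℤ} (x : F r) {t : B ⊗[K] B}
    {T : AssocGraded F ⊗[K] AssocGraded F} (h : (t, T) ∈ tensorSymbol F z) :
    (TensorProduct.assoc K B B B (t ⊗ₜ[K] (x : B)),
      TensorProduct.assoc K _ _ _ (T ⊗ₜ[K] symbol F r x)) ∈ tripleSymbol F (z + r) := by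
  suffices H : tensorSymbol F z ≤ (tripleSymbol F (z + r)).comap
      (((TensorProduct.assoc K B B B).toLinearMap ∘ₗ
          (TensorProduct.mk K (B ⊗[K] B) B).flip x).prodMap
        ((TensorProduct.assoc K _ _ _).toLinearMap ∘ₗ
          (TensorProduct.mk K (AssocGraded F ⊗[K] AssocGraded F) (AssocGraded F)).flip
          (symbol F r x))) from H h
  refine Submodule.span_le.2 ?_
  rintro _ ⟨i, j, rfl, y, w, rfl⟩
  exact Submodule.subset_span ⟨i, j, r, rfl, y, w, x, by simp⟩

theorem coassoc_left_mem {z : ℤ} {t : B ⊗[K] B} {T : AssocGraded F ⊗[K] AssocGraded F}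
    (h : (t, T) ∈ tensorSymbol F z) :
    (TensorProduct.assoc K B B B (Coalgebra.comul.rTensor B t),
      TensorProduct.assoc K _ _ _ ((comulHom F).rTensor _ T)) ∈ tripleSymbol F z := by
  suffices H : tensorSymbol F z ≤ (tripleSymbol F z).comap
      (((TensorProduct.assoc K B B B).toLinearMap ∘ₗ Coalgebra.comul.rTensor B).prodMap
        ((TensorProduct.assoc K _ _ _).toLinearMap ∘ₗ (comulHom F).rTensor _)) from H h
  refine Submodule.span_le.2 ?_
  rintro _ ⟨i, j, rfl, y, w, rfl⟩
  exact assoc_tmul_mem_tripleSymbol w (comulHom_spec i y)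

theorem coassoc_right_mem {z : ℤ} {t : B ⊗[K] B} {T : AssocGraded F ⊗[K] AssocGraded F}
    (h : (t, T) ∈ tensorSymbol F z) :
    (Coalgebra.comul.lTensor B t, (comulHom F).lTensor _ T) ∈ tripleSymbol F z := by
  suffices H : tensorSymbol F z ≤ (tripleSymbol F z).comap
      ((Coalgebra.comul.lTensor B).prodMap ((comulHom F).lTensor _)) from H h
  refine Submodule.span_le.2 ?_
  rintro _ ⟨i, j, rfl, y, w, rfl⟩
  exact tmul_mem_tripleSymbol y (comulHom_spec j w)

theorem counit_symbol_mem {r s : ℤ} (x : F r) (y : F s) :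
    (Coalgebra.counit (R := K) (x : B) • (y : B), counitHom F (symbol F r x) • symbol F s y) ∈
      LinearMap.range ((F (r + s)).subtype.prod (symbol F (r + s))) := by
  rw [counitHom_symbol]
  rcases lt_trichotomy r 0 with h | h | h
  · rw [if_neg h.ne, IsBialgebraFiltration.counit_eq_zero (F := F)
      (IsBialgebraFiltration.monotone (F := F) (show r ≤ -1 by omega) x.2), zero_smul, zero_smul]
    exact zero_mem _
  · rw [if_pos h, ← map_smul]
    subst h
    have hm : Coalgebra.counit (R := K) (x : B) • (y : B) ∈ F (0 + s) := by
      rw [zero_add]; exact Submodule.smul_mem _ _ y.2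
    refine ⟨⟨_, hm⟩, Prod.ext rfl ?_⟩
    exact symbol_congr (by ring) _ _ rfl
  · rw [if_neg h.ne', zero_smul]
    have hm : Coalgebra.counit (R := K) (x : B) • (y : B) ∈ F (r + s - 1) :=
      Submodule.smul_mem _ _ (IsBialgebraFiltration.monotone (F := F) (by omega) y.2)
    refine ⟨⟨_, IsBialgebraFiltration.monotone (F := F) (by omega) hm⟩, Prod.ext rfl ?_⟩
    exact symbol_eq_zero _ hm

theorem rTensor_counit (z : ℤ) (x : F z) :
    TensorProduct.lid K _ ((counitHom F).rTensor _ (comulHom F (symbol F z x))) =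
      symbol F z x := by
  refine eq_of_mem_range ?_
  suffices H : tensorSymbol F z ≤ (LinearMap.range ((F z).subtype.prod (symbol F z))).comap
      (((TensorProduct.lid K B).toLinearMap ∘ₗ Coalgebra.counit.rTensor B).prodMap
        ((TensorProduct.lid K _).toLinearMap ∘ₗ (counitHom F).rTensor _)) by
    have := H (comulHom_spec z x)
    simpa using this
  refine Submodule.span_le.2 ?_
  rintro _ ⟨i, j, rfl, y, w, rfl⟩
  exact counit_symbol_mem y w

theorem lTensor_counit (z : ℤ) (x : F z) :
    TensorProduct.rid K _ ((counitHom F).lTensor _ (comulHom F (symbol F z x))) =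
      symbol F z x := by
  refine eq_of_mem_range ?_
  suffices H : tensorSymbol F z ≤ (LinearMap.range ((F z).subtype.prod (symbol F z))).comap
      (((TensorProduct.rid K B).toLinearMap ∘ₗ Coalgebra.counit.lTensor B).prodMap
        ((TensorProduct.rid K _).toLinearMap ∘ₗ (counitHom F).lTensor _)) by
    have := H (comulHom_spec z x)
    simpa using this
  refine Submodule.span_le.2 ?_
  rintro _ ⟨i, j, rfl, y, w, rfl⟩
  rw [add_comm i j]
  exact counit_symbol_mem w y

instance : Coalgebra K (AssocGraded F) where
  comul := comulHom F
  counit := counitHom F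
  coassoc := hom_ext fun z x => by
    refine tripleSymbol_unique IsBialgebraFiltration.monotone
      (coassoc_left_mem (comulHom_spec z x)) ?_
    have := coassoc_right_mem (comulHom_spec z x)
    rwa [← Coalgebra.coassoc_apply] at this
  rTensor_counit_comp_comul := hom_ext fun z x => by
    apply (TensorProduct.lid K _).injective
    simpa using rTensor_counit z x
  lTensor_counit_comp_comul := hom_ext fun z x => by
    apply (TensorProduct.rid K _).injective
    simpa using lTensor_counit z x

theorem comul_symbol_mem (z : ℤ) (x : F z) :
    (Coalgebra.comul (R := K) (x : B), Coalgebra.comul (R := K) (symbol F z x)) ∈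
      tensorSymbol F z :=
  comulHom_spec z x

theorem counit_symbol (z : ℤ) (x : F z) : Coalgebra.counit (R := K) (symbol F z x) =
    if z = 0 then Coalgebra.counit (R := K) (x : B) else 0 :=
  counitHom_symbol z x

theorem mul_mem_tensorSymbol {m n : ℤ} {p q : (B ⊗[K] B) × (AssocGraded F ⊗[K] AssocGraded F)}
    (hp : p ∈ tensorSymbol F m) (hq : q ∈ tensorSymbol F n) : p * q ∈ tensorSymbol F (m + n) := by
  induction hp using Submodule.span_induction with
  | zero => rw [zero_mul]; exact zero_mem _
  | add p p' _ _ h h' => rw [add_mul]; exact add_mem h h'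
  | smul c p _ h => rw [smul_mul_assoc]; exact Submodule.smul_mem _ c h
  | mem p hp =>
    obtain ⟨r, s, rfl, x, y, rfl⟩ := hp
    induction hq using Submodule.span_induction with
    | zero => rw [mul_zero]; exact zero_mem _
    | add p p' _ _ h h' => rw [mul_add]; exact add_mem h h'
    | smul c p _ h => rw [mul_smul_comm]; exact Submodule.smul_mem _ c h
    | mem q hq =>
      obtain ⟨r', s', rfl, x', y', rfl⟩ := hq
      refine Submodule.subset_span ⟨r + r', s + s', by ring,
        ⟨x * x', IsBialgebraFiltration.mul_mem x.2 x'.2⟩,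
        ⟨y * y', IsBialgebraFiltration.mul_mem y.2 y'.2⟩, ?_⟩
      simp [symbol_mul_symbol]

/-- `G_F(B)` is a bialgebra. -/
instance : Bialgebra K (AssocGraded F) :=
  Bialgebra.mk' K (AssocGraded F)
    (by rw [one_def, counit_symbol, if_pos rfl]; exact Bialgebra.counit_one)
    (by
      intro a b
      induction a using induction_on with
      | hadd a a' h h' => simp only [add_mul, map_add, h, h']
      | h m x =>
      induction b using induction_on with
      | hadd a a' h h' => simp only [mul_add, map_add, h, h']
      | h n y =>
      rw [symbol_mul_symbol, counit_symbol, counit_symbol, counit_symbol]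
      have hneg : ∀ k : ℤ, k < 0 → ∀ w : F k, Coalgebra.counit (R := K) (w : B) = 0 :=
        fun k hk w => IsBialgebraFiltration.counit_eq_zero (F := F)
          (IsBialgebraFiltration.monotone (F := F) (show k ≤ -1 by omega) w.2)
      simp only [Bialgebra.counit_mul]
      by_cases hm : m = 0
      · by_cases hn : n = 0
        · simp [hm, hn]
        · simp [hm, hn]
      · by_cases hmn : m + n = 0
        · rcases lt_or_gt_of_ne hm with h | h
          · rw [if_pos hmn, if_neg hm, hneg m h, zero_mul, zero_mul]
          · rw [if_pos hmn, if_neg hm, hneg n (by omega), mul_zero, zero_mul]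
        · rw [if_neg hmn, if_neg hm, zero_mul])
    (by
      rw [one_def]
      refine tensorSymbol_unique IsBialgebraFiltration.monotone (comul_symbol_mem 0 _) ?_
      refine Submodule.subset_span ⟨0, 0, rfl, ⟨1, IsBialgebraFiltration.one_mem⟩,
        ⟨1, IsBialgebraFiltration.one_mem⟩, ?_⟩
      simp [← one_def, Algebra.TensorProduct.one_def])
    (by
      intro a b
      induction a using induction_on with
      | hadd a a' h h' => simp only [add_mul, map_add, h, h']
      | h m x =>
      induction b using induction_on with
      | hadd a a' h h' => simp only [mul_add, map_add, h, h']
      | h n y =>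
      rw [symbol_mul_symbol]
      refine tensorSymbol_unique IsBialgebraFiltration.monotone (comul_symbol_mem _ _) ?_
      have := mul_mem_tensorSymbol (comul_symbol_mem m x) (comul_symbol_mem n y)
      simpa [Bialgebra.comul_mul] using this)

end Coalgebra

end AssocGraded
end GradedObject

section LieTheory

variable (K : Type u) [Field K] (p : ℕ) (g : Type v) [LieRing g] [LieAlgebra K g]

variable {K g} in
/-- `adPowCoeff x y n j` is the coefficient of `t ^ j` in `ad (t x + y) ^ n (x)`. -/
def adPowCoeff (x y : g) : ℕ → ℕ → g
  | 0, 0 => x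
  | 0, _ + 1 => 0
  | n + 1, 0 => ⁅y, adPowCoeff x y n 0⁆
  | n + 1, j + 1 => ⁅y, adPowCoeff x y n (j + 1)⁆ + ⁅x, adPowCoeff x y n j⁆

variable {g} in
/-- Jacobson's sum `∑_{i=1}^{p-1} s_i(x, y)`, where `i s_i(x, y)` is the coefficient of
`t ^ (i-1)` in `ad (t x + y) ^ (p-1) (x)`. -/
def jacobsonSum (x y : g) : g :=
  ∑ i ∈ Finset.Icc 1 (p - 1), ((i : K)⁻¹) • adPowCoeff x y (p - 1) (i - 1)

/-- A restricted Lie algebra structure on a Lie algebra over a field of characteristic `p`, given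
by its `p`-operation `x ↦ x^[p]`. If `p = 0` there is no condition: the `p`-operation is then a
dummy, which plays no role, and "restricted Lie algebra" just means "Lie algebra". -/
structure RestrictedLieStructure where
  pMap : g → g
  pMap_smul : p ≠ 0 → ∀ (c : K) (x : g), pMap (c • x) = c ^ p • pMap x
  pMap_add : p ≠ 0 → ∀ x y : g, pMap (x + y) = pMap x + pMap y + jacobsonSum K p x y
  pMap_lie : p ≠ 0 → ∀ x y : g, ⁅pMap x, y⁆ = ((LieAlgebra.ad K g x) ^ p) y

variable {K}

/-- The cyclic permutation `a ⊗ b ⊗ c ↦ b ⊗ c ⊗ a`. -/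
def cyclicPerm (K : Type u) [Field K] (V : Type v) [AddCommGroup V] [Module K V] :
    (V ⊗[K] V) ⊗[K] V →ₗ[K] (V ⊗[K] V) ⊗[K] V :=
  (TensorProduct.comm K V (V ⊗[K] V)).toLinearMap ∘ₗ (TensorProduct.assoc K V V V).toLinearMap

/-- A Lie cobracket: a linear map `δ : V → V ⊗ V` with image in the alternating tensors
`a ⊗ b - b ⊗ a` that satisfies the co-Jacobi identity. -/
structure IsLieCobracket {V : Type v} [AddCommGroup V] [Module K V] (δ : V →ₗ[K] V ⊗[K] V) :
    Prop where
  alternating : LinearMap.range δ ≤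
    LinearMap.range (LinearMap.id - (TensorProduct.comm K V V).toLinearMap)
  coJacobi : ∀ x : V, δ.rTensor V (δ x) + cyclicPerm K V (δ.rTensor V (δ x)) +
    cyclicPerm K V (cyclicPerm K V (δ.rTensor V (δ x))) = 0

variable (K)

/-- A restricted Lie bialgebra: a restricted Lie algebra with a Lie cobracket `δ` that is a
`1`-cocycle with values in `g ⊗ g`, compatible with the `p`-operation if `p > 0`. -/
structure RestrictedLieBialgebra extends RestrictedLieStructure K p g where
  cobracket : g →ₗ[K] g ⊗[K] g
  isLieCobracket : IsLieCobracket cobracket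
  cobracket_lie : ∀ x y : g, cobracket ⁅x, y⁆ = ⁅x, cobracket y⁆ - ⁅y, cobracket x⁆
  cobracket_pMap : p ≠ 0 → ∀ x : g,
    cobracket (pMap x) = ((LieModule.toEnd K g (g ⊗[K] g) x) ^ (p - 1)) (cobracket x)

variable {K p g}

/-- The relations `x ^ p = x^[p]`, `x ∈ g` (no relation if `p = 0`). -/
inductive EnvelopingRel (𝔤 : RestrictedLieStructure K p g) :
    UniversalEnvelopingAlgebra K g → UniversalEnvelopingAlgebra K g → Prop
  | pow (hp : p ≠ 0) (x : g) : EnvelopingRel 𝔤 (UniversalEnvelopingAlgebra.ι K x ^ p)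
      (UniversalEnvelopingAlgebra.ι K (𝔤.pMap x))

/-- The enveloping algebra `𝒰(g)`: the universal enveloping algebra `U(g)` if `p = 0`, and the
restricted universal enveloping algebra `u(g) = U(g) / (x ^ p - x^[p] | x ∈ g)` if `p > 0`. -/
def Enveloping (𝔤 : RestrictedLieStructure K p g) : Type (max u v) := RingQuot (EnvelopingRel 𝔤)

namespace Enveloping

variable (𝔤 : RestrictedLieStructure K p g)

instance : Ring (Enveloping 𝔤) := inferInstanceAs (Ring (RingQuot (EnvelopingRel 𝔤)))

instance : Algebra K (Enveloping 𝔤) :=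
  inferInstanceAs (Algebra K (RingQuot (EnvelopingRel 𝔤)))

/-- The canonical map `U(g) → 𝒰(g)`. -/
def mk : UniversalEnvelopingAlgebra K g →ₐ[K] Enveloping 𝔤 :=
  RingQuot.mkAlgHom K (EnvelopingRel 𝔤)

attribute [local instance] LieRing.ofAssociativeRing in
/-- The canonical map `g → 𝒰(g)`. -/
def ι : g →ₗ[K] Enveloping 𝔤 :=
  (mk 𝔤).toLinearMap ∘ₗ
    ((UniversalEnvelopingAlgebra.ι K : g →ₗ⁅K⁆ UniversalEnvelopingAlgebra K g) :
      g →ₗ[K] UniversalEnvelopingAlgebra K g)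

attribute [local instance] LieRing.ofAssociativeRing in
theorem ι_lie (x y : g) : ι 𝔤 ⁅x, y⁆ = ι 𝔤 x * ι 𝔤 y - ι 𝔤 y * ι 𝔤 x := by
  have := (UniversalEnvelopingAlgebra.ι K (L := g)).map_lie x y
  rw [LieRing.of_associative_ring_bracket] at this
  exact (congrArg (mk 𝔤) this).trans (by rw [map_sub, map_mul, map_mul]; rfl)

theorem ι_pow (hp : p ≠ 0) (x : g) : ι 𝔤 x ^ p = ι 𝔤 (𝔤.pMap x) := by
  have := RingQuot.mkAlgHom_rel K (EnvelopingRel.pow (𝔤 := 𝔤) hp x)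
  rw [map_pow] at this
  exact this

variable {𝔤}

variable {A : Type w} [Ring A] [Algebra K A]

attribute [local instance] LieRing.ofAssociativeRing in
/-- The universal property of `𝒰(g)`. -/
def lift (f : g →ₗ[K] A) (hf : ∀ x y, f ⁅x, y⁆ = f x * f y - f y * f x)
    (hp : p ≠ 0 → ∀ x, f x ^ p = f (𝔤.pMap x)) : Enveloping 𝔤 →ₐ[K] A :=
  RingQuot.liftAlgHom K ⟨UniversalEnvelopingAlgebra.lift K
    { f with map_lie' := fun {x y} => hf x y }, by
      rintro _ _ ⟨h, x⟩
      rw [map_pow, UniversalEnvelopingAlgebra.lift_ι_apply,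
        UniversalEnvelopingAlgebra.lift_ι_apply]
      exact hp h x⟩

attribute [local instance] LieRing.ofAssociativeRing in
@[simp] theorem lift_ι (f : g →ₗ[K] A) (hf : ∀ x y, f ⁅x, y⁆ = f x * f y - f y * f x)
    (hp : p ≠ 0 → ∀ x, f x ^ p = f (𝔤.pMap x)) (x : g) : lift f hf hp (ι 𝔤 x) = f x := by
  refine (RingQuot.liftAlgHom_mkAlgHom_apply _ _ _ _).trans ?_
  exact UniversalEnvelopingAlgebra.lift_ι_apply K _ x

attribute [local instance] LieRing.ofAssociativeRing in
theorem hom_ext {f f' : Enveloping 𝔤 →ₐ[K] A} (h : ∀ x, f (ι 𝔤 x) = f' (ι 𝔤 x)) : f = f' := by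
  refine RingQuot.ringQuot_ext' _ _ _ (UniversalEnvelopingAlgebra.hom_ext K ?_)
  apply LieHom.ext
  intro x
  exact h x

theorem induction_on {P : Enveloping 𝔤 → Prop} (a : Enveloping 𝔤)
    (halg : ∀ c, P (algebraMap K _ c)) (hι : ∀ x, P (ι 𝔤 x))
    (hmul : ∀ a b, P a → P b → P (a * b)) (hadd : ∀ a b, P a → P b → P (a + b)) : P a := by
  let S : Subalgebra K (Enveloping 𝔤) :=
    { carrier := {a | P a}
      mul_mem' := fun ha hb => hmul _ _ ha hb
      add_mem' := fun ha hb => hadd _ _ ha hb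
      algebraMap_mem' := halg }
  let f : Enveloping 𝔤 →ₐ[K] S := lift ((ι 𝔤).codRestrict (Subalgebra.toSubmodule S) hι)
    (fun x y => Subtype.ext (ι_lie 𝔤 x y)) (fun hp x => Subtype.ext (ι_pow 𝔤 hp x))
  have h : S.val.comp f = AlgHom.id K _ := hom_ext fun x => by
    simp only [AlgHom.comp_apply, f, lift_ι]; rfl
  have := AlgHom.congr_fun h a
  rw [AlgHom.id_apply] at this
  rw [← this]
  exact (f a).2

variable (𝔤)

/-- The counit of `𝒰(g)`, given by `x ↦ 0` for `x ∈ g`. -/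
def counitAlgHom : Enveloping 𝔤 →ₐ[K] K :=
  lift 0 (by simp) (fun hp x => by simp [hp])

@[simp] theorem counitAlgHom_ι (x : g) : counitAlgHom 𝔤 (ι 𝔤 x) = 0 := by
  simp [counitAlgHom]

variable [CharP K p]

/-- The coproduct of `𝒰(g)`, given by `x ↦ x ⊗ 1 + 1 ⊗ x` for `x ∈ g`. -/
def comulAlgHom : Enveloping 𝔤 →ₐ[K] Enveloping 𝔤 ⊗[K] Enveloping 𝔤 :=
  lift (((TensorProduct.mk K (Enveloping 𝔤) (Enveloping 𝔤)).flip 1 +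
      TensorProduct.mk K (Enveloping 𝔤) (Enveloping 𝔤) 1) ∘ₗ ι 𝔤)
    (fun x y => by
      simp only [LinearMap.comp_apply, LinearMap.add_apply, LinearMap.flip_apply,
        TensorProduct.mk_apply, ι_lie, mul_add, add_mul, Algebra.TensorProduct.tmul_mul_tmul,
        mul_one, one_mul, TensorProduct.sub_tmul, TensorProduct.tmul_sub]
      abel)
    (fun hp x => by
      have : Fact p.Prime := ⟨(CharP.char_is_prime_or_zero K p).resolve_right hp⟩
      have : CharP (Enveloping 𝔤 ⊗[K] Enveloping 𝔤) p := by
        have : Nontrivial (Enveloping 𝔤 ⊗[K] Enveloping 𝔤) :=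
          (Algebra.TensorProduct.lift (counitAlgHom 𝔤) (counitAlgHom 𝔤)
            (fun _ _ => Commute.all _ _)).toRingHom.domain_nontrivial
        exact charP_of_injective_algebraMap
          (algebraMap K (Enveloping 𝔤 ⊗[K] Enveloping 𝔤)).injective p
      simp only [LinearMap.comp_apply, LinearMap.add_apply, LinearMap.flip_apply,
        TensorProduct.mk_apply]
      rw [add_pow_char_of_commute]
      · simp only [Algebra.TensorProduct.tmul_pow, one_pow, ι_pow 𝔤 hp]
      · simp [Commute, SemiconjBy])

@[simp] theorem comulAlgHom_ι (x : g) :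
    comulAlgHom 𝔤 (ι 𝔤 x) = ι 𝔤 x ⊗ₜ[K] 1 + 1 ⊗ₜ[K] ι 𝔤 x := by
  simp [comulAlgHom]

instance : Bialgebra K (Enveloping 𝔤) :=
  Bialgebra.ofAlgHom (comulAlgHom 𝔤) (counitAlgHom 𝔤)
    (hom_ext fun x => by
      simp only [AlgHom.comp_apply, comulAlgHom_ι, map_add, Algebra.TensorProduct.map_tmul,
        map_one, AlgHom.id_apply, TensorProduct.add_tmul, TensorProduct.tmul_add,
        Algebra.TensorProduct.one_def]
      simp [add_assoc])
    (hom_ext fun x => by simp)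
    (hom_ext fun x => by simp)

@[simp] theorem comul_ι (x : g) : Coalgebra.comul (R := K) (ι 𝔤 x) =
    ι 𝔤 x ⊗ₜ[K] 1 + 1 ⊗ₜ[K] ι 𝔤 x :=
  comulAlgHom_ι 𝔤 x

@[simp] theorem counit_ι (x : g) : Coalgebra.counit (R := K) (ι 𝔤 x) = 0 :=
  counitAlgHom_ι 𝔤 x

/-- The antipode of `𝒰(g)`, given by `x ↦ -x` for `x ∈ g`, as an antihomomorphism. -/
def antipodeAlgHom : Enveloping 𝔤 →ₐ[K] (Enveloping 𝔤)ᵐᵒᵖ :=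
  lift (-((MulOpposite.opLinearEquiv K).toLinearMap ∘ₗ ι 𝔤))
    (fun x y => by
      apply MulOpposite.unop_injective
      simp [ι_lie])
    (fun hp x => by
      have : Fact p.Prime := ⟨(CharP.char_is_prime_or_zero K p).resolve_right hp⟩
      have : CharP (Enveloping 𝔤) p := by
        have : Nontrivial (Enveloping 𝔤) := (counitAlgHom 𝔤).toRingHom.domain_nontrivial
        exact charP_of_injective_algebraMap (algebraMap K (Enveloping 𝔤)).injective p
      apply MulOpposite.unop_injective
      simp [neg_pow (ι 𝔤 x), neg_one_pow_char, ι_pow 𝔤 hp])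

/-- The antipode of `𝒰(g)`. -/
def antipodeHom : Enveloping 𝔤 →ₗ[K] Enveloping 𝔤 :=
  (MulOpposite.opLinearEquiv K).symm.toLinearMap ∘ₗ (antipodeAlgHom 𝔤).toLinearMap

@[simp] theorem antipodeHom_ι (x : g) : antipodeHom 𝔤 (ι 𝔤 x) = -ι 𝔤 x := by
  simp [antipodeHom, antipodeAlgHom]

theorem antipodeHom_mul (a b : Enveloping 𝔤) :
    antipodeHom 𝔤 (a * b) = antipodeHom 𝔤 b * antipodeHom 𝔤 a := by
  simp [antipodeHom]

@[simp] theorem antipodeHom_algebraMap (c : K) :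
    antipodeHom 𝔤 (algebraMap K _ c) = algebraMap K _ c := by
  simp [antipodeHom]

theorem antipode_left_mul (t w : Enveloping 𝔤 ⊗[K] Enveloping 𝔤) (c : K)
    (h : LinearMap.mul' K _ ((antipodeHom 𝔤).rTensor _ t) = algebraMap K _ c) :
    LinearMap.mul' K _ ((antipodeHom 𝔤).rTensor _ (t * w)) =
      c • LinearMap.mul' K _ ((antipodeHom 𝔤).rTensor _ w) := by
  induction w using TensorProduct.induction_on with
  | zero => simp
  | add w w' h h' => simp only [mul_add, map_add, smul_add, h, h']
  | tmul b b' =>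
    have key : LinearMap.mul' K _ ((antipodeHom 𝔤).rTensor _ (t * (b ⊗ₜ[K] b'))) =
        antipodeHom 𝔤 b * LinearMap.mul' K _ ((antipodeHom 𝔤).rTensor _ t) * b' := by
      clear h
      induction t using TensorProduct.induction_on with
      | zero => simp
      | add w w' h h' => simp only [mul_add, add_mul, map_add, h, h']
      | tmul a a' => simp [antipodeHom_mul, mul_assoc]
    rw [key, h, ← Algebra.commutes, mul_assoc, ← Algebra.smul_def]
    simp

theorem antipode_right_mul (t w : Enveloping 𝔤 ⊗[K] Enveloping 𝔤) (c : K)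
    (h : LinearMap.mul' K _ ((antipodeHom 𝔤).lTensor _ w) = algebraMap K _ c) :
    LinearMap.mul' K _ ((antipodeHom 𝔤).lTensor _ (t * w)) =
      c • LinearMap.mul' K _ ((antipodeHom 𝔤).lTensor _ t) := by
  induction t using TensorProduct.induction_on with
  | zero => simp
  | add w w' h h' => simp only [add_mul, map_add, smul_add, h, h']
  | tmul b b' =>
    have key : LinearMap.mul' K _ ((antipodeHom 𝔤).lTensor _ ((b ⊗ₜ[K] b') * w)) =
        b * LinearMap.mul' K _ ((antipodeHom 𝔤).lTensor _ w) * antipodeHom 𝔤 b' := by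
      clear h
      induction w using TensorProduct.induction_on with
      | zero => simp
      | add w w' h h' => simp only [mul_add, add_mul, map_add, h, h']
      | tmul a a' => simp [antipodeHom_mul, mul_assoc]
    rw [key, h, ← Algebra.commutes, mul_assoc, ← Algebra.smul_def]
    simp

/-- `𝒰(g)` is a Hopf algebra. -/
instance : HopfAlgebra K (Enveloping 𝔤) where
  antipode := antipodeHom 𝔤
  mul_antipode_rTensor_comul := by
    ext a
    simp only [LinearMap.comp_apply, Algebra.linearMap_apply]
    induction a using induction_on with
    | halg c => simp [Algebra.algebraMap_eq_smul_one, Algebra.TensorProduct.one_def,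
        show antipodeHom 𝔤 1 = 1 by simpa using antipodeHom_algebraMap 𝔤 1]
    | hι x => simp [show antipodeHom 𝔤 1 = 1 by simpa using antipodeHom_algebraMap 𝔤 1]
    | hadd a b ha hb => simp only [map_add, ha, hb]
    | hmul a b ha hb =>
      rw [Bialgebra.comul_mul, antipode_left_mul 𝔤 _ _ _ ha, hb, Bialgebra.counit_mul, map_mul,
        Algebra.smul_def]
  mul_antipode_lTensor_comul := by
    ext a
    simp only [LinearMap.comp_apply, Algebra.linearMap_apply]
    induction a using induction_on with
    | halg c => simp [Algebra.algebraMap_eq_smul_one, Algebra.TensorProduct.one_def,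
        show antipodeHom 𝔤 1 = 1 by simpa using antipodeHom_algebraMap 𝔤 1]
    | hι x => simp [show antipodeHom 𝔤 1 = 1 by simpa using antipodeHom_algebraMap 𝔤 1]
    | hadd a b ha hb => simp only [map_add, ha, hb]
    | hmul a b ha hb =>
      rw [Bialgebra.comul_mul, antipode_right_mul 𝔤 _ _ _ hb, ha, Bialgebra.counit_mul, map_mul,
        Algebra.smul_def, Algebra.commutes]

end Enveloping
end LieTheory

section HopfNotions

variable {K : Type u} [Field K] {H : Type v} [Ring H] [Bialgebra K H]

/-- `S` is an antipode of the bialgebra `H`, so that `H` is a Hopf algebra with antipode `S`. -/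
structure IsAntipode (S : H →ₗ[K] H) : Prop where
  left : LinearMap.mul' K H ∘ₗ S.rTensor H ∘ₗ Coalgebra.comul =
    Algebra.linearMap K H ∘ₗ Coalgebra.counit
  right : LinearMap.mul' K H ∘ₗ S.lTensor H ∘ₗ Coalgebra.comul =
    Algebra.linearMap K H ∘ₗ Coalgebra.counit

/-- `H = ⨁_z 𝒜_z` is a grading of the Hopf algebra `H` (with antipode `S`): all the structure maps
of `H` have degree `0`. -/
structure IsGradedHopf (S : H →ₗ[K] H) (𝒜 : ℤ → Submodule K H) : Prop where
  isInternal : DirectSum.IsInternal 𝒜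
  one_mem : (1 : H) ∈ 𝒜 0
  mul_mem : ∀ {m n : ℤ} {a b : H}, a ∈ 𝒜 m → b ∈ 𝒜 n → a * b ∈ 𝒜 (m + n)
  counit_eq_zero : ∀ {n : ℤ} {a : H}, n ≠ 0 → a ∈ 𝒜 n → Coalgebra.counit (R := K) a = 0
  comul_mem : ∀ {n : ℤ} {a : H}, a ∈ 𝒜 n → Coalgebra.comul (R := K) a ∈ tensorDegree 𝒜 n
  antipode_mem : ∀ {n : ℤ} {a : H}, a ∈ 𝒜 n → S a ∈ 𝒜 n

/-- The set `P(H)` of primitive elements. -/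
def primitives (K : Type u) [Field K] (H : Type v) [Ring H] [Bialgebra K H] : Set H :=
  {a | Coalgebra.comul (R := K) a = a ⊗ₜ[K] 1 + 1 ⊗ₜ[K] a}

/-- The bracket `{a ⊗ b, c ⊗ d} = {a, c} ⊗ b d + a c ⊗ {b, d}` on `H ⊗ H`. -/
def tensorBracket (br : H →ₗ[K] H →ₗ[K] H) :
    H ⊗[K] H →ₗ[K] H ⊗[K] H →ₗ[K] H ⊗[K] H :=
  TensorProduct.map₂ br (LinearMap.mul K H) + TensorProduct.map₂ (LinearMap.mul K H) br

/-- The Hopf algebra `H` (with antipode `S`) is a (commutative) Poisson Hopf algebra with respect to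
the bracket `br`. -/
structure IsPoissonHopf (S : H →ₗ[K] H) (br : H →ₗ[K] H →ₗ[K] H) : Prop where
  mul_comm : ∀ a b : H, a * b = b * a
  bracket_self : ∀ a, br a a = 0
  jacobi : ∀ a b c, br a (br b c) + br b (br c a) + br c (br a b) = 0
  leibniz_left : ∀ a b c, br (a * b) c = br a c * b + a * br b c
  leibniz_right : ∀ a b c, br a (b * c) = br a b * c + b * br a c
  comul_bracket : ∀ a b, Coalgebra.comul (R := K) (br a b) =
    tensorBracket br (Coalgebra.comul a) (Coalgebra.comul b)
  counit_bracket : ∀ a b, Coalgebra.counit (R := K) (br a b) = 0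
  antipode_bracket : ∀ a b, S (br a b) = br (S b) (S a)

/-- The Hopf algebra `H` (with antipode `S`) is a (cocommutative) co-Poisson Hopf algebra with
respect to the cobracket `δ`. -/
structure IsCoPoissonHopf (S : H →ₗ[K] H) (δ : H →ₗ[K] H ⊗[K] H) : Prop where
  cocomm : Coalgebra.IsCocomm K H
  isLieCobracket : IsLieCobracket δ
  coLeibniz : ∀ a, Coalgebra.comul.lTensor H (δ a) =
    TensorProduct.assoc K H H H (δ.rTensor H (Coalgebra.comul a)) +
      TensorProduct.leftComm K H H H (δ.lTensor H (Coalgebra.comul a))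
  cobracket_mul : ∀ a b, δ (a * b) =
    δ a * Coalgebra.comul (R := K) b + Coalgebra.comul (R := K) a * δ b
  counit_cobracket : ∀ a,
    TensorProduct.map (Coalgebra.counit (R := K)) (Coalgebra.counit (R := K)) (δ a) = 0
  antipode_cobracket : ∀ a, δ (S a) = TensorProduct.comm K H H (TensorProduct.map S S (δ a))

end HopfNotions

section GradedStructures

variable {K : Type u} [Field K] {p : ℕ} {g : Type v} [LieRing g] [LieAlgebra K g]

/-- `g = ⨁_n 𝓛_n` is a grading of the restricted Lie bialgebra `g`: the Lie bracket has degree `0`,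
the `p`-operation (if `p > 0`) multiplies degrees by `p`, the Lie cobracket has degree `+1`. -/
structure RestrictedLieBialgebra.IsGraded (𝔤 : RestrictedLieBialgebra K p g)
    (𝓛 : ℤ → Submodule K g) : Prop where
  isInternal : DirectSum.IsInternal 𝓛
  lie_mem : ∀ {m n : ℤ} {x y : g}, x ∈ 𝓛 m → y ∈ 𝓛 n → ⁅x, y⁆ ∈ 𝓛 (m + n)
  pMap_mem : p ≠ 0 → ∀ {n : ℤ} {x : g}, x ∈ 𝓛 n → 𝔤.pMap x ∈ 𝓛 (p * n)
  cobracket_mem : ∀ {n : ℤ} {x : g}, x ∈ 𝓛 n → 𝔤.cobracket x ∈ tensorDegree 𝓛 (n + 1)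

/-- The grading of `𝒰(g)` induced by a grading of `g`: the degree `n` part is spanned by the
products `x₁ ⋯ x_k` of homogeneous elements of `g` whose degrees add up to `n`. -/
def Enveloping.degreePart (𝔤 : RestrictedLieStructure K p g) (𝓛 : ℤ → Submodule K g) (n : ℤ) :
    Submodule K (Enveloping 𝔤) :=
  Submodule.span K {a | ∃ l : List (ℤ × g), (∀ q ∈ l, q.2 ∈ 𝓛 q.1) ∧
    (l.map Prod.fst).sum = n ∧ a = (l.map fun q => Enveloping.ι 𝔤 q.2).prod}

end GradedStructures

section AssociatedBrackets

variable {K : Type u} [Field K] {B : Type v} [Ring B] [Bialgebra K B]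
  (F : ℤ → Submodule K B) [IsBialgebraFiltration F]

/-- `br` is the bracket on `G_F(B)` induced by the commutator of `B`: for `x ∈ F_m`, `y ∈ F_n` one
has `x y - y x ∈ F_{m+n-1}`, and `br` sends the classes of `x` and `y` in degrees `m` and `n` to the
class of `x y - y x` in degree `m + n - 1`. -/
def IsInducedBracket (br : AssocGraded F →ₗ[K] AssocGraded F →ₗ[K] AssocGraded F) : Prop :=
  ∀ (m n : ℤ) (x : F m) (y : F n), ∃ h : (x : B) * y - y * x ∈ F (m + n - 1),
    br (AssocGraded.symbol F m x) (AssocGraded.symbol F n y) =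
      AssocGraded.symbol F (m + n - 1) ⟨(x : B) * y - y * x, h⟩

/-- `δ` is the cobracket on `G_F(B)` induced by `∇ = Δ - Δᵒᵖ`: for `x ∈ F_z` one has
`∇ x ∈ ∑_{r+s=z-1} F_r ⊗ F_s`, and `δ` sends the class of `x` in degree `z` to the class of `∇ x` in
degree `z - 1`. -/
def IsInducedCobracket (δ : AssocGraded F →ₗ[K] AssocGraded F ⊗[K] AssocGraded F) : Prop :=
  ∀ (z : ℤ) (x : F z),
    (Coalgebra.comul (R := K) (x : B) - TensorProduct.comm K B B (Coalgebra.comul (x : B)),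
      δ (AssocGraded.symbol F z x)) ∈ AssocGraded.tensorSymbol F (z - 1)

end AssociatedBrackets

section Filtrations

variable (K : Type u) [Field K] (B : Type v) [Ring B] [Bialgebra K B]

/-- The augmentation ideal `J = Ker ε`. -/
def augmentationIdeal : Submodule K B := LinearMap.ker (Coalgebra.counit : B →ₗ[K] K)

/-- The `ε`-filtration: `J_{-n} = Jⁿ` for `n > 0`, and `J_n = B` for `n ≥ 0`. -/
def epsilonFiltration (z : ℤ) : Submodule K B :=
  if 0 ≤ z then ⊤ else augmentationIdeal K B ^ (-z).toNat

/-- The iterated coproduct `Δⁿ : B → B^{⊗ n}` (`Δ⁰ = ε`, `Δ¹ = id`, `Δ² = Δ`, ...). -/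
def iteratedComul : (n : ℕ) → B →ₗ[K] ⨂[K]^n B
  | 0 => (TensorPower.algebraMap₀ (R := K) (M := B)).toLinearMap ∘ₗ Coalgebra.counit
  | n + 1 => (TensorPower.mulEquiv (R := K) (M := B)).toLinearMap ∘ₗ
      TensorProduct.map (iteratedComul n)
        (PiTensorProduct.subsingletonEquiv (R := K) (s := fun _ : Fin 1 => B) 0).symm.toLinearMap ∘ₗ
      Coalgebra.comul

/-- Drinfeld's maps `δ_n = (id - u ∘ ε)^{⊗ n} ∘ Δⁿ : B → B^{⊗ n}`. -/
def drinfeldMap (n : ℕ) : B →ₗ[K] ⨂[K]^n B :=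
  PiTensorProduct.map (fun _ : Fin n =>
    (LinearMap.id - Algebra.linearMap K B ∘ₗ Coalgebra.counit : B →ₗ[K] B)) ∘ₗ iteratedComul K B n

/-- The `δ_•`-filtration: `D_n = Ker δ_{n+1}` for `n ≥ 0`, and `D_n = 0` for `n < 0`. -/
def deltaFiltration (z : ℤ) : Submodule K B :=
  if 0 ≤ z then LinearMap.ker (drinfeldMap K B (z.toNat + 1)) else ⊥

end Filtrations

/-- An affine algebraic Poisson group `G` over `K` (not necessarily reduced or of finite type). By
the antiequivalence between commutative Hopf algebras and affine group schemes it is given by its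
function algebra `F[G]`, a commutative Poisson Hopf algebra; `G` is the spectrum of `F[G]`. -/
structure PoissonGroup (K : Type u) [Field K] where
  functionAlgebra : Type v
  [commRing : CommRing functionAlgebra]
  [hopfAlgebra : HopfAlgebra K functionAlgebra]
  bracket : functionAlgebra →ₗ[K] functionAlgebra →ₗ[K] functionAlgebra
  isPoissonHopf : IsPoissonHopf (HopfAlgebra.antipode K) bracket

namespace PoissonGroup

attribute [instance] PoissonGroup.commRing PoissonGroup.hopfAlgebra

variable {K : Type u} [Field K] (G : PoissonGroup.{u, v} K)

/-- `G` is connected: `F[G]` has no non-trivial idempotents. -/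
def IsConnected : Prop := ∀ e : G.functionAlgebra, e * e = e → e = 0 ∨ e = 1

/-- `F[G]` is a polynomial algebra (in possibly infinitely many variables); equivalently, `G` is a
(pro)affine space as a variety. -/
def IsAffineSpace : Prop :=
  ∃ I : Type v, Nonempty (G.functionAlgebra ≃ₐ[K] MvPolynomial I K)

/-- `F[G]` is a truncated polynomial algebra `K[x_i] / (x_i ^ p)`. -/
def IsTruncatedPolynomial (p : ℕ) : Prop :=
  ∃ I : Type v, Nonempty (G.functionAlgebra ≃ₐ[K]
    MvPolynomial I K ⧸ Ideal.span (Set.range fun i : I => (MvPolynomial.X i : MvPolynomial I K) ^ p))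

/-- The dimension of `G`. -/
def dim : WithBot ℕ∞ := ringKrullDim G.functionAlgebra

/-- `G` has height (at most) `1` in characteristic `p > 0`: the `p`-th powers of the functions
vanishing at the unit element of `G` are zero. -/
def HasHeightOne (p : ℕ) : Prop :=
  ∀ f : G.functionAlgebra, Coalgebra.counit (R := K) f = 0 → f ^ p = 0

/-- `G = {1}`, i.e. `F[G] = K`. -/
def IsTrivial : Prop := Function.Bijective (algebraMap K G.functionAlgebra)

end PoissonGroup

end CrystalDuality

end

open CrystalDuality

/-! Write `∂x = Δx - x ⊗ 1` (`comulSubTmulOne`). The δ_•-filtration is governed by one recursion: `x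
∈ D_n` iff `∂x ∈ D_{n-1} ⊗ B` (`mem_deltaFiltration_iff`). The image under `∂` of a product, a
commutator or a `p`-th power expands into terms whose left factors have smaller degree, so induction
gives `D_m D_n ⊆ D_{m+n}`, `[D_m, D_n] ⊆ D_{m+n-1}` and, if `p > 0` and `n ≥ 1`, `x^p ∈ D_{pn-1}`
for `x ∈ D_n`; coassociativity gives the compatibility with `Δ`. Hence the graded bialgebra is
commutative and Poisson, and in characteristic `p > 0` the `p`-th powers of its elements of positive
degree vanish.

For the ε-filtration, `∇ = Δ - Δᵒᵖ` takes values in `J ⊗ J`, and therefore raises the order of `J^n`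
by one. Hence the graded bialgebra is cocommutative and carries a cobracket. It is generated by
`J/J²`, which consists of primitive elements, as no positive degree is smaller than one.

Both graded bialgebras are connected: they live in degrees `≥ 0`, with only scalars in degree `0`.
So they are conilpotent, and the convolution geometric series of `uε - id` is locally finite and
gives the antipode (`exists_isAntipode`).

The structure theorems rest on one independence result, `eq_zero_of_aeval_eq_zero`. In a commutative
bialgebra with augmentation ideal `I`, let `x_i ∈ I` and let `d_i` be point derivations at the
counit with `d_i(x_j) = δ_ij`. The invariant derivation `(id ⊗ d_i)Δ` acts on polynomials in the
`x_j` like `∂/∂X_i`, up to higher powers of `I`; therefore the monomials whose exponents have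
invertible factorials are linearly independent. For the δ_•-filtration the `x_i` are homogeneous
lifts of a basis of `I/I²`, and they generate (`IsConnectedGrading.exists_generators`). In
characteristic `0` evaluation at the `x_i` is then an isomorphism from a polynomial algebra; in
characteristic `p` its kernel is generated by the `X_i^p`.

For the ε-filtration, any bialgebra `H` generated by its space `P` of primitive elements is `𝒰(P)`
(`envelopingToHopf_bijective`). Standard monomials with reduced exponents span `𝒰(P)` modulo shorter
ones. Their images in `H` are separated by their symbols in the graded algebra of the δ_•-filtration
of `H` itself: elements of `P` have degree one there, that algebra is commutative, and the same
independence result applies.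

If `p = 0` and `B` is finite dimensional, only finitely many components are non-zero. The lowest one
of positive degree would consist of primitive elements, and in characteristic `0` a non-zero
primitive element is not nilpotent, so there is no such component (`IsConnectedGrading.bot_eq_top`).
-/

noncomputable section

namespace CrystalDuality

/-! ### Subspaces `V ⊗ W` of a tensor product over a field. -/

section TensorSub

variable {K : Type*} [Field K] {M N M' N' : Type*} [AddCommGroup M] [Module K M]
  [AddCommGroup N] [Module K N] [AddCommGroup M'] [Module K M'] [AddCommGroup N'] [Module K N']

/-- The subspace `V ⊗ W` of `M ⊗ N`. -/
def tensorSub (V : Submodule K M) (W : Submodule K N) : Submodule K (M ⊗[K] N) :=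
  Submodule.map₂ (TensorProduct.mk K M N) V W

theorem tmul_mem_tensorSub {V : Submodule K M} {W : Submodule K N} {x : M} {y : N}
    (hx : x ∈ V) (hy : y ∈ W) : x ⊗ₜ[K] y ∈ tensorSub V W :=
  Submodule.apply_mem_map₂ _ hx hy

theorem tensorSub_le {V : Submodule K M} {W : Submodule K N} {P : Submodule K (M ⊗[K] N)}
    (h : ∀ x ∈ V, ∀ y ∈ W, x ⊗ₜ[K] y ∈ P) : tensorSub V W ≤ P :=
  Submodule.map₂_le.2 h

theorem tensorSub_mono {V V' : Submodule K M} {W W' : Submodule K N} (hV : V ≤ V') (hW : W ≤ W') :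
    tensorSub V W ≤ tensorSub V' W' :=
  Submodule.map₂_le_map₂ hV hW

/-- Factor `f` through its range. The inclusion of the range stays injective after tensoring by
flatness over a field, and the surjection onto the range is handled by right exactness. -/
theorem rTensor_apply_eq_zero_iff (f : M →ₗ[K] M') (t : M ⊗[K] N) :
    f.rTensor N t = 0 ↔ t ∈ tensorSub (LinearMap.ker f) ⊤ := by
  constructor
  · intro h
    have h1 : f.rangeRestrict.rTensor N t = 0 := by
      apply Module.Flat.rTensor_preserves_injective_linearMap (M := N)
        (LinearMap.range f).subtype (Submodule.injective_subtype _)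
      rw [← LinearMap.comp_apply, ← LinearMap.rTensor_comp, map_zero]
      exact h
    have hex : Function.Exact (LinearMap.ker f).subtype f.rangeRestrict := by
      rw [LinearMap.exact_iff, LinearMap.ker_rangeRestrict, Submodule.range_subtype]
    obtain ⟨s, rfl⟩ := (rTensor_exact N hex f.surjective_rangeRestrict t).1 h1
    clear h h1
    induction s using TensorProduct.induction_on with
    | zero => simp
    | add a b ha hb => rw [map_add]; exact add_mem ha hb
    | tmul a b => exact tmul_mem_tensorSub a.2 trivial
  · intro h
    have : tensorSub (LinearMap.ker f) ⊤ ≤ LinearMap.ker (f.rTensor N) :=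
      tensorSub_le fun x hx y _ => by simp [LinearMap.mem_ker.1 hx]
    exact this h

theorem lTensor_apply_eq_zero_iff (f : N →ₗ[K] N') (t : M ⊗[K] N) :
    f.lTensor M t = 0 ↔ t ∈ tensorSub ⊤ (LinearMap.ker f) := by
  constructor
  · intro h
    have h1 : TensorProduct.comm K M N t ∈ tensorSub (LinearMap.ker f) ⊤ := by
      rw [← rTensor_apply_eq_zero_iff, LinearMap.rTensor, TensorProduct.map_comm]
      change TensorProduct.comm K M N' (f.lTensor M t) = 0
      rw [h, map_zero]
    have h2 : tensorSub (LinearMap.ker f) ⊤ ≤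
        (tensorSub ⊤ (LinearMap.ker f)).comap (TensorProduct.comm K N M).toLinearMap :=
      tensorSub_le fun x hx y _ => tmul_mem_tensorSub trivial hx
    simpa using h2 h1
  · intro h
    have : tensorSub ⊤ (LinearMap.ker f) ≤ LinearMap.ker (f.lTensor M) :=
      tensorSub_le fun x _ y hy => by simp [LinearMap.mem_ker.1 hy]
    exact this h

theorem exists_projector (V : Submodule K M) :
    ∃ e : M →ₗ[K] M, (∀ x, e x ∈ V) ∧ ∀ x ∈ V, e x = x := by
  obtain ⟨f, hf⟩ := LinearMap.exists_extend (LinearMap.id : V →ₗ[K] V)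
  exact ⟨V.subtype ∘ₗ f, fun x => (f x).2, fun x hx =>
    congrArg Subtype.val (LinearMap.congr_fun hf ⟨x, hx⟩)⟩

/-- A projector onto `W`, applied to the second factor, fixes every element of `M ⊗ W` and maps `V ⊗
N` into `V ⊗ W`. -/
theorem mem_tensorSub_of_mem_of_mem {V : Submodule K M} {W : Submodule K N} {t : M ⊗[K] N}
    (h : t ∈ tensorSub V ⊤) (h' : t ∈ tensorSub ⊤ W) : t ∈ tensorSub V W := by
  obtain ⟨e, he, he'⟩ := exists_projector W
  have h1 : tensorSub (⊤ : Submodule K M) W ≤ LinearMap.ker (e.lTensor M - LinearMap.id) :=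
    tensorSub_le fun x _ y hy => by simp [he' y hy]
  have h2 : e.lTensor M t = t := sub_eq_zero.1 (h1 h')
  have h3 : tensorSub V ⊤ ≤ (tensorSub V W).comap (e.lTensor M) :=
    tensorSub_le fun x hx y _ => tmul_mem_tensorSub hx (he y)
  rw [← h2]
  exact h3 h

theorem tensorSub_le_tensorDegree {F : ℤ → Submodule K M} (r s : ℤ) :
    tensorSub (F r) (F s) ≤ tensorDegree F (r + s) :=
  tensorSub_le fun x hx y hy => Submodule.subset_span ⟨r, s, rfl, x, hx, y, hy, rfl⟩

end TensorSub

/-! ### Products and commutators controlled by the left tensor factor. -/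

section MulTensorSub

variable {K : Type*} [Field K] {A A' : Type*} [Ring A] [Algebra K A] [Ring A'] [Algebra K A']

theorem mul_mem_tensorSub_top {U V W : Submodule K A} (h : ∀ x ∈ U, ∀ y ∈ V, x * y ∈ W)
    {s t : A ⊗[K] A'} (hs : s ∈ tensorSub U ⊤) (ht : t ∈ tensorSub V ⊤) :
    s * t ∈ tensorSub W ⊤ := by
  have h1 : ∀ x ∈ U, ∀ b : A', tensorSub V ⊤ ≤
      (tensorSub W ⊤).comap (LinearMap.mulLeft K (x ⊗ₜ[K] b)) := fun x hx b =>
    tensorSub_le fun y hy c _ => by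
      simpa using tmul_mem_tensorSub (h x hx y hy) (Submodule.mem_top (x := b * c))
  have h2 : tensorSub U ⊤ ≤ (tensorSub W ⊤).comap (LinearMap.mulRight K t) :=
    tensorSub_le fun x hx b _ => h1 x hx b ht
  exact h2 hs

/-- Since the right factor of `x ⊗ 1` is central, `[x ⊗ 1, y ⊗ c] = [x, y] ⊗ c`, and the commutator
is seen by the left factor alone. -/
theorem commutator_mem_tensorSub_top {U V W : Submodule K A}
    (h : ∀ x ∈ U, ∀ y ∈ V, x * y - y * x ∈ W)
    {x : A} (hx : x ∈ U) {t : A ⊗[K] A'} (ht : t ∈ tensorSub V ⊤) :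
    (x ⊗ₜ[K] 1) * t - t * (x ⊗ₜ[K] 1) ∈ tensorSub W ⊤ := by
  have h1 : tensorSub V ⊤ ≤ (tensorSub W ⊤).comap
      (LinearMap.mulLeft K (x ⊗ₜ[K] (1 : A')) - LinearMap.mulRight K (x ⊗ₜ[K] (1 : A'))) :=
    tensorSub_le fun y hy c _ => by
      simpa [TensorProduct.sub_tmul] using tmul_mem_tensorSub (h x hx y hy)
        (W := ⊤) (y := c) trivial
  exact h1 ht

end MulTensorSub

/-! ### The δ_•-filtration is a bialgebra filtration. -/

section DeltaFiltration

variable {K : Type u} [Field K] {B : Type v} [Ring B] [Bialgebra K B]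

variable (K B) in
/-- The map `x ↦ Δ x - x ⊗ 1`. -/
def comulSubTmulOne : B →ₗ[K] B ⊗[K] B :=
  Coalgebra.comul - (TensorProduct.mk K B B).flip 1

theorem comulSubTmulOne_apply (x : B) :
    comulSubTmulOne K B x = Coalgebra.comul (R := K) x - x ⊗ₜ[K] 1 := rfl

variable (K B) in
/-- The projection `id - u ∘ ε` onto the augmentation ideal. -/
def augProj : B →ₗ[K] B := LinearMap.id - Algebra.linearMap K B ∘ₗ Coalgebra.counit

theorem augProj_apply (x : B) :
    augProj K B x = x - algebraMap K B (Coalgebra.counit (R := K) x) := rfl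

theorem lTensor_augProj_comul (x : B) :
    (augProj K B).lTensor B (Coalgebra.comul (R := K) x) = comulSubTmulOne K B x := by
  have h : (Algebra.linearMap K B ∘ₗ Coalgebra.counit).lTensor B (Coalgebra.comul (R := K) x) =
      x ⊗ₜ[K] 1 := by
    rw [LinearMap.lTensor_comp, LinearMap.comp_apply, Coalgebra.lTensor_counit_comul]
    simp
  rw [augProj, LinearMap.lTensor_sub, LinearMap.sub_apply, h]
  simp [comulSubTmulOne_apply]

/-- The iterated coproduct is built by splitting off the last factor, so `δ_{n+1}` is `(δ_n ⊗ (id -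
uε)) ∘ Δ` up to the identification of tensor powers, and `(id ⊗ (id - uε))Δx = ∂x` by the counit
axiom. -/
theorem drinfeldMap_succ (n : ℕ) (x : B) : drinfeldMap K B (n + 1) x =
    TensorPower.mulEquiv (R := K) (M := B) (TensorProduct.map LinearMap.id
      (PiTensorProduct.subsingletonEquiv (R := K) (s := fun _ : Fin 1 => B) 0).symm.toLinearMap
      ((drinfeldMap K B n).rTensor B (comulSubTmulOne K B x))) := by
  rw [← lTensor_augProj_comul]
  -- Tensor powers of a linear map commute with the identification `B^{⊗n} ⊗ B ≅ B^{⊗(n+1)}`; this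
  -- is checked on pure tensors.
  have key : ∀ (π : B →ₗ[K] B) (s : (⨂[K]^n B) ⊗[K] B),
      PiTensorProduct.map (fun _ : Fin (n + 1) => π) (TensorPower.mulEquiv (R := K) (M := B)
        (TensorProduct.map LinearMap.id (PiTensorProduct.subsingletonEquiv (R := K)
          (s := fun _ : Fin 1 => B) 0).symm.toLinearMap s)) =
      TensorPower.mulEquiv (R := K) (M := B) (TensorProduct.map LinearMap.id
        (PiTensorProduct.subsingletonEquiv (R := K) (s := fun _ : Fin 1 => B) 0).symm.toLinearMap
        (TensorProduct.map (PiTensorProduct.map (fun _ : Fin n => π)) π s)) := by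
    intro π s
    induction s using TensorProduct.induction_on with
    | zero => simp
    | add a b ha hb => simp only [map_add, ha, hb]
    | tmul a b =>
      induction a using PiTensorProduct.induction_on with
      | add a a' ha hb => simp only [map_add, TensorProduct.add_tmul, ha, hb]
      | smul_tprod r f =>
        simp only [← TensorProduct.smul_tmul', map_smul]
        congr 1
        simp only [TensorProduct.map_tmul, LinearMap.id_apply, LinearEquiv.coe_coe,
          PiTensorProduct.subsingletonEquiv_symm_apply', PiTensorProduct.map_tprod]
        have := fun (a : Fin n → B) (b : Fin 1 → B) =>
          TensorPower.tprod_mul_tprod (R := K) (M := B) a b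
        simp only [TensorPower.gMul_def] at this
        rw [this, this, PiTensorProduct.map_tprod]
        congr 1
        funext i
        refine Fin.addCases (fun i => ?_) (fun i => ?_) i <;> simp
  have h2 := key (augProj K B) (TensorProduct.map (iteratedComul K B n) LinearMap.id
    (Coalgebra.comul (R := K) x))
  have h3 : drinfeldMap K B (n + 1) x = PiTensorProduct.map (fun _ : Fin (n + 1) => augProj K B)
      (TensorPower.mulEquiv (R := K) (M := B)
        (TensorProduct.map LinearMap.id (PiTensorProduct.subsingletonEquiv (R := K)
          (s := fun _ : Fin 1 => B) 0).symm.toLinearMap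
          (TensorProduct.map (iteratedComul K B n) LinearMap.id
            (Coalgebra.comul (R := K) x)))) := by
    rw [← LinearMap.comp_apply (TensorProduct.map _ _) (TensorProduct.map _ _),
      ← TensorProduct.map_comp]
    rfl
  rw [h3, h2]
  congr 2
  rw [← LinearMap.comp_apply, ← TensorProduct.map_comp, LinearMap.rTensor, LinearMap.lTensor,
    ← LinearMap.comp_apply (TensorProduct.map _ _) (TensorProduct.map _ _),
    ← TensorProduct.map_comp]
  rfl

theorem mem_ker_drinfeldMap_succ (n : ℕ) (x : B) : drinfeldMap K B (n + 1) x = 0 ↔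
    comulSubTmulOne K B x ∈ tensorSub (LinearMap.ker (drinfeldMap K B n)) ⊤ := by
  rw [← rTensor_apply_eq_zero_iff, drinfeldMap_succ, LinearEquiv.map_eq_zero_iff]
  have : Function.Injective (TensorProduct.map (LinearMap.id : (⨂[K]^n B) →ₗ[K] _)
      (PiTensorProduct.subsingletonEquiv (R := K) (s := fun _ : Fin 1 => B) 0).symm.toLinearMap) :=
    (TensorProduct.congr (LinearEquiv.refl K (⨂[K]^n B))
      (PiTensorProduct.subsingletonEquiv (R := K) (s := fun _ : Fin 1 => B) 0).symm).injective
  rw [map_eq_zero_iff _ this]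

theorem ker_drinfeldMap_zero :
    LinearMap.ker (drinfeldMap K B 0) = LinearMap.ker (Coalgebra.counit : B →ₗ[K] K) := by
  ext x
  have h : ∀ y : ⨂[K]^0 B, PiTensorProduct.map (fun _ : Fin 0 => augProj K B) y = y := by
    intro y
    induction y using PiTensorProduct.induction_on with
    | add a b ha hb => rw [map_add, ha, hb]
    | smul_tprod r f =>
      rw [map_smul, PiTensorProduct.map_tprod]
      congr 2
      exact Subsingleton.elim _ _
  rw [LinearMap.mem_ker, LinearMap.mem_ker]
  change PiTensorProduct.map (fun _ : Fin 0 => augProj K B)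
    (TensorPower.algebraMap₀ (R := K) (M := B) (Coalgebra.counit x)) = 0 ↔ _
  rw [h, LinearEquiv.map_eq_zero_iff]

theorem deltaFiltration_of_neg {n : ℤ} (hn : n < 0) : deltaFiltration K B n = ⊥ :=
  if_neg (by omega)

/-- The recursive description of the `δ_•`-filtration. -/
theorem mem_deltaFiltration_iff {n : ℤ} (hn : 0 ≤ n) (x : B) : x ∈ deltaFiltration K B n ↔
    comulSubTmulOne K B x ∈ tensorSub (deltaFiltration K B (n - 1)) ⊤ := by
  obtain ⟨m, rfl⟩ := Int.eq_ofNat_of_zero_le hn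
  rw [deltaFiltration, if_pos hn, LinearMap.mem_ker, Int.toNat_natCast, mem_ker_drinfeldMap_succ]
  cases m with
  -- Here `ker δ_0 = ker ε` is larger than `D_{-1} = 0`, but the two conditions agree: if `(ε ⊗
  -- id)(∂x) = 0` then `x = ε(x) 1`, and `∂` vanishes on scalars.
  | zero =>
    have hbot : deltaFiltration K B (((0 : ℕ) : ℤ) - 1) = LinearMap.ker LinearMap.id := by
      rw [deltaFiltration_of_neg (by simp), LinearMap.ker_id]
    rw [ker_drinfeldMap_zero, ← rTensor_apply_eq_zero_iff, hbot, ← rTensor_apply_eq_zero_iff,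
      LinearMap.rTensor_id, LinearMap.id_apply]
    refine ⟨fun h => ?_, fun h => by rw [h, map_zero]⟩
    rw [comulSubTmulOne_apply, map_sub, Coalgebra.rTensor_counit_comul, LinearMap.rTensor_tmul,
      sub_eq_zero] at h
    have h2 := congrArg (TensorProduct.lid K B) h
    simp only [TensorProduct.lid_tmul, one_smul] at h2
    rw [h2, comulSubTmulOne_apply, map_smul, Bialgebra.comul_one, Algebra.TensorProduct.one_def,
      TensorProduct.smul_tmul', sub_self]
  | succ k =>
    rw [deltaFiltration, if_pos (by push_cast; omega), Nat.cast_succ, add_sub_cancel_right,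
      Int.toNat_natCast]

theorem deltaFiltration_zero : deltaFiltration K B 0 = Submodule.span K {1} := by
  ext x
  rw [mem_deltaFiltration_iff le_rfl, deltaFiltration_of_neg (by norm_num), ← LinearMap.ker_id,
    ← rTensor_apply_eq_zero_iff, LinearMap.rTensor_id, LinearMap.id_apply, comulSubTmulOne_apply,
    Submodule.mem_span_singleton]
  constructor
  · intro h
    refine ⟨Coalgebra.counit (R := K) x, ?_⟩
    have h2 := congrArg (fun t => TensorProduct.lid K B (Coalgebra.counit.rTensor B t)) h
    simp only [map_sub, Coalgebra.rTensor_counit_comul, LinearMap.rTensor_tmul,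
      TensorProduct.lid_tmul, one_smul, map_zero, sub_eq_zero] at h2
    exact h2.symm
  · rintro ⟨c, rfl⟩
    simp [Algebra.TensorProduct.one_def, TensorProduct.smul_tmul']

theorem one_mem_deltaFiltration : (1 : B) ∈ deltaFiltration K B 0 := by
  rw [deltaFiltration_zero]; exact Submodule.mem_span_singleton_self 1

theorem deltaFiltration_le_succ (n : ℕ) :
    deltaFiltration K B ((n : ℤ) - 1) ≤ deltaFiltration K B n := by
  induction n with
  | zero => rw [deltaFiltration_of_neg (by simp)]; exact bot_le
  | succ n ih =>
    intro x hx
    rw [Nat.cast_succ, add_sub_cancel_right, mem_deltaFiltration_iff (by positivity)] at hx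
    rw [mem_deltaFiltration_iff (by positivity), Nat.cast_succ, add_sub_cancel_right]
    exact tensorSub_mono ih le_rfl hx

theorem deltaFiltration_monotone : Monotone (deltaFiltration K B) := by
  refine monotone_int_of_le_succ fun n => ?_
  rcases lt_or_ge n 0 with h | h
  · rw [deltaFiltration_of_neg h]; exact bot_le
  · obtain ⟨m, rfl⟩ := Int.eq_ofNat_of_zero_le h
    simpa using deltaFiltration_le_succ (K := K) (B := B) (m + 1)

theorem comul_mem_tensorSub_deltaFiltration {n : ℤ} {x : B} (hx : x ∈ deltaFiltration K B n) :
    Coalgebra.comul (R := K) x ∈ tensorSub (deltaFiltration K B n) ⊤ := by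
  rcases lt_or_ge n 0 with h | h
  · rw [deltaFiltration_of_neg h] at hx
    rw [(Submodule.mem_bot K).1 hx, map_zero]; exact zero_mem _
  · have := (mem_deltaFiltration_iff h x).1 hx
    rw [← sub_add_cancel (Coalgebra.comul (R := K) x) (x ⊗ₜ[K] 1)]
    exact add_mem (tensorSub_mono (deltaFiltration_monotone (by omega)) le_rfl this)
      (tmul_mem_tensorSub hx trivial)

/-- Multiplicativity of `Δ` gives `∂(xy) = ∂x ∂y + ∂x (y ⊗ 1) + (x ⊗ 1) ∂y`. In each term the
degrees of the left factors add up to less than `i + j`, so the recursion allows an induction on a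
bound for `i + j`. -/
theorem mul_mem_deltaFiltration_nat (n : ℕ) : ∀ i j : ℤ, i + j ≤ n → ∀ x ∈ deltaFiltration K B i,
    ∀ y ∈ deltaFiltration K B j, x * y ∈ deltaFiltration K B (i + j) := by
  have neg : ∀ i j : ℤ, (i < 0 ∨ j < 0) → ∀ x ∈ deltaFiltration K B i,
      ∀ y ∈ deltaFiltration K B j, x * y ∈ deltaFiltration K B (i + j) := by
    rintro i j (h | h) x hx y hy
    · rw [deltaFiltration_of_neg h] at hx
      rw [(Submodule.mem_bot K).1 hx, zero_mul]; exact zero_mem _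
    · rw [deltaFiltration_of_neg h] at hy
      rw [(Submodule.mem_bot K).1 hy, mul_zero]; exact zero_mem _
  have scal : ∀ j : ℤ, ∀ x ∈ deltaFiltration K B 0,
      ∀ y ∈ deltaFiltration K B j, x * y ∈ deltaFiltration K B (0 + j) := by
    intro j x hx y hy
    rw [deltaFiltration_zero] at hx
    obtain ⟨c, rfl⟩ := Submodule.mem_span_singleton.1 hx
    rw [smul_mul_assoc, one_mul, zero_add]
    exact Submodule.smul_mem _ _ hy
  induction n with
  | zero =>
    intro i j hij x hx y hy
    by_cases h : i < 0 ∨ j < 0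
    · exact neg i j h x hx y hy
    · obtain rfl : i = 0 := by push_cast at hij; omega
      exact scal j x hx y hy
  | succ n ih =>
    intro i j hij x hx y hy
    by_cases h : i < 0 ∨ j < 0
    · exact neg i j h x hx y hy
    push Not at h
    push_cast at hij
    rw [mem_deltaFiltration_iff (by omega)]
    have hX := (mem_deltaFiltration_iff h.1 x).1 hx
    have hY := (mem_deltaFiltration_iff h.2 y).1 hy
    have hy1 : y ⊗ₜ[K] (1 : B) ∈ tensorSub (deltaFiltration K B j) ⊤ :=
      tmul_mem_tensorSub hy trivial
    have hx1 : x ⊗ₜ[K] (1 : B) ∈ tensorSub (deltaFiltration K B i) ⊤ :=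
      tmul_mem_tensorSub hx trivial
    have key : comulSubTmulOne K B (x * y) =
        comulSubTmulOne K B x * comulSubTmulOne K B y + comulSubTmulOne K B x * (y ⊗ₜ[K] 1) +
          (x ⊗ₜ[K] 1) * comulSubTmulOne K B y := by
      simp only [comulSubTmulOne_apply, Bialgebra.comul_mul, sub_mul, mul_sub,
        Algebra.TensorProduct.tmul_mul_tmul, mul_one]
      abel
    rw [key]
    refine add_mem (add_mem ?_ ?_) ?_
    · refine tensorSub_mono (deltaFiltration_monotone (show i - 1 + (j - 1) ≤ _ by omega)) le_rfl
        (mul_mem_tensorSub_top (ih (i - 1) (j - 1) (by omega)) hX hY)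
    · refine tensorSub_mono (deltaFiltration_monotone (show i - 1 + j ≤ _ by omega)) le_rfl
        (mul_mem_tensorSub_top (ih (i - 1) j (by omega)) hX hy1)
    · refine tensorSub_mono (deltaFiltration_monotone (show i + (j - 1) ≤ _ by omega)) le_rfl
        (mul_mem_tensorSub_top (ih i (j - 1) (by omega)) hx1 hY)

theorem mul_mem_deltaFiltration {i j : ℤ} {x y : B} (hx : x ∈ deltaFiltration K B i)
    (hy : y ∈ deltaFiltration K B j) : x * y ∈ deltaFiltration K B (i + j) :=
  mul_mem_deltaFiltration_nat (i + j).toNat i j (by omega) x hx y hy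

/-- Here `∂[x, y] = [∂x, ∂y] + [∂x, y ⊗ 1] + [x ⊗ 1, ∂y]`, and left degree `i + j - 2` is required.
The first term has it by multiplicativity alone. In the other two one entry has right factor `1`, so
they are commutators in the left factor and the induction hypothesis provides the missing drop by
one. -/
theorem commutator_mem_deltaFiltration_nat (n : ℕ) : ∀ i j : ℤ, i + j ≤ n →
    ∀ x ∈ deltaFiltration K B i, ∀ y ∈ deltaFiltration K B j,
      x * y - y * x ∈ deltaFiltration K B (i + j - 1) := by
  have low : ∀ i j : ℤ, (i ≤ 0 ∨ j ≤ 0) → ∀ x ∈ deltaFiltration K B i,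
      ∀ y ∈ deltaFiltration K B j, x * y - y * x = 0 := by
    have h0 : ∀ i ≤ (0 : ℤ), ∀ x ∈ deltaFiltration K B i, ∀ y : B, x * y - y * x = 0 := by
      intro i h x hx y
      have := deltaFiltration_monotone h hx
      rw [deltaFiltration_zero] at this
      obtain ⟨c, rfl⟩ := Submodule.mem_span_singleton.1 this
      simp
    rintro i j (h | h) x hx y hy
    · exact h0 i h x hx y
    · rw [← neg_sub, h0 j h y hy x, neg_zero]
  induction n with
  | zero =>
    intro i j hij x hx y hy
    rw [low i j (by push_cast at hij; omega) x hx y hy]; exact zero_mem _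
  | succ n ih =>
    intro i j hij x hx y hy
    by_cases h : i ≤ 0 ∨ j ≤ 0
    · rw [low i j h x hx y hy]; exact zero_mem _
    push Not at h
    push_cast at hij
    rw [mem_deltaFiltration_iff (by omega)]
    have hX := (mem_deltaFiltration_iff h.1.le x).1 hx
    have hY := (mem_deltaFiltration_iff h.2.le y).1 hy
    have key : comulSubTmulOne K B (x * y - y * x) =
        (comulSubTmulOne K B x * comulSubTmulOne K B y -
          comulSubTmulOne K B y * comulSubTmulOne K B x) -
          ((y ⊗ₜ[K] 1) * comulSubTmulOne K B x - comulSubTmulOne K B x * (y ⊗ₜ[K] 1)) +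
          ((x ⊗ₜ[K] 1) * comulSubTmulOne K B y - comulSubTmulOne K B y * (x ⊗ₜ[K] 1)) := by
      simp only [comulSubTmulOne_apply, Bialgebra.comul_mul, sub_mul, mul_sub, map_sub,
        Algebra.TensorProduct.tmul_mul_tmul, mul_one]
      abel
    rw [key]
    refine add_mem (sub_mem (sub_mem ?_ ?_) ?_) ?_
    · exact tensorSub_mono (deltaFiltration_monotone (show i - 1 + (j - 1) ≤ _ by omega)) le_rfl
        (mul_mem_tensorSub_top (fun a ha b hb => mul_mem_deltaFiltration ha hb) hX hY)
    · exact tensorSub_mono (deltaFiltration_monotone (show j - 1 + (i - 1) ≤ _ by omega)) le_rfl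
        (mul_mem_tensorSub_top (fun a ha b hb => mul_mem_deltaFiltration ha hb) hY hX)
    · exact tensorSub_mono (deltaFiltration_monotone (show j + (i - 1) - 1 ≤ _ by omega)) le_rfl
        (commutator_mem_tensorSub_top (ih j (i - 1) (by omega)) hy hX)
    · exact tensorSub_mono (deltaFiltration_monotone (show i + (j - 1) - 1 ≤ _ by omega)) le_rfl
        (commutator_mem_tensorSub_top (ih i (j - 1) (by omega)) hx hY)

theorem commutator_mem_deltaFiltration {i j : ℤ} {x y : B} (hx : x ∈ deltaFiltration K B i)
    (hy : y ∈ deltaFiltration K B j) : x * y - y * x ∈ deltaFiltration K B (i + j - 1) :=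
  commutator_mem_deltaFiltration_nat (i + j).toNat i j (by omega) x hx y hy

/-- Coassociativity, with `Δx ⊗ 1` subtracted on both sides. It converts information about the left
factor of `∂x` into information about the right factor of `Δx`. -/
theorem lTensor_comulSubTmulOne_comul (x : B) :
    (comulSubTmulOne K B).lTensor B (Coalgebra.comul (R := K) x) =
      TensorProduct.assoc K B B B (Coalgebra.comul.rTensor B (comulSubTmulOne K B x)) := by
  have h : ∀ t : B ⊗[K] B, ((TensorProduct.mk K B B).flip 1).lTensor B t =
      TensorProduct.assoc K B B B (t ⊗ₜ[K] 1) := by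
    intro t
    induction t using TensorProduct.induction_on with
    | zero => simp
    | add a b ha hb => simp only [map_add, ha, hb, TensorProduct.add_tmul]
    | tmul a b => simp
  rw [comulSubTmulOne, LinearMap.lTensor_sub, LinearMap.sub_apply, h, LinearMap.sub_apply, map_sub,
    map_sub, Coalgebra.coassoc_apply]
  simp

/-- With projectors `e_i` onto `D_i`, cut `Δx` into the slices `((e_i - e_{i-1}) ⊗ id)Δx`, where `x
∈ D_{n+1}`. The slice lies in `D_i ⊗ B`, and it remains to place it in `B ⊗ D_{n+1-i}`. By the
recursion this is tested by applying `∂` to the right factor and reducing modulo `D_{n-i}`. By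
coassociativity the test may be made on `(Δ ⊗ id)∂x`, where `∂x ∈ D_n ⊗ B` and the induction
hypothesis describes `Δ(D_n)`. -/
theorem comul_mem_tensorDegree_deltaFiltration (n : ℕ) : ∀ x ∈ deltaFiltration K B n,
    Coalgebra.comul (R := K) x ∈ tensorDegree (deltaFiltration K B) n := by
  induction n with
  | zero =>
    intro x hx
    have := comul_mem_tensorSub_deltaFiltration hx
    rw [Nat.cast_zero, deltaFiltration_zero] at hx
    obtain ⟨c, rfl⟩ := Submodule.mem_span_singleton.1 hx
    rw [map_smul, Bialgebra.comul_one, Algebra.TensorProduct.one_def]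
    exact Submodule.smul_mem _ _ (Submodule.subset_span ⟨0, 0, rfl, 1, one_mem_deltaFiltration,
      1, one_mem_deltaFiltration, rfl⟩)
  | succ n ih =>
    intro x hx
    choose e he he' using fun i : ℤ => exists_projector (deltaFiltration K B i)
    set u := Coalgebra.comul (R := K) x with hu
    -- The sum telescopes to `e_{n+1} - e_{-1}`; the first projector fixes the left factors of `Δx`
    -- and the second one is zero.
    have hsum : u = ∑ i ∈ Finset.range (n + 2),
        (e ((i : ℕ) : ℤ) - e ((i : ℤ) - 1)).rTensor B u := by
      have h1 : ∑ i ∈ Finset.range (n + 2), (e ((i : ℕ) : ℤ) - e ((i : ℤ) - 1)) =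
          e ((n + 1 : ℕ) : ℤ) - e (-1) := by
        have := Finset.sum_range_sub (fun i : ℕ => e ((i : ℤ) - 1)) (n + 2)
        push_cast at this ⊢
        simp only [add_sub_cancel_right] at this
        rw [this]
        congr 2
        ring
      have h2 : e (-1) = 0 := by
        ext y
        have := he (-1) y
        rw [deltaFiltration_of_neg (by norm_num)] at this
        exact (Submodule.mem_bot K).1 this
      have h3 : (e ((n + 1 : ℕ) : ℤ)).rTensor B u = u := by
        have : tensorSub (deltaFiltration K B ((n + 1 : ℕ) : ℤ)) ⊤ ≤
            LinearMap.ker ((e ((n + 1 : ℕ) : ℤ)).rTensor B - LinearMap.id) :=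
          tensorSub_le fun a ha b _ => by
            rw [LinearMap.mem_ker, LinearMap.sub_apply, LinearMap.rTensor_tmul, he' _ a ha,
              LinearMap.id_apply, sub_self]
        exact sub_eq_zero.1 (this (comul_mem_tensorSub_deltaFiltration hx))
      rw [h2, sub_zero] at h1
      conv_lhs => rw [← h3, ← h1]
      exact (LinearMap.congr_fun (map_sum (LinearMap.rTensorHom (R := K) B) _ _) u).trans
        (LinearMap.sum_apply _ _ _)
    rw [hsum]
    refine Submodule.sum_mem _ fun i hi => ?_
    have hin : i ≤ n + 1 := by simpa [Nat.lt_succ_iff] using hi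
    have hdeg : ((n + 1 : ℕ) : ℤ) = (i : ℤ) + ((n : ℤ) + 1 - i) := by push_cast; ring
    rw [hdeg]
    refine tensorSub_le_tensorDegree _ _ (mem_tensorSub_of_mem_of_mem ?_ ?_)
    · have : (⊤ : Submodule K (B ⊗[K] B)) ≤ (tensorSub (deltaFiltration K B i) ⊤).comap
          ((e ((i : ℕ) : ℤ) - e ((i : ℤ) - 1)).rTensor B) := by
        intro t _
        induction t using TensorProduct.induction_on with
        | zero => simp
        | add a b ha hb => exact add_mem (ha trivial) (hb trivial)
        | tmul a b =>
          exact tmul_mem_tensorSub (sub_mem (he _ _)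
            (deltaFiltration_monotone (by omega) (he ((i : ℤ) - 1) a))) trivial
      exact this trivial
    · set q := (deltaFiltration K B ((n : ℤ) - i)).mkQ with hq
      have hker : deltaFiltration K B ((n : ℤ) + 1 - i) =
          LinearMap.ker (q.rTensor B ∘ₗ comulSubTmulOne K B) := by
        ext y
        rw [mem_deltaFiltration_iff (by omega), LinearMap.mem_ker, LinearMap.comp_apply,
          rTensor_apply_eq_zero_iff, hq, Submodule.ker_mkQ,
          show (n : ℤ) + 1 - i - 1 = n - i by ring]
      rw [hker, ← lTensor_apply_eq_zero_iff, ← LinearMap.comp_apply,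
        LinearMap.lTensor_comp_rTensor, ← LinearMap.rTensor_comp_lTensor, LinearMap.comp_apply,
        LinearMap.lTensor_comp, LinearMap.comp_apply, hu, lTensor_comulSubTmulOne_comul]
      have hx' := (mem_deltaFiltration_iff (by positivity) x).1 hx
      rw [Nat.cast_succ, add_sub_cancel_right] at hx'
      have hle : tensorSub (deltaFiltration K B n) ⊤ ≤ LinearMap.ker
          ((e ((i : ℕ) : ℤ) - e ((i : ℤ) - 1)).rTensor _ ∘ₗ (q.rTensor B).lTensor B ∘ₗ
            (TensorProduct.assoc K B B B).toLinearMap ∘ₗ Coalgebra.comul.rTensor B) := by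
        refine tensorSub_le fun a ha b _ => ?_
        have hle2 : tensorDegree (deltaFiltration K B) n ≤ LinearMap.ker
            ((e ((i : ℕ) : ℤ) - e ((i : ℤ) - 1)).rTensor _ ∘ₗ (q.rTensor B).lTensor B ∘ₗ
            (TensorProduct.assoc K B B B).toLinearMap ∘ₗ
              (TensorProduct.mk K (B ⊗[K] B) B).flip b) := by
          refine Submodule.span_le.2 ?_
          rintro _ ⟨k, l, hkl, y, hy, z, hz, rfl⟩
          simp only [SetLike.mem_coe, LinearMap.mem_ker, LinearMap.comp_apply,
            LinearMap.flip_apply, TensorProduct.mk_apply, LinearEquiv.coe_coe,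
            TensorProduct.assoc_tmul, LinearMap.lTensor_tmul, LinearMap.rTensor_tmul,
            LinearMap.sub_apply]
          -- A term of `D_k ⊗ D_l` with `k + l = n` is killed by `e_i - e_{i-1}` if `k < i`, since
          -- both projectors fix it, and otherwise by the quotient map, since `l ≤ n - i`.
          by_cases hk : k < i
          · rw [he' _ y (deltaFiltration_monotone (by omega) hy),
              he' _ y (deltaFiltration_monotone (by omega) hy), sub_self, TensorProduct.zero_tmul]
          · have : q z = 0 := by
              rw [hq, Submodule.mkQ_apply, Submodule.Quotient.mk_eq_zero]
              exact deltaFiltration_monotone (by omega) hz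
            rw [this, TensorProduct.zero_tmul, TensorProduct.tmul_zero]
        exact hle2 (ih a ha)
      exact hle hx'

instance isBialgebraFiltration_deltaFiltration : IsBialgebraFiltration (deltaFiltration K B) where
  monotone := deltaFiltration_monotone
  mul_mem := mul_mem_deltaFiltration
  comul_mem := by
    intro z x hx
    rcases lt_or_ge z 0 with h | h
    · rw [deltaFiltration_of_neg h] at hx
      rw [(Submodule.mem_bot K).1 hx, map_zero]; exact zero_mem _
    · obtain ⟨m, rfl⟩ := Int.eq_ofNat_of_zero_le h
      exact comul_mem_tensorDegree_deltaFiltration m x hx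
  one_mem := one_mem_deltaFiltration
  counit_eq_zero := by
    intro x hx
    rw [deltaFiltration_of_neg (by norm_num)] at hx
    rw [(Submodule.mem_bot K).1 hx, map_zero]

end DeltaFiltration

/-! ### Commutator identities in characteristic `p`. -/

section CharP

variable {R : Type*} [Ring R] (p : ℕ) [Fact p.Prime] [CharP R p]

/-- Pascal's rule together with the vanishing of the binomial coefficients of `p` in intermediate
positions makes consecutive values opposite. -/
theorem cast_choose_pred_char {i : ℕ} (hi : i < p) : ((p - 1).choose i : R) = (-1) ^ i := by
  induction i with
  | zero => simp
  | succ i ih =>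
    have h1 : (p - 1 + 1).choose (i + 1) = (p - 1).choose i + (p - 1).choose (i + 1) :=
      Nat.choose_succ_succ _ _
    rw [Nat.sub_add_cancel (Fact.out : p.Prime).one_le] at h1
    have h2 : ((p.choose (i + 1) : ℕ) : R) = 0 :=
      (CharP.cast_eq_zero_iff R p _).2
        ((Fact.out : p.Prime).dvd_choose_self (by omega) hi)
    rw [h1, Nat.cast_add, ih (by omega)] at h2
    rw [pow_succ, mul_neg_one, eq_neg_iff_add_eq_zero, add_comm]
    exact h2

theorem geom_sum₂_eq_sub_pow_char {a b : R} (h : Commute a b) :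
    ∑ i ∈ Finset.range p, a ^ i * b ^ (p - 1 - i) = (a - b) ^ (p - 1) := by
  have hp : p - 1 + 1 = p := Nat.sub_add_cancel (Fact.out : p.Prime).one_le
  rw [sub_eq_add_neg, h.neg_right.add_pow, hp]
  refine Finset.sum_congr rfl fun i hi => ?_
  have hi : i < p := Finset.mem_range.1 hi
  have hc : ((p - 1).choose i : R) = (-1) ^ (p - 1 - i) := by
    rw [← Nat.choose_symm (show i ≤ p - 1 by omega), cast_choose_pred_char p (by omega)]
  rw [hc, neg_pow b, mul_assoc, ((Commute.neg_one_left (b ^ (p - 1 - i))).pow_left _).eq,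
    mul_assoc, ← pow_add, ← two_mul, pow_mul, neg_one_sq, one_pow, mul_one]

/-- In characteristic `p`, `∑ xⁱ y x^{p-1-i} = (ad x)^{p-1}(y)`. -/
theorem sum_pow_mul_pow_eq_iterate (x y : R) :
    ∑ i ∈ Finset.range p, x ^ i * y * x ^ (p - 1 - i) =
      (fun z => x * z - z * x)^[p - 1] y := by
  have : CharP (Module.End ℤ R) p :=
    charP_of_injective_ringHom (f := (Algebra.lmul ℤ R).toRingHom) Algebra.lmul_injective p
  -- Left and right multiplication by `x` commute, and their difference is `ad x`.
  have h := geom_sum₂_eq_sub_pow_char p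
    (show Commute (LinearMap.mulLeft ℤ x) (LinearMap.mulRight ℤ x) from
      LinearMap.commute_mulLeft_right x x)
  have h2 := LinearMap.congr_fun h y
  rw [Module.End.pow_apply] at h2
  simp only [LinearMap.sum_apply, LinearMap.pow_mulLeft, LinearMap.pow_mulRight,
    Module.End.mul_apply, LinearMap.mulLeft_apply, LinearMap.mulRight_apply, ← mul_assoc] at h2
  exact h2

end CharP

/-! ### Powers with exponent `p` and the δ_•-filtration. -/

section PowCharDelta

variable {K : Type u} [Field K] {B : Type v} [Ring B] [Bialgebra K B]

/-- A product expansion modulo terms which involve at least two factors `t`. -/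
theorem pow_add_sub_mem {A : Type*} [Ring A] (F : ℤ → AddSubgroup A)
    (hF : ∀ {i j : ℤ} {x y : A}, x ∈ F i → y ∈ F j → x * y ∈ F (i + j))
    (h1 : (1 : A) ∈ F 0) (hmono : Monotone F) {n : ℤ} {X t : A} (hX : X ∈ F n)
    (ht : t ∈ F (n - 1)) (k : ℕ) :
    (X + t) ^ k ∈ F (k * n) ∧ (X + t) ^ k - X ^ k ∈ F (k * n - 1) ∧
      (X + t) ^ k - X ^ k - ∑ i ∈ Finset.range k, X ^ i * t * X ^ (k - 1 - i) ∈ F (k * n - 2) := by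
  induction k with
  | zero => simpa using h1
  | succ k ih =>
    obtain ⟨ha, hb, hc⟩ := ih
    have hXt : X + t ∈ F n := add_mem hX (hmono (by omega) ht)
    have e : ((k + 1 : ℕ) : ℤ) * n = k * n + n := by push_cast; ring
    rw [e]
    refine ⟨by rw [pow_succ]; exact hF ha hXt, ?_, ?_⟩
    · have : (X + t) ^ (k + 1) - X ^ (k + 1) = (X + t) ^ k * t + ((X + t) ^ k - X ^ k) * X := by
        rw [pow_succ, pow_succ]; noncomm_ring
      rw [this]
      exact add_mem (hmono (by omega) (hF ha ht)) (hmono (by omega) (hF hb hX))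
    · have hs : ∑ i ∈ Finset.range (k + 1), X ^ i * t * X ^ (k + 1 - 1 - i) =
          (∑ i ∈ Finset.range k, X ^ i * t * X ^ (k - 1 - i)) * X + X ^ k * t := by
        rw [Finset.sum_range_succ, Finset.sum_mul]
        congr 1
        · refine Finset.sum_congr rfl fun i hi => ?_
          have hi := Finset.mem_range.1 hi
          rw [mul_assoc (X ^ i * t), ← pow_succ, show k - 1 - i + 1 = k + 1 - 1 - i by omega]
        · simp
      have : (X + t) ^ (k + 1) - X ^ (k + 1) -
          ∑ i ∈ Finset.range (k + 1), X ^ i * t * X ^ (k + 1 - 1 - i) =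
          ((X + t) ^ k - X ^ k - ∑ i ∈ Finset.range k, X ^ i * t * X ^ (k - 1 - i)) * X +
            ((X + t) ^ k - X ^ k) * t := by
        rw [hs, pow_succ, pow_succ]; noncomm_ring
      rw [this]
      exact add_mem (hmono (by omega) (hF hc hX)) (hmono (by omega) (hF hb ht))

/-- With `X = x ⊗ 1` and `t = ∂x` one has `∂(x^p) = (X + t)^p - X^p`. Terms with at least two
factors `t` have left degree at most `pn - 2`. The terms linear in `t` add up to `(ad X)^{p-1}(t)`;
each `ad X` raises the degree by only `n - 1`, which leads to `p(n - 1) ≤ pn - 2`. -/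
theorem pow_char_mem_deltaFiltration (p : ℕ) [Fact p.Prime] [CharP K p] {n : ℤ} (hn : 1 ≤ n)
    {x : B} (hx : x ∈ deltaFiltration K B n) : x ^ p ∈ deltaFiltration K B (p * n - 1) := by
  have hp : (2 : ℤ) ≤ p := by exact_mod_cast (Fact.out : p.Prime).two_le
  have hpn : 2 * n ≤ p * n := by nlinarith
  rw [mem_deltaFiltration_iff (by omega)]
  set X : B ⊗[K] B := x ⊗ₜ[K] 1 with hXdef
  set t := comulSubTmulOne K B x with htdef
  have hX : X ∈ tensorSub (deltaFiltration K B n) ⊤ := tmul_mem_tensorSub hx trivial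
  have ht : t ∈ tensorSub (deltaFiltration K B (n - 1)) ⊤ :=
    (mem_deltaFiltration_iff (by omega) x).1 hx
  have hexp : comulSubTmulOne K B (x ^ p) = (X + t) ^ p - X ^ p := by
    rw [comulSubTmulOne_apply, Bialgebra.comul_pow, htdef, comulSubTmulOne_apply,
      add_sub_cancel, hXdef, Algebra.TensorProduct.tmul_pow, one_pow]
  rw [hexp]
  have h := (pow_add_sub_mem
    (fun k => (tensorSub (deltaFiltration K B k) (⊤ : Submodule K B)).toAddSubgroup)
    (fun hx hy => mul_mem_tensorSub_top (fun a ha b hb => mul_mem_deltaFiltration ha hb) hx hy)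
    (tmul_mem_tensorSub one_mem_deltaFiltration trivial)
    (fun i j hij => tensorSub_mono (deltaFiltration_monotone hij) le_rfl) hX ht p).2.2
  have : CharP (B ⊗[K] B) p := by
    have : Nontrivial (B ⊗[K] B) :=
      (Bialgebra.counitAlgHom K (B ⊗[K] B)).toRingHom.domain_nontrivial
    exact charP_of_injective_algebraMap (algebraMap K (B ⊗[K] B)).injective p
  rw [sum_pow_mul_pow_eq_iterate p X t] at h
  have hiter : ∀ k : ℕ, (fun z => X * z - z * X)^[k] t ∈
      tensorSub (deltaFiltration K B (n - 1 + k * (n - 1))) ⊤ := by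
    intro k
    induction k with
    | zero => simpa using ht
    | succ k ih =>
      rw [Function.iterate_succ_apply']
      have := commutator_mem_tensorSub_top
        (fun a ha b hb => commutator_mem_deltaFiltration ha hb) hx ih
      rwa [show n + (n - 1 + k * (n - 1)) - 1 = n - 1 + (k + 1 : ℕ) * (n - 1) by
        push_cast; ring] at this
  have h3 := hiter (p - 1)
  rw [← sub_add_cancel ((X + t) ^ p - X ^ p) ((fun z => X * z - z * X)^[p - 1] t)]
  refine add_mem (tensorSub_mono (deltaFiltration_monotone (by omega)) le_rfl h)
    (tensorSub_mono (deltaFiltration_monotone ?_) le_rfl h3)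
  rw [Nat.cast_sub (Fact.out : p.Prime).one_le]
  push_cast
  nlinarith

end PowCharDelta

/-! ### Gradings of vector spaces and of their tensor squares. -/

section Internal

variable {K : Type u} [Field K] {M : Type v} [AddCommGroup M] [Module K M]

theorem isInternal_of_projections (𝒜 : ℤ → Submodule K M) (π : ℤ → M →ₗ[K] M)
    (hπ : ∀ m n, ∀ x ∈ 𝒜 m, π n x = if m = n then x else 0) (htop : ⨆ n, 𝒜 n = ⊤) :
    DirectSum.IsInternal 𝒜 := by
  refine DirectSum.isInternal_submodule_of_iSupIndep_of_iSup_eq_top ?_ htop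
  intro n
  rw [Submodule.disjoint_def]
  intro x hx hx'
  have h1 : ⨆ j, ⨆ (_ : j ≠ n), 𝒜 j ≤ LinearMap.ker (π n) :=
    iSup₂_le fun j hj y hy => by rw [LinearMap.mem_ker, hπ j n y hy, if_neg hj]
  have h2 := hπ n n x hx
  rw [if_pos rfl, h1 hx'] at h2
  exact h2.symm

theorem tensorDegree_neg (𝒜 : ℤ → Submodule K M) (n : ℤ) :
    tensorDegree (fun m => 𝒜 (-m)) n = tensorDegree 𝒜 (-n) := by
  unfold tensorDegree
  congr 1
  ext t
  constructor
  · rintro ⟨r, s, h, x, hx, y, hy, rfl⟩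
    exact ⟨-r, -s, by omega, x, hx, y, hy, rfl⟩
  · rintro ⟨r, s, h, x, hx, y, hy, rfl⟩
    exact ⟨-r, -s, by omega, x, by simpa using hx, y, by simpa using hy, rfl⟩

theorem tmul_mem_tensorDegree {F : ℤ → Submodule K M} {r s z : ℤ} (h : r + s = z) {x y : M}
    (hx : x ∈ F r) (hy : y ∈ F s) : x ⊗ₜ[K] y ∈ tensorDegree F z :=
  Submodule.subset_span ⟨r, s, h, x, hx, y, hy, rfl⟩

theorem tensorDegree_le {F : ℤ → Submodule K M} {z : ℤ} {P : Submodule K (M ⊗[K] M)}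
    (h : ∀ r s, r + s = z → ∀ x ∈ F r, ∀ y ∈ F s, x ⊗ₜ[K] y ∈ P) : tensorDegree F z ≤ P := by
  refine Submodule.span_le.2 ?_
  rintro _ ⟨r, s, hrs, x, hx, y, hy, rfl⟩
  exact h r s hrs x hx y hy

theorem map_mem_tensorDegree {N : Type w} [AddCommGroup N] [Module K N] {F : ℤ → Submodule K M}
    {G : ℤ → Submodule K N} {f g : M →ₗ[K] N} (hf : ∀ n, ∀ x ∈ F n, f x ∈ G n)
    (hg : ∀ n, ∀ x ∈ F n, g x ∈ G n) {z : ℤ} {t : M ⊗[K] M} (ht : t ∈ tensorDegree F z) :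
    TensorProduct.map f g t ∈ tensorDegree G z := by
  have : tensorDegree F z ≤ (tensorDegree G z).comap (TensorProduct.map f g) :=
    tensorDegree_le fun r s h x hx y hy => tmul_mem_tensorDegree h (hf r x hx) (hg s y hy)
  exact this ht

end Internal

/-! ### Connected gradings and conilpotency. -/

section ConnectedGrading

variable {K : Type u} [Field K] {H : Type v} [Ring H] [Bialgebra K H]

/-- A grading `H = ⨁_{n ≥ 0} 𝒜_n` of the bialgebra `H` with `𝒜_0 = K`. -/
structure IsConnectedGrading (𝒜 : ℤ → Submodule K H) : Prop where
  isInternal : DirectSum.IsInternal 𝒜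
  one_mem : (1 : H) ∈ 𝒜 0
  mul_mem : ∀ {m n : ℤ} {a b : H}, a ∈ 𝒜 m → b ∈ 𝒜 n → a * b ∈ 𝒜 (m + n)
  counit_eq_zero : ∀ {n : ℤ} {a : H}, n ≠ 0 → a ∈ 𝒜 n → Coalgebra.counit (R := K) a = 0
  comul_mem : ∀ {n : ℤ} {a : H}, a ∈ 𝒜 n → Coalgebra.comul (R := K) a ∈ tensorDegree 𝒜 n
  eq_bot_of_neg : ∀ {n : ℤ}, n < 0 → 𝒜 n = ⊥
  zero_le : 𝒜 0 ≤ Submodule.span K {1}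

namespace IsConnectedGrading

variable {𝒜 : ℤ → Submodule K H} (h : IsConnectedGrading 𝒜)

include h

/-- The map `e` below sends `a ⊗ b` to `ε(b) a ⊗ 1`, so `∂x = (id - e)Δx`. Homogeneous terms whose
right factor has degree `0` cancel, because that factor is a scalar; the others have a left factor
of degree less than `n`, to which the induction applies. -/
theorem mem_deltaFiltration (n : ℕ) : ∀ x ∈ 𝒜 n, x ∈ deltaFiltration K H n := by
  induction n using Nat.strong_induction_on with
  | _ n ih =>
  intro x hx
  rw [mem_deltaFiltration_iff (by positivity)]
  set e : H ⊗[K] H →ₗ[K] H ⊗[K] H := (TensorProduct.mk K H H).flip 1 ∘ₗ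
    (TensorProduct.rid K H).toLinearMap ∘ₗ Coalgebra.counit.lTensor H with he
  have hle : tensorDegree 𝒜 n ≤ (tensorSub (deltaFiltration K H (n - 1)) ⊤).comap
      (LinearMap.id - e) := by
    refine tensorDegree_le fun r s hrs a ha b hb => ?_
    have hval : (LinearMap.id - e : H ⊗[K] H →ₗ[K] H ⊗[K] H) (a ⊗ₜ[K] b) =
        a ⊗ₜ[K] (b - Coalgebra.counit (R := K) b • 1) := by
      simp [he, TensorProduct.tmul_sub]
    rw [Submodule.mem_comap, hval]
    rcases lt_trichotomy s 0 with hs | rfl | hs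
    · rw [h.eq_bot_of_neg hs] at hb
      rw [(Submodule.mem_bot K).1 hb]; simp
    · obtain ⟨c, rfl⟩ := Submodule.mem_span_singleton.1 (h.zero_le hb)
      simp
    · rcases lt_or_ge r 0 with hr | hr
      · rw [h.eq_bot_of_neg hr] at ha
        rw [(Submodule.mem_bot K).1 ha]; simp
      · obtain ⟨m, rfl⟩ := Int.eq_ofNat_of_zero_le hr
        exact tmul_mem_tensorSub (deltaFiltration_monotone (by omega) (ih m (by omega) a ha))
          trivial
  have := hle (h.comul_mem hx)
  simpa [he, comulSubTmulOne_apply] using this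

theorem iSup_eq_top : ⨆ n, 𝒜 n = ⊤ := h.isInternal.submodule_iSup_eq_top

theorem exists_mem_deltaFiltration (x : H) : ∃ n : ℕ, x ∈ deltaFiltration K H n := by
  have hx : x ∈ ⨆ n, 𝒜 n := by rw [h.iSup_eq_top]; trivial
  induction hx using Submodule.iSup_induction' with
  | mem n x hx =>
    rcases lt_or_ge n 0 with hn | hn
    · rw [h.eq_bot_of_neg hn] at hx
      exact ⟨0, by rw [(Submodule.mem_bot K).1 hx]; exact zero_mem _⟩
    · obtain ⟨m, rfl⟩ := Int.eq_ofNat_of_zero_le hn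
      exact ⟨m, h.mem_deltaFiltration m x hx⟩
  | zero => exact ⟨0, zero_mem _⟩
  | add x y _ _ hx hy =>
    obtain ⟨m, hm⟩ := hx
    obtain ⟨n, hn⟩ := hy
    exact ⟨max m n, add_mem (deltaFiltration_monotone (by simp) hm)
      (deltaFiltration_monotone (by simp) hn)⟩

end IsConnectedGrading

end ConnectedGrading

/-! ### The antipode of a conilpotent bialgebra. -/

section Antipode

variable {K : Type u} [Field K] {H : Type v} [Ring H] [Bialgebra K H]

open WithConv

variable (K H) in
/-- The projection onto the augmentation ideal, up to sign, in the convolution algebra. -/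
def convNegAugProj : WithConv (H →ₗ[K] H) := -toConv (augProj K H)

/-- The convolution unit is `uε`. Hence an antipode, being a convolution inverse of `id`, is given
by the geometric series in `uε - id` as soon as that series makes sense. -/
theorem one_sub_convNegAugProj : 1 - convNegAugProj K H = toConv LinearMap.id := by
  rw [convNegAugProj, sub_neg_eq_add]
  refine WithConv.ofConv_injective (LinearMap.ext fun x => ?_)
  change algebraMap K H (Coalgebra.counit (R := K) x) + augProj K H x = x
  rw [augProj_apply, add_sub_cancel]

theorem convNegAugProj_one : (convNegAugProj K H).ofConv 1 = 0 := by
  change -(augProj K H 1) = 0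
  simp [augProj_apply]

/-- Since `uε - id` kills `1`, the coproduct may be replaced by `∂x` in the convolution product, and
the left factors of `∂x` lie one step lower. So the geometric series is locally finite on the union
of the δ_•-filtration. -/
theorem convNegAugProj_pow_apply (k : ℕ) : ∀ x ∈ deltaFiltration K H ((k : ℤ) - 1),
    (convNegAugProj K H ^ k).ofConv x = 0 := by
  induction k with
  | zero =>
    intro x hx
    rw [deltaFiltration_of_neg (by simp)] at hx
    rw [(Submodule.mem_bot K).1 hx, map_zero]
  | succ k ih =>
    intro x hx
    rw [Nat.cast_succ, add_sub_cancel_right] at hx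
    have hx' := (mem_deltaFiltration_iff (by positivity) x).1 hx
    have hle : tensorSub (deltaFiltration K H ((k : ℤ) - 1)) ⊤ ≤ LinearMap.ker
        (TensorProduct.map (convNegAugProj K H ^ k).ofConv (convNegAugProj K H).ofConv) :=
      tensorSub_le fun a ha b _ => by
        rw [LinearMap.mem_ker, TensorProduct.map_tmul, ih a ha, TensorProduct.zero_tmul]
    have h0 : TensorProduct.map (convNegAugProj K H ^ k).ofConv (convNegAugProj K H).ofConv
        (Coalgebra.comul (R := K) x) = 0 := by
      have := hle hx'
      rw [LinearMap.mem_ker, comulSubTmulOne_apply, map_sub, TensorProduct.map_tmul,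
        convNegAugProj_one, TensorProduct.tmul_zero, sub_zero] at this
      exact this
    rw [pow_succ]
    change LinearMap.mul' K H (TensorProduct.map _ _ _) = 0
    rw [h0, map_zero]

theorem convNegAugProj_pow_apply_of_lt {n : ℤ} {k : ℕ} (h : n < k) {x : H}
    (hx : x ∈ deltaFiltration K H n) : (convNegAugProj K H ^ k).ofConv x = 0 :=
  convNegAugProj_pow_apply k x (deltaFiltration_monotone (by omega) hx)

theorem geomSum_convNegAugProj_apply {n : ℤ} {k : ℕ} (h : n < k) {x : H}
    (hx : x ∈ deltaFiltration K H n) {m : ℕ} (hm : k ≤ m) :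
    (∑ i ∈ Finset.range m, convNegAugProj K H ^ i).ofConv x =
      (∑ i ∈ Finset.range k, convNegAugProj K H ^ i).ofConv x := by
  obtain ⟨d, rfl⟩ := Nat.exists_eq_add_of_le hm
  induction d with
  | zero => rfl
  | succ d ih =>
    rw [← add_assoc, Finset.sum_range_succ]
    change (∑ i ∈ Finset.range (k + d), convNegAugProj K H ^ i).ofConv x +
      (convNegAugProj K H ^ (k + d)).ofConv x = _
    rw [ih (by omega), convNegAugProj_pow_apply_of_lt (n := n) (by push_cast; omega) hx, add_zero]

theorem comul_mem_tensorSub_top_deltaFiltration {n : ℤ} {x : H}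
    (hx : x ∈ deltaFiltration K H n) :
    Coalgebra.comul (R := K) x ∈ tensorSub ⊤ (deltaFiltration K H n) := by
  refine (tensorDegree_le fun r s hrs a ha b hb => ?_ :
    tensorDegree (deltaFiltration K H) n ≤ _) (IsBialgebraFiltration.comul_mem hx)
  rcases lt_or_ge r 0 with hr | hr
  · rw [deltaFiltration_of_neg hr] at ha
    rw [(Submodule.mem_bot K).1 ha, TensorProduct.zero_tmul]; exact zero_mem _
  · exact tmul_mem_tensorSub trivial (deltaFiltration_monotone (by omega) hb)

/-- A conilpotent bialgebra is a Hopf algebra. -/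
theorem exists_isAntipode (hH : ∀ x : H, ∃ n : ℕ, x ∈ deltaFiltration K H n) :
    ∃ S : H →ₗ[K] H, IsAntipode S ∧ ∀ V : Submodule K H,
      (∀ k : ℕ, ∀ x ∈ V, (convNegAugProj K H ^ k).ofConv x ∈ V) → ∀ x ∈ V, S x ∈ V := by
  choose d hd using hH
  set G : ℕ → WithConv (H →ₗ[K] H) := fun m => ∑ i ∈ Finset.range m, convNegAugProj K H ^ i with hG
  have hst : ∀ (n : ℕ) (x : H), x ∈ deltaFiltration K H n → ∀ m, n < m →
      (G m).ofConv x = (G (d x + 1)).ofConv x := by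
    intro n x hx m hm
    rw [← geomSum_convNegAugProj_apply (m := max m (d x + 1)) (n := n) (k := m)
      (by exact_mod_cast hm)
      hx (le_max_left _ _), ← geomSum_convNegAugProj_apply (m := max m (d x + 1)) (n := d x)
      (k := d x + 1) (by push_cast; omega) (hd x) (le_max_right _ _)]
  -- The value at `x` is the stable value of the partial sums at `x`. Linearity holds because the
  -- finitely many elements involved have a common bound.
  let S : H →ₗ[K] H :=
    { toFun := fun x => (G (d x + 1)).ofConv x
      map_add' := fun x y => by
        set m := max (d (x + y)) (max (d x) (d y)) + 1 with hm
        rw [← hst _ x (hd x) m (by omega), ← hst _ y (hd y) m (by omega),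
          ← hst _ (x + y) (hd _) m (by omega), map_add]
      map_smul' := fun c x => by
        set m := max (d (c • x)) (d x) + 1 with hm
        rw [← hst _ x (hd x) m (by omega), ← hst _ (c • x) (hd _) m (by omega), map_smul]
        rfl }
  have hS : ∀ (n : ℕ) (x : H), x ∈ deltaFiltration K H n → S x = (G (n + 1)).ofConv x :=
    fun n x hx => (hst n x hx (n + 1) (by omega)).symm
  have hone : ∀ x : H, (1 : WithConv (H →ₗ[K] H)).ofConv x =
      algebraMap K H (Coalgebra.counit (R := K) x) := fun x => rfl
  refine ⟨S, ⟨?_, ?_⟩, ?_⟩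
  · refine LinearMap.ext fun x => ?_
    have hx := hd x
    set n := d x
    -- As `Δx ∈ D_n ⊗ H`, the map `S` can be replaced on left factors by one partial sum, for which
    -- the finite geometric identity holds; its error term vanishes at `x`.
    have hle : tensorSub (deltaFiltration K H n) ⊤ ≤ LinearMap.ker
        (S.rTensor H - TensorProduct.map (G (n + 1)).ofConv LinearMap.id) :=
      tensorSub_le fun a ha b _ => by simp [hS n a ha]
    have h1 := sub_eq_zero.1 (hle (comul_mem_tensorSub_deltaFiltration hx))
    have h2 : G (n + 1) * (1 - convNegAugProj K H) = 1 - convNegAugProj K H ^ (n + 1) :=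
      geom_sum_mul_neg _ _
    rw [one_sub_convNegAugProj] at h2
    have h3 : LinearMap.mul' K H (TensorProduct.map (G (n + 1)).ofConv LinearMap.id
        (Coalgebra.comul (R := K) x)) = (1 : WithConv (H →ₗ[K] H)).ofConv x -
          (convNegAugProj K H ^ (n + 1)).ofConv x :=
      LinearMap.congr_fun (congrArg WithConv.ofConv h2) x
    rw [convNegAugProj_pow_apply_of_lt (n := n) (by push_cast; omega) hx, sub_zero, hone] at h3
    rw [LinearMap.comp_apply, LinearMap.comp_apply, h1]
    exact h3
  · refine LinearMap.ext fun x => ?_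
    have hx := hd x
    set n := d x
    have hle : tensorSub ⊤ (deltaFiltration K H n) ≤ LinearMap.ker
        (S.lTensor H - TensorProduct.map LinearMap.id (G (n + 1)).ofConv) :=
      tensorSub_le fun a _ b hb => by simp [hS n b hb]
    have h1 := sub_eq_zero.1 (hle (comul_mem_tensorSub_top_deltaFiltration hx))
    have h2 : (1 - convNegAugProj K H) * G (n + 1) = 1 - convNegAugProj K H ^ (n + 1) :=
      mul_neg_geom_sum _ _
    rw [one_sub_convNegAugProj] at h2
    have h3 : LinearMap.mul' K H (TensorProduct.map LinearMap.id (G (n + 1)).ofConv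
        (Coalgebra.comul (R := K) x)) = (1 : WithConv (H →ₗ[K] H)).ofConv x -
          (convNegAugProj K H ^ (n + 1)).ofConv x :=
      LinearMap.congr_fun (congrArg WithConv.ofConv h2) x
    rw [convNegAugProj_pow_apply_of_lt (n := n) (by push_cast; omega) hx, sub_zero, hone] at h3
    rw [LinearMap.comp_apply, LinearMap.comp_apply, h1]
    exact h3
  · intro V hV x hx
    rw [hS (d x) x (hd x)]
    have : ∀ m, (G m).ofConv x ∈ V := by
      intro m
      induction m with
      | zero => exact zero_mem _
      | succ m ih =>
        simp only [hG, Finset.sum_range_succ]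
        exact add_mem ih (hV m x hx)
    exact this _

theorem IsConnectedGrading.convNegAugProj_pow_mem {𝒜 : ℤ → Submodule K H}
    (h : IsConnectedGrading 𝒜) (k : ℕ) :
    ∀ n, ∀ x ∈ 𝒜 n, (convNegAugProj K H ^ k).ofConv x ∈ 𝒜 n := by
  have hunit : ∀ n, ∀ x ∈ 𝒜 n, algebraMap K H (Coalgebra.counit (R := K) x) ∈ 𝒜 n := by
    intro n x hx
    by_cases hn : n = 0
    · subst hn
      rw [Algebra.algebraMap_eq_smul_one]
      exact Submodule.smul_mem _ _ h.one_mem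
    · rw [h.counit_eq_zero hn hx, map_zero]; exact zero_mem _
  induction k with
  | zero => exact hunit
  | succ k ih =>
    intro n x hx
    rw [pow_succ]
    change LinearMap.mul' K H (TensorProduct.map _ _ _) ∈ _
    have h1 := map_mem_tensorDegree (G := 𝒜) (f := (convNegAugProj K H ^ k).ofConv)
      (g := (convNegAugProj K H).ofConv) ih (fun n x hx => by
        change -(augProj K H x) ∈ _
        rw [augProj_apply]
        exact neg_mem (sub_mem hx (hunit n x hx))) (h.comul_mem hx)
    have h2 : tensorDegree 𝒜 n ≤ (𝒜 n).comap (LinearMap.mul' K H) :=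
      tensorDegree_le fun r s hrs a ha b hb => by
        subst hrs
        exact h.mul_mem ha hb
    exact h2 h1

theorem IsConnectedGrading.exists_isGradedHopf {𝒜 : ℤ → Submodule K H}
    (h : IsConnectedGrading 𝒜) : ∃ S : H →ₗ[K] H, IsAntipode S ∧ IsGradedHopf S 𝒜 := by
  obtain ⟨S, hS, hV⟩ := exists_isAntipode h.exists_mem_deltaFiltration
  exact ⟨S, hS, h.isInternal, h.one_mem, h.mul_mem, h.counit_eq_zero, h.comul_mem,
    fun ha => hV _ (fun k => h.convNegAugProj_pow_mem k _) _ ha⟩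

end Antipode

/-! ### The homogeneous components of an associated graded bialgebra. -/

section Pieces

variable {K : Type u} [Field K] {B : Type v} [Ring B] [Bialgebra K B] {F : ℤ → Submodule K B}

namespace AssocGraded

theorem symbol_mem_piece (z : ℤ) (x : F z) : symbol F z x ∈ piece F z := ⟨x, rfl⟩

theorem iSup_piece : ⨆ z, piece F z = ⊤ := by
  refine eq_top_iff.2 fun a _ => ?_
  induction a using induction_on with
  | h z x => exact Submodule.mem_iSup_of_mem z (symbol_mem_piece z x)
  | hadd a b ha hb => exact add_mem (ha trivial) (hb trivial)

theorem proj_of_mem_piece {m : ℤ} (n : ℤ) {a : AssocGraded F} (ha : a ∈ piece F m) :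
    proj F n a = if m = n then a else 0 := by
  obtain ⟨x, rfl⟩ := ha
  rw [proj_symbol]

theorem isInternal_piece : DirectSum.IsInternal (piece F) :=
  isInternal_of_projections _ (proj F) (fun _ n _ ha => proj_of_mem_piece n ha) iSup_piece

theorem isInternal_piece_neg : DirectSum.IsInternal (fun n => piece F (-n)) :=
  isInternal_of_projections _ (fun n => proj F (-n))
    (fun m n a ha => by rw [proj_of_mem_piece _ ha]; simp only [neg_inj])
    (by rw [← iSup_piece]; exact (Equiv.neg ℤ).iSup_comp (g := piece F))

theorem symbol_eq_zero_iff {z : ℤ} (x : F z) : symbol F z x = 0 ↔ (x : B) ∈ F (z - 1) := by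
  refine ⟨fun h => ?_, fun h => symbol_eq_zero x.2 h⟩
  have h1 : GradedPiece.mk F z x = 0 :=
    DirectSum.of_injective (β := GradedPiece F) z (h.trans (map_zero _).symm)
  exact (Submodule.Quotient.mk_eq_zero ((F (z - 1)).submoduleOf (F z))).1 h1

theorem snd_mem_tensorDegree_piece {z : ℤ} {q : (B ⊗[K] B) × (AssocGraded F ⊗[K] AssocGraded F)}
    (h : q ∈ tensorSymbol F z) : q.2 ∈ tensorDegree (piece F) z := by
  have : tensorSymbol F z ≤ (tensorDegree (piece F) z).comap (LinearMap.snd K _ _) := by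
    refine Submodule.span_le.2 ?_
    rintro _ ⟨r, s, hrs, x, y, rfl⟩
    exact tmul_mem_tensorDegree hrs (symbol_mem_piece r x) (symbol_mem_piece s y)
  exact this h

variable [IsBialgebraFiltration F]

theorem one_mem_piece : (1 : AssocGraded F) ∈ piece F 0 := symbol_mem_piece _ _

theorem mul_mem_piece {m n : ℤ} {a b : AssocGraded F} (ha : a ∈ piece F m) (hb : b ∈ piece F n) :
    a * b ∈ piece F (m + n) := by
  obtain ⟨x, rfl⟩ := ha
  obtain ⟨y, rfl⟩ := hb
  rw [symbol_mul_symbol]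
  exact symbol_mem_piece _ _

theorem counit_of_mem_piece {n : ℤ} {a : AssocGraded F} (hn : n ≠ 0) (ha : a ∈ piece F n) :
    Coalgebra.counit (R := K) a = 0 := by
  obtain ⟨x, rfl⟩ := ha
  rw [counit_symbol, if_neg hn]

theorem comul_mem_of_mem_piece {n : ℤ} {a : AssocGraded F} (ha : a ∈ piece F n) :
    Coalgebra.comul (R := K) a ∈ tensorDegree (piece F) n := by
  obtain ⟨x, rfl⟩ := ha
  exact snd_mem_tensorDegree_piece (comul_symbol_mem n x)

theorem isConnectedGrading_piece (hneg : ∀ z < 0, F z ≤ F (z - 1))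
    (hzero : ∀ x ∈ F 0, ∃ c : K, x - c • 1 ∈ F (-1)) : IsConnectedGrading (piece F) where
  isInternal := isInternal_piece
  one_mem := one_mem_piece
  mul_mem := mul_mem_piece
  counit_eq_zero := counit_of_mem_piece
  comul_mem := comul_mem_of_mem_piece
  eq_bot_of_neg := by
    intro n hn
    refine eq_bot_iff.2 ?_
    rintro _ ⟨x, rfl⟩
    exact symbol_eq_zero _ (hneg n hn x.2)
  zero_le := by
    rintro _ ⟨x, rfl⟩
    obtain ⟨c, hc⟩ := hzero x x.2
    refine Submodule.mem_span_singleton.2 ⟨c, ?_⟩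
    rw [one_def, ← map_smul]
    refine (sub_eq_zero.1 ?_).symm
    rw [← map_sub]
    exact symbol_eq_zero _ hc

/-- This version serves filtrations concentrated in indices `≤ 0`, such as the ε-filtration, where
the degree is minus the filtration index. -/
theorem isConnectedGrading_piece_neg (hpos : ∀ z > 0, F z ≤ F (z - 1))
    (hzero : ∀ x ∈ F 0, ∃ c : K, x - c • 1 ∈ F (-1)) :
    IsConnectedGrading (fun n => piece F (-n)) where
  isInternal := isInternal_piece_neg
  one_mem := by simpa using one_mem_piece (F := F)
  mul_mem := fun {m n a b} ha hb => by
    have := mul_mem_piece ha hb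
    rwa [← neg_add] at this
  counit_eq_zero := fun hn ha => counit_of_mem_piece (neg_ne_zero.2 hn) ha
  comul_mem := fun ha => by
    rw [tensorDegree_neg]
    exact comul_mem_of_mem_piece ha
  eq_bot_of_neg := by
    intro n hn
    refine eq_bot_iff.2 ?_
    rintro _ ⟨x, rfl⟩
    exact symbol_eq_zero _ (hpos (-n) (by omega) x.2)
  zero_le := by
    rw [neg_zero]
    rintro _ ⟨x, rfl⟩
    obtain ⟨c, hc⟩ := hzero x x.2
    refine Submodule.mem_span_singleton.2 ⟨c, ?_⟩
    rw [one_def, ← map_smul]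
    refine (sub_eq_zero.1 ?_).symm
    rw [← map_sub]
    exact symbol_eq_zero _ hc

end AssocGraded

theorem isConnectedGrading_deltaFiltration :
    IsConnectedGrading (AssocGraded.piece (deltaFiltration K B)) :=
  AssocGraded.isConnectedGrading_piece
    (fun z hz => by rw [deltaFiltration_of_neg hz]; exact bot_le)
    (fun x hx => by
      rw [deltaFiltration_zero] at hx
      obtain ⟨c, rfl⟩ := Submodule.mem_span_singleton.1 hx
      exact ⟨c, by simp⟩)

end Pieces

/-! ### From an antipode to a Hopf algebra structure. -/

section HopfOfAntipode

variable {K : Type u} [Field K] {H : Type v} [Ring H] [Bialgebra K H]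

/-- The Hopf algebra structure given by an antipode. -/
abbrev IsAntipode.hopfAlgebra {S : H →ₗ[K] H} (hS : IsAntipode S) : HopfAlgebra K H where
  antipode := S
  mul_antipode_rTensor_comul := hS.left
  mul_antipode_lTensor_comul := hS.right

theorem isAntipode_antipode {K : Type u} [Field K] {H : Type v} [Ring H] [HopfAlgebra K H] :
    IsAntipode (HopfAlgebra.antipode K (A := H)) :=
  ⟨HopfAlgebra.mul_antipode_rTensor_comul, HopfAlgebra.mul_antipode_lTensor_comul⟩

end HopfOfAntipode

/-! ### Antipodes and Poisson brackets. -/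

section PoissonAntipode

open WithConv

variable {K : Type u} [Field K] {H : Type v} [CommRing H] [HopfAlgebra K H]

theorem convMul_tmul (f g : WithConv (H ⊗[K] H →ₗ[K] H)) (a b : H) :
    (f * g).ofConv (a ⊗ₜ[K] b) =
      ∑ i ∈ (Coalgebra.Repr.arbitrary K a).index, ∑ j ∈ (Coalgebra.Repr.arbitrary K b).index,
        f.ofConv ((Coalgebra.Repr.arbitrary K a).left i ⊗ₜ (Coalgebra.Repr.arbitrary K b).left j) *
        g.ofConv ((Coalgebra.Repr.arbitrary K a).right i ⊗ₜ
          (Coalgebra.Repr.arbitrary K b).right j) := by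
  rw [LinearMap.convMul_def, ofConv_toConv, LinearMap.comp_apply, LinearMap.comp_apply,
    TensorProduct.comul_tmul, ← (Coalgebra.Repr.arbitrary K a).eq,
    ← (Coalgebra.Repr.arbitrary K b).eq, TensorProduct.sum_tmul]
  simp only [TensorProduct.tmul_sum, map_sum]
  simp

/-- In a commutative Hopf algebra, the antipode is compatible with every bracket which is a
biderivation compatible with the coproduct and the counit. -/
theorem antipode_bracket (br : H →ₗ[K] H →ₗ[K] H) (hself : ∀ a, br a a = 0)
    (hleft : ∀ a b c, br (a * b) c = br a c * b + a * br b c)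
    (hright : ∀ a b c, br a (b * c) = br a b * c + b * br a c)
    (hcomul : ∀ a b, Coalgebra.comul (R := K) (br a b) =
      tensorBracket br (Coalgebra.comul a) (Coalgebra.comul b))
    (hcounit : ∀ a b, Coalgebra.counit (R := K) (br a b) = 0) (a b : H) :
    HopfAlgebra.antipode K (br a b) =
      br (HopfAlgebra.antipode K b) (HopfAlgebra.antipode K a) := by
  set S : H →ₗ[K] H := HopfAlgebra.antipode K with hSdef
  have hswap : ∀ x y, br x y = -br y x := by
    intro x y
    have := hself (x + y)
    simp only [map_add, LinearMap.add_apply, hself, zero_add, add_zero] at this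
    exact eq_neg_of_add_eq_zero_right this
  have hS1 : ∀ x : H, ∑ i ∈ (Coalgebra.Repr.arbitrary K x).index,
      S ((Coalgebra.Repr.arbitrary K x).left i) * (Coalgebra.Repr.arbitrary K x).right i =
        algebraMap K H (Coalgebra.counit x) :=
    fun x => HopfAlgebra.sum_antipode_mul_eq_algebraMap_counit _
  have hone_left : ∀ (c : K) (y : H), br (algebraMap K H c) y = 0 := by
    intro c y
    have : br 1 y = 0 := by simpa using hleft 1 1 y
    rw [Algebra.algebraMap_eq_smul_one, map_smul, LinearMap.smul_apply, this, smul_zero]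
  have hone_right : ∀ (c : K) (y : H), br y (algebraMap K H c) = 0 := by
    intro c y; rw [hswap, hone_left, neg_zero]
  -- In the convolution algebra of maps `H ⊗ H → H`, both `a ⊗ b ↦ S{a, b}` and `a ⊗ b ↦ {Sb, Sa}`
  -- solve the equation `Y * m + (S ∘ m) * β = 0`, with `β` the bracket. As `m` has the right
  -- inverse `S ∘ m`, the solution is unique.
  let m : WithConv (H ⊗[K] H →ₗ[K] H) := toConv (LinearMap.mul' K H)
  let Sm : WithConv (H ⊗[K] H →ₗ[K] H) := toConv (S ∘ₗ LinearMap.mul' K H)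
  let β : WithConv (H ⊗[K] H →ₗ[K] H) := toConv (TensorProduct.lift br)
  let Sβ : WithConv (H ⊗[K] H →ₗ[K] H) := toConv (S ∘ₗ TensorProduct.lift br)
  let ρ : WithConv (H ⊗[K] H →ₗ[K] H) := toConv (TensorProduct.lift (br.flip.compl₁₂ S S))
  have hmSm : m * Sm = 1 := by
    refine WithConv.ofConv_injective (TensorProduct.ext' fun x y => ?_)
    rw [convMul_tmul]
    simp only [m, Sm, LinearMap.comp_apply, LinearMap.mul'_apply, hSdef,
      HopfAlgebra.antipode_mul_distrib]
    have h1 := HopfAlgebra.sum_mul_antipode_eq_algebraMap_counit (Coalgebra.Repr.arbitrary K x)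
    have h2 := HopfAlgebra.sum_mul_antipode_eq_algebraMap_counit (Coalgebra.Repr.arbitrary K y)
    change _ = algebraMap K H (Coalgebra.counit (R := K) (x ⊗ₜ[K] y))
    rw [TensorProduct.counit_tmul, smul_eq_mul, mul_comm (Coalgebra.counit y), map_mul, ← h1, ← h2,
      Finset.sum_mul_sum]
    refine Finset.sum_congr rfl fun i _ => Finset.sum_congr rfl fun j _ => by ring
  have h1 : Sβ * m + Sm * β = 0 := by
    refine WithConv.ofConv_injective (TensorProduct.ext' fun x y => ?_)
    change (Sβ * m).ofConv (x ⊗ₜ y) + (Sm * β).ofConv (x ⊗ₜ y) = 0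
    -- The first equation is the antipode axiom at `{x, y}`, expanded by the coproduct of a bracket;
    -- the right-hand side is zero because `ε{x, y} = 0`.
    have h := LinearMap.congr_fun (HopfAlgebra.mul_antipode_rTensor_comul (R := K) (A := H))
      (br x y)
    simp only [LinearMap.comp_apply, hcounit, map_zero, hcomul] at h
    rw [← h, convMul_tmul, convMul_tmul, ← Finset.sum_add_distrib]
    conv_rhs => rw [← (Coalgebra.Repr.arbitrary K x).eq, ← (Coalgebra.Repr.arbitrary K y).eq]
    simp only [map_sum, LinearMap.sum_apply, ← Finset.sum_add_distrib]
    rw [Finset.sum_comm]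
    refine Finset.sum_congr rfl fun i _ => Finset.sum_congr rfl fun j _ => ?_
    simp [Sβ, m, Sm, β, tensorBracket, hSdef]
  have h2 : ρ * m + Sm * β = 0 := by
    refine WithConv.ofConv_injective (TensorProduct.ext' fun x y => ?_)
    change (ρ * m).ofConv (x ⊗ₜ y) + (Sm * β).ofConv (x ⊗ₜ y) = 0
    rw [convMul_tmul, convMul_tmul]
    simp only [m, Sm, ρ, β, LinearMap.comp_apply, LinearMap.mul'_apply,
      TensorProduct.lift.tmul, LinearMap.compl₁₂_apply, LinearMap.flip_apply]
    simp only [hSdef, HopfAlgebra.antipode_mul_distrib]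
    simp only [← hSdef]
    set X := Coalgebra.Repr.arbitrary K x
    set Y := Coalgebra.Repr.arbitrary K y
    have r1 : ∀ z, ∑ i ∈ X.index, S (X.left i) * br (X.right i) z =
        -∑ i ∈ X.index, br (S (X.left i)) z * X.right i := by
      intro z
      have := congrArg (fun t => br t z) (hS1 x)
      simp only [map_sum, LinearMap.sum_apply, hleft, hone_left, Finset.sum_add_distrib] at this
      exact eq_neg_of_add_eq_zero_right this
    have r2 : ∀ z, ∑ j ∈ Y.index, S (Y.left j) * br z (Y.right j) =
        -∑ j ∈ Y.index, br z (S (Y.left j)) * Y.right j := by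
      intro z
      have := congrArg (fun t => br z t) (hS1 y)
      simp only [map_sum, hright, hone_right, Finset.sum_add_distrib] at this
      exact eq_neg_of_add_eq_zero_right this
    have e1 : ∑ i ∈ X.index, ∑ j ∈ Y.index,
        S (X.left i) * S (Y.left j) * br (X.right i) (Y.right j) =
        ∑ j ∈ Y.index, S (Y.left j) * ∑ i ∈ X.index, S (X.left i) * br (X.right i) (Y.right j) := by
      rw [Finset.sum_comm]
      refine Finset.sum_congr rfl fun j _ => ?_
      rw [Finset.mul_sum]
      exact Finset.sum_congr rfl fun i _ => by ring
    have e2 : ∑ j ∈ Y.index, S (Y.left j) *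
        ∑ i ∈ X.index, br (S (X.left i)) (Y.right j) * X.right i =
        ∑ i ∈ X.index, X.right i * ∑ j ∈ Y.index, S (Y.left j) * br (S (X.left i)) (Y.right j) := by
      simp only [Finset.mul_sum]
      rw [Finset.sum_comm]
      exact Finset.sum_congr rfl fun i _ => Finset.sum_congr rfl fun j _ => by ring
    rw [e1]
    simp only [r1, mul_neg, Finset.sum_neg_distrib]
    rw [e2]
    simp only [r2, mul_neg, Finset.sum_neg_distrib, neg_neg]
    rw [← Finset.sum_add_distrib]
    refine Finset.sum_eq_zero fun i _ => ?_
    rw [Finset.mul_sum, ← Finset.sum_add_distrib]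
    refine Finset.sum_eq_zero fun j _ => ?_
    rw [hswap (S (Y.left j))]
    ring
  have h3 : Sβ = ρ := by
    have : (Sβ - ρ) * m = 0 := by
      rw [sub_mul, ← add_sub_add_right_eq_sub _ _ (Sm * β), h1, h2, sub_zero]
    have := congrArg (· * Sm) this
    simpa [mul_assoc, hmSm, sub_eq_zero] using this
  have h4 := LinearMap.congr_fun (congrArg WithConv.ofConv h3) (a ⊗ₜ[K] b)
  simpa [Sβ, ρ] using h4

theorem IsAntipode.bracket {H : Type v} [Ring H] [Bialgebra K H] (hc : ∀ a b : H, a * b = b * a)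
    {S : H →ₗ[K] H} (hS : IsAntipode S) (br : H →ₗ[K] H →ₗ[K] H) (hself : ∀ a, br a a = 0)
    (hleft : ∀ a b c, br (a * b) c = br a c * b + a * br b c)
    (hright : ∀ a b c, br a (b * c) = br a b * c + b * br a c)
    (hcomul : ∀ a b, Coalgebra.comul (R := K) (br a b) =
      tensorBracket br (Coalgebra.comul a) (Coalgebra.comul b))
    (hcounit : ∀ a b, Coalgebra.counit (R := K) (br a b) = 0) (a b : H) :
    S (br a b) = br (S b) (S a) := by
  let : CommRing H := { ‹Ring H› with mul_comm := hc }
  let : HopfAlgebra K H := hS.hopfAlgebra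
  exact antipode_bracket br hself hleft hright hcomul hcounit a b

end PoissonAntipode

/-! ### The Poisson bracket induced by the commutator. -/

section InducedBracket

variable {K : Type u} [Field K] {B : Type v} [Ring B] [Bialgebra K B]
  {F : ℤ → Submodule K B} [IsBialgebraFiltration F]

namespace AssocGraded

theorem symbol_eq_add {z z₁ z₂ : ℤ} (h₁ : z = z₁) (h₂ : z = z₂) {x x₁ x₂ : B} (hx : x ∈ F z)
    (hx₁ : x₁ ∈ F z₁) (hx₂ : x₂ ∈ F z₂) (e : x = x₁ + x₂) :
    symbol F z ⟨x, hx⟩ = symbol F z₁ ⟨x₁, hx₁⟩ + symbol F z₂ ⟨x₂, hx₂⟩ := by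
  subst h₁; subst h₂; subst e
  rw [← map_add]; rfl

theorem symbol_eq_symbol_of_sub_mem {z z' : ℤ} (h : z = z') {x x' : B} (hx : x ∈ F z)
    (hx' : x' ∈ F z') (e : x - x' ∈ F (z - 1)) :
    symbol F z ⟨x, hx⟩ = symbol F z' ⟨x', hx'⟩ := by
  subst h
  rw [← sub_eq_zero, ← map_sub]
  exact symbol_eq_zero _ e

variable (hF : ∀ {m n : ℤ} {x y : B}, x ∈ F m → y ∈ F n → x * y - y * x ∈ F (m + n - 1))

include hF in
theorem mul_comm_of_commutator_mem (a b : AssocGraded F) : a * b = b * a := by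
  induction a using induction_on with
  | hadd a a' h h' => simp only [add_mul, mul_add, h, h']
  | h m x =>
  induction b using induction_on with
  | hadd a a' h h' => simp only [mul_add, add_mul, h, h']
  | h n y =>
  rw [symbol_mul_symbol, symbol_mul_symbol]
  exact symbol_eq_symbol_of_sub_mem (add_comm m n) _ _ (hF x.2 y.2)

/-- The bracket on `G_F(B)` induced by the commutator of `B`. -/
def bracketHom : AssocGraded F →ₗ[K] AssocGraded F →ₗ[K] AssocGraded F :=
  lift (fun m => LinearMap.flip (lift (fun n => LinearMap.flip (LinearMap.mk₂ K
      (fun (x : F m) (y : F n) => symbol F (m + n - 1) ⟨(x : B) * y - y * x, hF x.2 y.2⟩)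
      (fun x x' y => by
        rw [← map_add]; exact symbol_congr rfl _ _ (by simp [add_mul, mul_add]; abel))
      (fun c x y => by
        rw [← map_smul]; exact symbol_congr rfl _ _ (by simp [smul_sub]))
      (fun x y y' => by
        rw [← map_add]; exact symbol_congr rfl _ _ (by simp [mul_add, add_mul]; abel))
      (fun c x y => by
        rw [← map_smul]; exact symbol_congr rfl _ _ (by simp [smul_sub]))))
    (fun n y hy => by
      ext x
      refine symbol_eq_zero _ ?_
      have := hF x.2 hy
      rwa [show m + (n - 1) - 1 = m + n - 1 - 1 by ring] at this)))
    (fun m x hx => by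
      refine hom_ext fun n y => ?_
      simp only [LinearMap.flip_apply, lift_symbol, LinearMap.mk₂_apply, LinearMap.zero_apply]
      refine symbol_eq_zero _ ?_
      have := hF hx y.2
      rwa [show m - 1 + n - 1 = m + n - 1 - 1 by ring] at this)

theorem bracketHom_symbol (m n : ℤ) (x : F m) (y : F n) :
    bracketHom hF (symbol F m x) (symbol F n y) =
      symbol F (m + n - 1) ⟨(x : B) * y - y * x, hF x.2 y.2⟩ := by
  simp [bracketHom]

theorem isInducedBracket_bracketHom : IsInducedBracket F (bracketHom hF) :=
  fun m n x y => ⟨hF x.2 y.2, bracketHom_symbol hF m n x y⟩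

theorem bracketHom_mem_piece {m n : ℤ} {a b : AssocGraded F} (ha : a ∈ piece F m)
    (hb : b ∈ piece F n) : bracketHom hF a b ∈ piece F (m + n - 1) := by
  obtain ⟨x, rfl⟩ := ha
  obtain ⟨y, rfl⟩ := hb
  rw [bracketHom_symbol]
  exact symbol_mem_piece _ _

theorem bracketHom_swap (a b : AssocGraded F) : bracketHom hF a b = -bracketHom hF b a := by
  induction a using induction_on with
  | hadd a a' h h' => simp only [map_add, LinearMap.add_apply, h, h', neg_add]
  | h m x =>
  induction b using induction_on with
  | hadd a a' h h' => simp only [map_add, LinearMap.add_apply, h, h', neg_add]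
  | h n y =>
  rw [bracketHom_symbol, bracketHom_symbol, ← map_neg]
  exact symbol_congr (by ring) _ _ (by simp)

theorem bracketHom_self (a : AssocGraded F) : bracketHom hF a a = 0 := by
  induction a using induction_on with
  | hadd a a' h h' =>
    simp only [map_add, LinearMap.add_apply, h, h', zero_add, add_zero]
    rw [bracketHom_swap, neg_add_cancel]
  | h m x =>
    rw [bracketHom_symbol]
    exact symbol_eq_zero _ (by rw [sub_self]; exact zero_mem _)

theorem bracketHom_leibniz_left (a b c : AssocGraded F) :
    bracketHom hF (a * b) c = bracketHom hF a c * b + a * bracketHom hF b c := by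
  induction a using induction_on with
  | hadd a a' h h' => simp only [map_add, LinearMap.add_apply, add_mul, h, h']; abel
  | h m x =>
  induction b using induction_on with
  | hadd a a' h h' => simp only [map_add, LinearMap.add_apply, mul_add, h, h']; abel
  | h n y =>
  induction c using induction_on with
  | hadd a a' h h' => simp only [map_add, add_mul, mul_add, h, h']; abel
  | h k z =>
  simp only [symbol_mul_symbol, bracketHom_symbol]
  exact symbol_eq_add (by ring) (by ring) _ _ _ (by noncomm_ring)

theorem bracketHom_jacobi (a b c : AssocGraded F) : bracketHom hF a (bracketHom hF b c) +
    bracketHom hF b (bracketHom hF c a) + bracketHom hF c (bracketHom hF a b) = 0 := by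
  induction a using induction_on with
  | hadd a a' h h' =>
    rw [← add_zero (0 : AssocGraded F)]
    nth_rw 1 [← h]
    rw [← h']
    simp only [map_add, LinearMap.add_apply]; abel
  | h m x =>
  induction b using induction_on with
  | hadd a a' h h' =>
    rw [← add_zero (0 : AssocGraded F)]
    nth_rw 1 [← h]
    rw [← h']
    simp only [map_add, LinearMap.add_apply]; abel
  | h n y =>
  induction c using induction_on with
  | hadd a a' h h' =>
    rw [← add_zero (0 : AssocGraded F)]
    nth_rw 1 [← h]
    rw [← h']
    simp only [map_add, LinearMap.add_apply]; abel
  | h k z =>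
  simp only [bracketHom_symbol]
  rw [← eq_neg_iff_add_eq_zero, ← map_neg, eq_comm]
  refine symbol_eq_add (by ring) (by ring) _ _ _ ?_
  simp only
  noncomm_ring

theorem bracketHom_leibniz_right (a b c : AssocGraded F) :
    bracketHom hF a (b * c) = bracketHom hF a b * c + b * bracketHom hF a c := by
  rw [bracketHom_swap, bracketHom_leibniz_left, bracketHom_swap hF b, bracketHom_swap hF c]
  simp [add_comm]

theorem counit_bracketHom (a b : AssocGraded F) :
    Coalgebra.counit (R := K) (bracketHom hF a b) = 0 := by
  induction a using induction_on with
  | hadd a a' h h' => simp only [map_add, LinearMap.add_apply, h, h', add_zero]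
  | h m x =>
  induction b using induction_on with
  | hadd a a' h h' => simp only [map_add, h, h', add_zero]
  | h n y =>
  rw [bracketHom_symbol, counit_symbol]
  simp [mul_comm]

/-- The identity `[x ⊗ y, x' ⊗ y'] = [x, x'] ⊗ y'y + xx' ⊗ [y, y']` holds before grading;
commutativity of the graded algebra then identifies the classes of `y'y` and `yy'`. This is what
makes the bracket compatible with the coproduct. -/
theorem commutator_mem_tensorSymbol {m n : ℤ}
    {q q' : (B ⊗[K] B) × (AssocGraded F ⊗[K] AssocGraded F)}
    (hq : q ∈ tensorSymbol F m) (hq' : q' ∈ tensorSymbol F n) :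
    (q.1 * q'.1 - q'.1 * q.1, tensorBracket (bracketHom hF) q.2 q'.2) ∈
      tensorSymbol F (m + n - 1) := by
  induction hq using Submodule.span_induction with
  | zero =>
    convert zero_mem (tensorSymbol F _) using 1
    exact Prod.ext (by simp) (by simp)
  | add p p' _ _ h h' =>
    convert add_mem h h' using 1
    refine Prod.ext ?_ ?_
    · simp only [Prod.fst_add, add_mul, mul_add]; abel
    · simp
  | smul c p _ h =>
    convert Submodule.smul_mem _ c h using 1
    refine Prod.ext ?_ ?_
    · simp [smul_sub]
    · simp
  | mem p hp =>
    obtain ⟨r, s, rfl, x, y, rfl⟩ := hp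
    induction hq' using Submodule.span_induction with
    | zero =>
      convert zero_mem (tensorSymbol F _) using 1
      exact Prod.ext (by simp) (by simp)
    | add p p' _ _ h h' =>
      convert add_mem h h' using 1
      refine Prod.ext ?_ ?_
      · simp only [Prod.fst_add, add_mul, mul_add]; abel
      · simp
    | smul c p _ h =>
      convert Submodule.smul_mem _ c h using 1
      refine Prod.ext ?_ ?_
      · simp [smul_sub]
      · simp
    | mem q hq =>
      obtain ⟨r', s', rfl, x', y', rfl⟩ := hq
      have h1 : ((((x : B) * x' - x' * x) ⊗ₜ[K] ((y' : B) * y)),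
          bracketHom hF (symbol F r x) (symbol F r' x') ⊗ₜ[K] (symbol F s' y' * symbol F s y)) ∈
          tensorSymbol F (r + s + (r' + s') - 1) := by
        rw [bracketHom_symbol, symbol_mul_symbol]
        exact Submodule.subset_span ⟨r + r' - 1, s' + s, by ring, ⟨_, hF x.2 x'.2⟩,
          ⟨_, IsBialgebraFiltration.mul_mem y'.2 y.2⟩, rfl⟩
      have h2 : ((((x : B) * x') ⊗ₜ[K] ((y : B) * y' - y' * y)),
          (symbol F r x * symbol F r' x') ⊗ₜ[K] bracketHom hF (symbol F s y) (symbol F s' y')) ∈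
          tensorSymbol F (r + s + (r' + s') - 1) := by
        rw [bracketHom_symbol, symbol_mul_symbol]
        exact Submodule.subset_span ⟨r + r', s + s' - 1, by ring,
          ⟨_, IsBialgebraFiltration.mul_mem x.2 x'.2⟩, ⟨_, hF y.2 y'.2⟩, rfl⟩
      convert add_mem h1 h2 using 1
      refine Prod.ext ?_ ?_
      · simp [TensorProduct.sub_tmul, TensorProduct.tmul_sub]
      · simp [tensorBracket, mul_comm_of_commutator_mem hF (symbol F s y)]

theorem comul_bracketHom (a b : AssocGraded F) :
    Coalgebra.comul (R := K) (bracketHom hF a b) =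
      tensorBracket (bracketHom hF) (Coalgebra.comul a) (Coalgebra.comul b) := by
  induction a using induction_on with
  | hadd a a' h h' => simp only [map_add, LinearMap.add_apply, h, h']
  | h m x =>
  induction b using induction_on with
  | hadd a a' h h' => simp only [map_add, h, h']
  | h n y =>
  refine tensorSymbol_unique IsBialgebraFiltration.monotone
    (t := Coalgebra.comul (R := K) ((x : B) * y - y * x)) (z := m + n - 1) ?_ ?_
  · rw [bracketHom_symbol]
    exact comul_symbol_mem (m + n - 1) ⟨(x : B) * y - y * x, hF x.2 y.2⟩
  · have := commutator_mem_tensorSymbol hF (comul_symbol_mem m x) (comul_symbol_mem n y)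
    simpa [Bialgebra.comul_mul] using this

theorem isPoissonHopf_bracketHom {S : AssocGraded F →ₗ[K] AssocGraded F} (hS : IsAntipode S) :
    IsPoissonHopf S (bracketHom hF) where
  mul_comm := mul_comm_of_commutator_mem hF
  bracket_self := bracketHom_self hF
  jacobi := bracketHom_jacobi hF
  leibniz_left := bracketHom_leibniz_left hF
  leibniz_right := bracketHom_leibniz_right hF
  comul_bracket := comul_bracketHom hF
  counit_bracket := counit_bracketHom hF
  antipode_bracket := hS.bracket (mul_comm_of_commutator_mem hF) _ (bracketHom_self hF)
    (bracketHom_leibniz_left hF) (bracketHom_leibniz_right hF) (comul_bracketHom hF)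
    (counit_bracketHom hF)

end AssocGraded

end InducedBracket

/-! ### Invariant derivations on a commutative bialgebra. -/

section Augmentation

variable {K : Type u} [Field K] {H : Type v} [CommRing H] [Bialgebra K H]

variable (K H) in
/-- The augmentation ideal of a commutative bialgebra. -/
def augIdeal : Ideal H := RingHom.ker (Bialgebra.counitAlgHom K H)

theorem mem_augIdeal {a : H} : a ∈ augIdeal K H ↔ Coalgebra.counit (R := K) a = 0 := Iff.rfl

/-- A linear form on `H` which is a derivation with respect to the counit. -/
def IsPointDerivation (d : H →ₗ[K] K) : Prop :=
  ∀ a b : H, d (a * b) = Coalgebra.counit (R := K) a * d b + d a * Coalgebra.counit (R := K) b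

/-- The invariant derivation `(id ⊗ d) ∘ Δ` attached to a linear form `d`. -/
def invariantMap (d : H →ₗ[K] K) : H →ₗ[K] H :=
  (TensorProduct.rid K H).toLinearMap ∘ₗ d.lTensor H ∘ₗ Coalgebra.comul

/-- Apply `id ⊗ d` to `Δ(a)Δ(b)`: the derivation rule leaves `id ⊗ ε` on one of the two factors, and
the counit axiom turns this back into `a` or `b`. -/
theorem invariantMap_mul {d : H →ₗ[K] K} (hd : IsPointDerivation d) (a b : H) :
    invariantMap d (a * b) = a * invariantMap d b + b * invariantMap d a := by
  have key : ∀ s t : H ⊗[K] H, TensorProduct.rid K H (d.lTensor H (s * t)) =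
      TensorProduct.rid K H (Coalgebra.counit.lTensor H s) * TensorProduct.rid K H (d.lTensor H t) +
      TensorProduct.rid K H (Coalgebra.counit.lTensor H t) *
        TensorProduct.rid K H (d.lTensor H s) := by
    intro s t
    induction s using TensorProduct.induction_on with
    | zero => simp
    | add s s' h h' => simp only [add_mul, mul_add, map_add, h, h']; ring
    | tmul x y =>
      induction t using TensorProduct.induction_on with
      | zero => simp
      | add s s' h h' => simp only [add_mul, mul_add, map_add, h, h']; ring
      | tmul x' y' =>
        simp only [Algebra.TensorProduct.tmul_mul_tmul, LinearMap.lTensor_tmul,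
          TensorProduct.rid_tmul, hd y y', add_smul]
        simp only [Algebra.smul_def, map_mul]
        ring
  simp only [invariantMap, LinearMap.comp_apply, LinearEquiv.coe_coe, Bialgebra.comul_mul, key,
    Coalgebra.lTensor_counit_comul, TensorProduct.rid_tmul, one_smul]

theorem counit_invariantMap (d : H →ₗ[K] K) (a : H) :
    Coalgebra.counit (R := K) (invariantMap d a) = d a := by
  have key : ∀ s : H ⊗[K] H, Coalgebra.counit (R := K) (TensorProduct.rid K H (d.lTensor H s)) =
      d (TensorProduct.lid K H (Coalgebra.counit.rTensor H s)) := by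
    intro s
    induction s using TensorProduct.induction_on with
    | zero => simp
    | add s s' h h' => simp only [map_add, h, h']
    | tmul x y => simp [mul_comm]
  have := key (Coalgebra.comul a)
  rw [Coalgebra.rTensor_counit_comul, TensorProduct.lid_tmul, one_smul] at this
  exact this

/-- A derivation lowers the order with respect to an ideal by at most one. -/
theorem invariantMap_mem_pow {d : H →ₗ[K] K} (hd : IsPointDerivation d) (n : ℕ) :
    ∀ a ∈ augIdeal K H ^ (n + 1), invariantMap d a ∈ augIdeal K H ^ n := by
  induction n with
  | zero => intro a _; simp
  | succ n ih =>
    intro a ha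
    rw [pow_succ] at ha
    induction ha using Submodule.mul_induction_on' with
    | mem_mul_mem x hx y hy =>
      rw [invariantMap_mul hd]
      refine add_mem (Ideal.mul_mem_right _ _ hx) ?_
      rw [pow_succ']
      exact Ideal.mul_mem_mul hy (ih x hx)
    | add x _ y _ hx hy => rw [map_add]; exact add_mem hx hy

end Augmentation

/-! ### Independence of reduced monomials. -/

section Independence

open MvPolynomial

variable {K : Type u} [Field K] {H : Type v} [CommRing H] [Bialgebra K H] {ι : Type w}

/-- A polynomial is reduced if all factorials of the exponents of its monomials are invertible. -/
def IsReducedPoly (f : MvPolynomial ι K) : Prop :=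
  ∀ a, f.coeff a ≠ 0 → ∀ i, ((a i).factorial : K) ≠ 0

theorem IsReducedPoly.pderiv {f : MvPolynomial ι K} (hf : IsReducedPoly f) (j : ι) :
    IsReducedPoly (MvPolynomial.pderiv j f) := by
  intro a ha i
  rw [coeff_pderiv] at ha
  have h1 := hf _ (left_ne_zero_of_mul ha) i
  intro h2
  apply h1
  have hle : a i ≤ (a + Finsupp.single j 1 : ι →₀ ℕ) i := by simp
  obtain ⟨c, hc⟩ := Nat.factorial_dvd_factorial hle
  rw [hc, Nat.cast_mul, h2, zero_mul]

theorem isHomogeneous_pderiv {f : MvPolynomial ι K} {n : ℕ} (hf : f.IsHomogeneous (n + 1))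
    (j : ι) : (MvPolynomial.pderiv j f).IsHomogeneous n := by
  intro a ha
  rw [coeff_pderiv] at ha
  have h1 := hf (left_ne_zero_of_mul ha)
  simp only [map_add] at h1
  have h2 : (Finsupp.weight (1 : ι → ℕ)) (Finsupp.single j 1) = 1 := by
    simp [Finsupp.weight_apply]
  omega

variable {x : ι → H} (hx : ∀ i, x i ∈ augIdeal K H)

include hx in
theorem aeval_mem_pow_of_isHomogeneous {f : MvPolynomial ι K} {n : ℕ} (hf : f.IsHomogeneous n) :
    aeval x f ∈ augIdeal K H ^ n := by
  have hm : ∀ a : ι →₀ ℕ, ∀ c : K, aeval x (monomial a c) ∈ augIdeal K H ^ a.degree := by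
    intro a c
    rw [aeval_monomial]
    refine Ideal.mul_mem_left _ _ ?_
    rw [Finsupp.degree_apply, ← Finset.prod_pow_eq_pow_sum]
    exact Ideal.prod_mem_prod fun i _ => Ideal.pow_mem_pow (hx i) _
  rw [f.as_sum, map_sum]
  refine Ideal.sum_mem _ fun a ha => ?_
  have : a.degree = n := by
    by_contra hne
    exact (mem_support_iff.1 ha) (hf.coeff_eq_zero hne)
  rw [← this]
  exact hm a _

variable {d : ι → H →ₗ[K] K} (hd : ∀ i, IsPointDerivation (d i))
  (hdx : ∀ i j, d i (x j) = Finsupp.single j (1 : K) i)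

-- The invariant derivation `D_j` of `d_j` satisfies `D_j x_i ≡ δ_ij` modulo `I`, since `ε ∘ D_j =
-- d_j`. The values of `∂f/∂X_j` lie in `I^{n-1}`, so the error in `I^n` is of higher order; it is
-- propagated by the product rule, one variable at a time.
include hx hd hdx in
theorem invariantMap_aeval_sub_mem {f : MvPolynomial ι K} {n : ℕ} (hf : f.IsHomogeneous n)
    (j : ι) : invariantMap (d j) (aeval x f) - aeval x (pderiv j f) ∈ augIdeal K H ^ n := by
  have hone : invariantMap (d j) 1 = 0 := by
    simpa using invariantMap_mul (hd j) 1 1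
  have hm : ∀ a : ι →₀ ℕ, ∀ c : K, ∃ n, (monomial a c : MvPolynomial ι K).IsHomogeneous n ∧
      invariantMap (d j) (aeval x (monomial a c)) - aeval x (pderiv j (monomial a c)) ∈
        augIdeal K H ^ n := by
    refine induction_on_monomial (fun c => ⟨0, isHomogeneous_C _ c, by simp⟩) ?_
    rintro q i ⟨n, hq, hmem⟩
    refine ⟨n + 1, hq.mul (isHomogeneous_X K i), ?_⟩
    have hXi : invariantMap (d j) (x i) - aeval x (pderiv j (X i : MvPolynomial ι K)) ∈
        augIdeal K H := by
      classical
      rw [mem_augIdeal, map_sub, counit_invariantMap, hdx, pderiv_X, Pi.single_apply,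
        Finsupp.single_apply]
      by_cases hij : j = i
      · rw [if_pos hij.symm, if_pos hij.symm, map_one, Bialgebra.counit_one, sub_self]
      · rw [if_neg (Ne.symm hij), if_neg (Ne.symm hij), map_zero, map_zero, sub_self]
    have e : invariantMap (d j) (aeval x (q * X i)) - aeval x (pderiv j (q * X i)) =
        (invariantMap (d j) (aeval x q) - aeval x (pderiv j q)) * x i +
          aeval x q * (invariantMap (d j) (x i) - aeval x (pderiv j (X i : MvPolynomial ι K))) := by
      simp only [map_mul, pderiv_mul, map_add, aeval_X, invariantMap_mul (hd j)]
      ring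
    rw [e, pow_succ]
    exact add_mem (Ideal.mul_mem_mul hmem (hx i))
      (Ideal.mul_mem_mul (aeval_mem_pow_of_isHomogeneous hx hq) hXi)
  rw [f.as_sum]
  simp only [map_sum, ← Finset.sum_sub_distrib]
  refine Ideal.sum_mem _ fun a ha => ?_
  obtain ⟨m, hm1, hm2⟩ := hm a (coeff a f)
  have ha' := mem_support_iff.1 ha
  have h2 : a.degree = n := by
    by_contra hne
    exact ha' (hf.coeff_eq_zero hne)
  have h3 : m = n := hm1.inj_right (isHomogeneous_monomial _ h2) (by
    rw [Ne, monomial_eq_zero]; exact ha')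
  rw [← h3]
  exact hm2

-- Invariant derivations lower the order by one and agree with partial derivatives to leading order,
-- so by induction all partial derivatives of `f` vanish. A monomial with exponent `a_j ≠ 0` then
-- has coefficient zero, because `a_j` divides `a_j!` and is therefore invertible in `K`.
include hx hd hdx in
theorem eq_zero_of_aeval_mem_pow (n : ℕ) : ∀ f : MvPolynomial ι K, f.IsHomogeneous n →
    IsReducedPoly f → aeval x f ∈ augIdeal K H ^ (n + 1) → f = 0 := by
  induction n with
  | zero =>
    intro f hf _ hmem
    have h1 : f = C (coeff 0 f) := by
      rw [← totalDegree_zero_iff_isHomogeneous] at hf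
      exact totalDegree_eq_zero_iff_eq_C.1 hf
    rw [h1, zero_add, pow_one, mem_augIdeal, aeval_C, Bialgebra.counit_algebraMap] at hmem
    rw [h1, hmem, map_zero]
  | succ n ih =>
    intro f hf hred hmem
    have h0 : ∀ j, pderiv j f = 0 := by
      intro j
      refine ih _ (isHomogeneous_pderiv hf j) (hred.pderiv j) ?_
      have h1 := invariantMap_aeval_sub_mem hx hd hdx hf j
      have h2 := invariantMap_mem_pow (hd j) (n + 1) _ hmem
      have := sub_mem h2 h1
      rwa [sub_sub_cancel] at this
    by_contra hne
    obtain ⟨a, ha⟩ := MvPolynomial.ne_zero_iff.1 hne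
    have hdeg := hf ha
    have : a ≠ 0 := by
      rintro rfl
      simp at hdeg
    obtain ⟨j, hj⟩ := Finsupp.ne_iff.1 this
    rw [Finsupp.zero_apply] at hj
    have h1 := congrArg (coeff (a - Finsupp.single j 1)) (h0 j)
    have h2 : a - Finsupp.single j 1 + Finsupp.single j 1 = a :=
      tsub_add_cancel_of_le (Finsupp.single_le_iff.2 (Nat.one_le_iff_ne_zero.2 hj))
    rw [coeff_pderiv, h2, coeff_zero, mul_eq_zero] at h1
    rcases h1 with h1 | h1
    · exact ha h1
    · have h3 := hred a ha j
      obtain ⟨k, hk⟩ := Nat.exists_eq_succ_of_ne_zero hj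
      apply h3
      rw [hk, Nat.factorial_succ, Nat.cast_mul]
      have : (a - Finsupp.single j 1 : ι →₀ ℕ) j = k := by simp [hk]
      rw [this] at h1
      push_cast at h1 ⊢
      rw [h1, zero_mul]

include hx hd hdx in
/-- The monomials in the `x_i` whose exponents have invertible factorials are independent. -/
theorem eq_zero_of_aeval_eq_zero {f : MvPolynomial ι K} (hf : IsReducedPoly f)
    (h : aeval x f = 0) : f = 0 := by
  -- Components of lower degree vanish by induction and those of higher degree take values in
  -- `I^{n+1}`, so the relation forces the value of the `n`-th one into `I^{n+1}` too.
  have hc : ∀ n, homogeneousComponent n f = 0 := by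
    intro n
    induction n using Nat.strong_induction_on with
    | _ n ih =>
    refine eq_zero_of_aeval_mem_pow hx hd hdx n _ (homogeneousComponent_isHomogeneous n f) ?_ ?_
    · intro a ha
      classical
      rw [coeff_homogeneousComponent] at ha
      exact hf a fun h0 => ha (by simp [h0])
    · have h1 : aeval x (homogeneousComponent n f) =
          -(∑ m ∈ (Finset.range (f.totalDegree + 1)).erase n,
            aeval x (homogeneousComponent m f)) := by
        by_cases hn : n ∈ Finset.range (f.totalDegree + 1)
        · rw [eq_neg_iff_add_eq_zero, Finset.add_sum_erase _ (fun m => aeval x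
            (homogeneousComponent m f)) hn, ← map_sum, sum_homogeneousComponent, h]
        · rw [Finset.erase_eq_of_notMem hn, ← map_sum, sum_homogeneousComponent, h, neg_zero,
            homogeneousComponent_eq_zero n f (by simpa using hn), map_zero]
      rw [h1]
      refine neg_mem (Ideal.sum_mem _ fun m hm => ?_)
      rcases lt_or_gt_of_ne (Finset.ne_of_mem_erase hm) with hlt | hgt
      · rw [ih m hlt, map_zero]; exact zero_mem _
      · exact Ideal.pow_le_pow_right hgt
          (aeval_mem_pow_of_isHomogeneous hx (homogeneousComponent_isHomogeneous m f))
  rw [← sum_homogeneousComponent f]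
  exact Finset.sum_eq_zero fun n _ => hc n

end Independence

/-! ### Homogeneous generators and dual point derivations. -/

section Generators

variable {K : Type u} [Field K]

theorem exists_projections {M : Type v} [AddCommGroup M] [Module K M] {𝒜 : ℤ → Submodule K M}
    (h : DirectSum.IsInternal 𝒜) :
    ∃ π : ℤ → M →ₗ[K] M, ∀ m n, ∀ x ∈ 𝒜 m, π n x = if m = n then x else 0 := by
  let e : (⨁ n, 𝒜 n) ≃ₗ[K] M := LinearEquiv.ofBijective (DirectSum.coeLinearMap 𝒜) h
  refine ⟨fun n => (𝒜 n).subtype ∘ₗ DirectSum.component K ℤ (fun n => 𝒜 n) n ∘ₗ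
    e.symm.toLinearMap, fun m n x hx => ?_⟩
  have h1 : e.symm x = DirectSum.lof K ℤ (fun n => 𝒜 n) m ⟨x, hx⟩ := by
    rw [LinearEquiv.symm_apply_eq]
    exact (DirectSum.coeLinearMap_lof 𝒜 m ⟨x, hx⟩).symm
  simp only [LinearMap.comp_apply, LinearEquiv.coe_coe, h1, Submodule.subtype_apply]
  split_ifs with hmn
  · subst hmn
    rw [DirectSum.component.lof_self]
  · rw [DirectSum.component.of, dif_neg hmn, ZeroMemClass.coe_zero]

variable {H : Type v} [CommRing H] [Bialgebra K H]

variable (K H) in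
/-- The subspace `K ⊕ I²`, where `I` is the augmentation ideal. -/
def scalarsSupAugSq : Submodule K H :=
  Submodule.span K {1} ⊔ (augIdeal K H ^ 2).restrictScalars K

/-- Expand `d((a - ε(a))(b - ε(b))) = 0`, using `d(1) = 0`. -/
theorem isPointDerivation_of_vanish {d : H →ₗ[K] K} (hd : scalarsSupAugSq K H ≤ LinearMap.ker d) :
    IsPointDerivation d := by
  intro a b
  have hone : d 1 = 0 := hd (Submodule.mem_sup_left (Submodule.mem_span_singleton_self 1))
  have hmem : ∀ c : H, c - algebraMap K H (Coalgebra.counit c) ∈ augIdeal K H := fun c => by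
    rw [mem_augIdeal, map_sub, Bialgebra.counit_algebraMap, sub_self]
  have h1 : d ((a - algebraMap K H (Coalgebra.counit a)) *
      (b - algebraMap K H (Coalgebra.counit b))) = 0 :=
    hd (Submodule.mem_sup_right (by
      rw [Submodule.restrictScalars_mem, pow_two]
      exact Ideal.mul_mem_mul (hmem a) (hmem b)))
  simp only [Algebra.algebraMap_eq_smul_one, sub_mul, mul_sub, map_sub, smul_mul_assoc, one_mul,
    mul_smul_comm, mul_one, map_smul, hone, smul_eq_mul, mul_zero, sub_zero] at h1
  linear_combination h1

/-- The `x_i` are homogeneous lifts of a basis of `H/(K ⊕ I²)`, and the `d_i` are the coordinate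
forms. For generation, a homogeneous `f` of degree `n > 0` agrees with a combination of the `x_i` up
to a scalar and an element of `I²`; the degree `n` part of the latter is a sum of products of
elements of smaller positive degree, which the induction covers. -/
theorem IsConnectedGrading.exists_generators {𝒜 : ℤ → Submodule K H} (h : IsConnectedGrading 𝒜) :
    ∃ (ι : Type v) (x : ι → H) (d : ι → H →ₗ[K] K), (∀ i, x i ∈ augIdeal K H) ∧
      (∀ i, IsPointDerivation (d i)) ∧ (∀ i j, d i (x j) = Finsupp.single j (1 : K) i) ∧
      Algebra.adjoin K (Set.range x) = ⊤ := by
  classical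
  set W := scalarsSupAugSq K H with hW
  -- Classes of homogeneous elements span the quotient, so a basis can be chosen among them.
  let t : Set (H ⧸ W) := {q | ∃ n : ℤ, ∃ a ∈ 𝒜 n, W.mkQ a = q}
  have ht : Submodule.span K t = ⊤ := by
    rw [eq_top_iff, ← W.range_mkQ, ← Submodule.map_top, ← h.iSup_eq_top, Submodule.map_iSup]
    refine iSup_le fun n => ?_
    rintro _ ⟨a, ha, rfl⟩
    exact Submodule.subset_span ⟨n, a, ha, rfl⟩
  obtain ⟨b, hbt, hbs, hbi⟩ := exists_linearIndependent K t
  let basis : Module.Basis b K (H ⧸ W) := Module.Basis.mk hbi (by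
    rw [Subtype.range_coe, hbs, ht])
  choose deg x hxdeg hxq using fun i : b => hbt i.2
  have hbasis : ∀ i : b, basis i = (i : H ⧸ W) := fun i => Module.Basis.mk_apply _ _ i
  have hdeg : ∀ i, deg i ≠ 0 := by
    intro i hi
    have h1 := hxdeg i
    rw [hi] at h1
    have h2 : W.mkQ (x i) = 0 :=
      (Submodule.Quotient.mk_eq_zero W).2 (Submodule.mem_sup_left (h.zero_le h1))
    rw [hxq] at h2
    exact basis.ne_zero i (by rw [hbasis, h2])
  have hxI : ∀ i, x i ∈ augIdeal K H := fun i => h.counit_eq_zero (hdeg i) (hxdeg i)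
  refine ⟨b, x, fun i => basis.coord i ∘ₗ W.mkQ, hxI, fun i => ?_, fun i j => ?_, ?_⟩
  · refine isPointDerivation_of_vanish fun w hw => ?_
    rw [LinearMap.mem_ker, LinearMap.comp_apply, Submodule.mkQ_apply,
      (Submodule.Quotient.mk_eq_zero W).2 hw, map_zero]
  · rw [LinearMap.comp_apply, hxq, ← hbasis, Module.Basis.coord_apply, Module.Basis.repr_self]
  · set A := Subalgebra.toSubmodule (Algebra.adjoin K (Set.range x)) with hA
    obtain ⟨π, hπ⟩ := exists_projections h.isInternal
    -- Connectedness makes the augmentation ideal the sum of the components of positive degree.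
    have haug : ∀ a ∈ augIdeal K H, a ∈ ⨆ m : {m : ℤ // 0 < m}, 𝒜 m := by
      intro a ha
      have h1 : (⊤ : Submodule K H) ≤ (⨆ m : {m : ℤ // 0 < m}, 𝒜 m).comap (augProj K H) := by
        rw [← h.iSup_eq_top]
        refine iSup_le fun m y hy => ?_
        rw [Submodule.mem_comap, augProj_apply]
        rcases lt_trichotomy m 0 with hm | rfl | hm
        · rw [h.eq_bot_of_neg hm] at hy
          rw [(Submodule.mem_bot K).1 hy]; simp
        · obtain ⟨c, rfl⟩ := Submodule.mem_span_singleton.1 (h.zero_le hy)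
          simp [Algebra.algebraMap_eq_smul_one]
        · rw [h.counit_eq_zero hm.ne' hy, map_zero, sub_zero]
          exact Submodule.mem_iSup_of_mem (⟨m, hm⟩ : {m : ℤ // 0 < m}) hy
      have h2 := h1 (Submodule.mem_top (x := a))
      rwa [Submodule.mem_comap, augProj_apply, mem_augIdeal.1 ha, map_zero, sub_zero] at h2
    have hall : ∀ n : ℕ, ∀ f ∈ 𝒜 n, f ∈ A := by
      intro n
      induction n using Nat.strong_induction_on with
      | _ n ih =>
      intro f hf
      rcases Nat.eq_zero_or_pos n with rfl | hn
      · obtain ⟨c, rfl⟩ := Submodule.mem_span_singleton.1 (h.zero_le hf)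
        exact Submodule.smul_mem _ _ (Algebra.adjoin K (Set.range x)).one_mem
      have hsq : ∀ w ∈ augIdeal K H ^ 2, π n w ∈ A := by
        intro w hw
        rw [pow_two] at hw
        induction hw using Submodule.mul_induction_on' with
        | add a _ b _ ha hb => rw [map_add]; exact add_mem ha hb
        | mem_mul_mem a ha b hb =>
          have key : ∀ r : {m : ℤ // 0 < m}, ∀ y ∈ 𝒜 r, ∀ s : {m : ℤ // 0 < m}, ∀ z ∈ 𝒜 s,
              π n (y * z) ∈ A := by
            intro r y hy s z hz
            rw [hπ _ n _ (h.mul_mem hy hz)]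
            split_ifs with hrs
            · obtain ⟨r', hr'⟩ := Int.eq_ofNat_of_zero_le r.2.le
              obtain ⟨s', hs'⟩ := Int.eq_ofNat_of_zero_le s.2.le
              have hr0 := r.2
              have hs0 := s.2
              refine (Algebra.adjoin K (Set.range x)).mul_mem
                  (ih r' (by omega) y (by rwa [hr'] at hy))
                (ih s' (by omega) z (by rwa [hs'] at hz))
            · exact zero_mem _
          have k1 : ∀ r : {m : ℤ // 0 < m}, ∀ y ∈ 𝒜 r, π n (y * b) ∈ A := by
            intro r y hy
            have : (⨆ m : {m : ℤ // 0 < m}, 𝒜 m) ≤ A.comap (π n ∘ₗ LinearMap.mulLeft K y) :=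
              iSup_le fun s z hz => key r y hy s z hz
            exact this (haug b hb)
          have : (⨆ m : {m : ℤ // 0 < m}, 𝒜 m) ≤ A.comap (π n ∘ₗ LinearMap.mulRight K b) :=
            iSup_le fun r y hy => k1 r y hy
          exact this (haug a ha)
      have hspan : W.mkQ f ∈ Submodule.map W.mkQ (Submodule.span K (Set.range x)) := by
        rw [Submodule.map_span, ← Set.range_comp]
        have : (W.mkQ ∘ x) = ((↑) : b → H ⧸ W) := funext hxq
        rw [this, Subtype.range_coe, hbs, ht]
        trivial
      obtain ⟨y, hy, hyf⟩ := hspan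
      have hw : f - y ∈ W := by
        rw [← W.ker_mkQ, LinearMap.mem_ker, map_sub, hyf, sub_self]
      obtain ⟨c1, hc1, w, hw, e⟩ := Submodule.mem_sup.1 hw
      obtain ⟨c, rfl⟩ := Submodule.mem_span_singleton.1 hc1
      have hπf : π n f = f := by rw [hπ n n f hf, if_pos rfl]
      have hsplit : f = π n y + (c • π n 1 + π n w) := by
        rw [← map_smul, ← map_add, e, ← map_add, add_sub_cancel, hπf]
      rw [hsplit]
      refine add_mem ?_ (add_mem ?_ (hsq w hw))
      · have : Submodule.span K (Set.range x) ≤ A.comap (π n) := by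
          refine Submodule.span_le.2 ?_
          rintro _ ⟨i, rfl⟩
          rw [SetLike.mem_coe, Submodule.mem_comap, hπ _ n _ (hxdeg i)]
          split_ifs
          · exact Algebra.subset_adjoin ⟨i, rfl⟩
          · exact zero_mem _
        exact this hy
      -- The scalar part has no component in degree `n > 0`.
      · rw [hπ 0 n 1 h.one_mem, if_neg (by omega), smul_zero]
        exact zero_mem _
    have : A = ⊤ := by
      rw [eq_top_iff, ← h.iSup_eq_top]
      refine iSup_le fun n f hf => ?_
      rcases lt_or_ge n 0 with hn | hn
      · rw [h.eq_bot_of_neg hn] at hf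
        rw [(Submodule.mem_bot K).1 hf]; exact zero_mem _
      · obtain ⟨m, rfl⟩ := Int.eq_ofNat_of_zero_le hn
        exact hall m f hf
    exact Algebra.toSubmodule_eq_top.1 this

end Generators

/-! ### Primitive elements and finite dimension in characteristic zero. -/

section FiniteDimensional

variable {K : Type u} [Field K] {H : Type v} [Ring H] [Bialgebra K H]

theorem mem_primitives {x : H} : x ∈ primitives K H ↔
    Coalgebra.comul (R := K) x = x ⊗ₜ[K] 1 + 1 ⊗ₜ[K] x := Iff.rfl

theorem nontrivial_of_bialgebra (K : Type u) [Field K] (H : Type v) [Ring H] [Bialgebra K H] :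
    Nontrivial H :=
  (Bialgebra.counitAlgHom K H).toRingHom.domain_nontrivial

/-- Suppose `x^{k+1} = 0` with `k ≥ 1`. Multiplying `0 = Δ(x^{k+1}) = (x ⊗ 1 + 1 ⊗ x)^{k+1}` by
`x^{k-1} ⊗ 1` kills every binomial term except `(k+1) x^k ⊗ x^k`, so `x^k = 0` already. -/
theorem pow_ne_zero_of_mem_primitives [CharZero K] {x : H} (hx : x ∈ primitives K H)
    (h0 : x ≠ 0) (k : ℕ) : x ^ k ≠ 0 := by
  have := nontrivial_of_bialgebra K H
  induction k with
  | zero => rw [pow_zero]; exact one_ne_zero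
  | succ k ih =>
    intro hk
    rcases Nat.eq_zero_or_pos k with rfl | hpos
    · exact h0 (by simpa using hk)
    have hvan : ∀ m, k + 1 ≤ m → x ^ m = 0 := fun m hm => pow_eq_zero_of_le hm hk
    have hcomm : Commute (x ⊗ₜ[K] (1 : H)) ((1 : H) ⊗ₜ[K] x) := by simp [Commute, SemiconjBy]
    have h1 : (x ^ (k - 1)) ⊗ₜ[K] (1 : H) * Coalgebra.comul (R := K) (x ^ (k + 1)) = 0 := by
      rw [hk, map_zero, mul_zero]
    have hpow : Coalgebra.comul (R := K) (x ^ (k + 1)) =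
        (Coalgebra.comul (R := K) x) ^ (k + 1) := map_pow (Bialgebra.comulAlgHom K H) x (k + 1)
    rw [hpow, mem_primitives.1 hx, hcomm.add_pow, Finset.mul_sum, Finset.sum_eq_single 1] at h1
    · simp only [Algebra.TensorProduct.tmul_pow, one_pow, Algebra.TensorProduct.tmul_mul_tmul,
        one_mul, mul_one, pow_one, Nat.choose_one_right, Nat.add_sub_cancel] at h1
      rw [← mul_assoc, Algebra.TensorProduct.tmul_mul_tmul, one_mul, ← pow_succ, Nat.sub_add_cancel hpos,
          ← nsmul_eq_mul',
        ← Nat.cast_smul_eq_nsmul K, smul_eq_zero] at h1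
      rcases h1 with h1 | h1
      · exact absurd h1 (Nat.cast_ne_zero.2 (Nat.succ_ne_zero k))
      -- Applying `f ⊗ f` to `x^k ⊗ x^k = 0` gives `f(x^k)² = 0` for every linear form `f`.
      · refine ih ((Module.forall_dual_apply_eq_zero_iff K (x ^ k)).1 fun f => ?_)
        have := congrArg (LinearMap.mul' K K ∘ₗ TensorProduct.map f f) h1
        simpa using this
    · intro i _ hi
      rw [Algebra.TensorProduct.tmul_pow, Algebra.TensorProduct.tmul_pow, one_pow, one_pow,
        ← mul_assoc, ← mul_assoc, Algebra.TensorProduct.tmul_mul_tmul,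
        Algebra.TensorProduct.tmul_mul_tmul, ← pow_add, one_mul, mul_one]
      rcases Nat.eq_zero_or_pos i with rfl | hi'
      · rw [hvan (k + 1 - 0) (by omega), mul_zero, TensorProduct.tmul_zero, zero_mul]
      · rw [hvan (k - 1 + i) (by omega), TensorProduct.zero_tmul, zero_mul]
    · intro h
      exact absurd (Finset.mem_range.2 (by omega)) h

theorem IsConnectedGrading.pow_mem {𝒜 : ℤ → Submodule K H} (h : IsConnectedGrading 𝒜) {n : ℤ}
    {a : H} (ha : a ∈ 𝒜 n) (k : ℕ) : a ^ k ∈ 𝒜 (k * n) := by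
  induction k with
  | zero => simpa using h.one_mem
  | succ k ih =>
    rw [pow_succ, Nat.cast_succ, add_mul, one_mul]
    exact h.mul_mem ih ha

/-- Only the bidegrees `(n, 0)` and `(0, n)` are available, so `Δx = a ⊗ 1 + 1 ⊗ b`. The counit
axioms determine `a` and `b` up to scalars, and these cancel because `ε(x) = 0`. -/
theorem IsConnectedGrading.mem_primitives {𝒜 : ℤ → Submodule K H} (h : IsConnectedGrading 𝒜)
    {n : ℤ} (hn : 0 < n) (hbot : ∀ m, 0 < m → m < n → 𝒜 m = ⊥) {x : H} (hx : x ∈ 𝒜 n) :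
    x ∈ primitives K H := by
  have hle : tensorDegree 𝒜 n ≤ LinearMap.range ((TensorProduct.mk K H H).flip 1) ⊔
      LinearMap.range (TensorProduct.mk K H H 1) := by
    refine tensorDegree_le fun r s hrs a ha b hb => ?_
    have hz : ∀ m, m ≠ 0 → m < n → 𝒜 m = ⊥ := fun m hm hmn => by
      rcases lt_or_gt_of_ne hm with h' | h'
      · exact h.eq_bot_of_neg h'
      · exact hbot m h' hmn
    rcases eq_or_ne r 0 with rfl | hr
    · obtain ⟨c, rfl⟩ := Submodule.mem_span_singleton.1 (h.zero_le ha)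
      exact Submodule.mem_sup_right ⟨c • b, by simp [TensorProduct.smul_tmul]⟩
    · rcases eq_or_ne s 0 with rfl | hs
      · obtain ⟨c, rfl⟩ := Submodule.mem_span_singleton.1 (h.zero_le hb)
        exact Submodule.mem_sup_left ⟨c • a, by simp⟩
      · rcases lt_or_ge r n with hrn | hrn
        · rw [hz r hr hrn] at ha
          rw [(Submodule.mem_bot K).1 ha, TensorProduct.zero_tmul]
          exact zero_mem _
        · rw [hz s hs (by omega)] at hb
          rw [(Submodule.mem_bot K).1 hb, TensorProduct.tmul_zero]
          exact zero_mem _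
  obtain ⟨_, ⟨a, rfl⟩, _, ⟨b, rfl⟩, e⟩ := Submodule.mem_sup.1 (hle (h.comul_mem hx))
  simp only [LinearMap.flip_apply, TensorProduct.mk_apply] at e
  have hε := h.counit_eq_zero hn.ne' hx
  have e1 := congrArg (TensorProduct.rid K H ∘ Coalgebra.counit.lTensor H) e
  have e2 := congrArg (TensorProduct.lid K H ∘ Coalgebra.counit.rTensor H) e
  simp only [Function.comp_apply, Coalgebra.lTensor_counit_comul, Coalgebra.rTensor_counit_comul,
    map_add, LinearMap.lTensor_tmul, LinearMap.rTensor_tmul, TensorProduct.rid_tmul,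
    TensorProduct.lid_tmul, Bialgebra.counit_one, one_smul] at e1 e2
  rw [CrystalDuality.mem_primitives, ← e]
  have ha : a ⊗ₜ[K] (1 : H) = x ⊗ₜ[K] 1 - Coalgebra.counit (R := K) b • (1 ⊗ₜ[K] 1) := by
    rw [← e1, TensorProduct.add_tmul, TensorProduct.smul_tmul', add_sub_cancel_right]
  have hb : (1 : H) ⊗ₜ[K] b = 1 ⊗ₜ[K] x - Coalgebra.counit (R := K) a • (1 ⊗ₜ[K] 1) := by
    rw [← e2, TensorProduct.tmul_add, TensorProduct.tmul_smul, add_sub_cancel_left]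
  have hab : Coalgebra.counit (R := K) b + Coalgebra.counit (R := K) a = 0 := by
    have := congrArg (Coalgebra.counit (R := K)) e1
    rw [map_add, map_smul, Bialgebra.counit_one, hε, smul_eq_mul, mul_one] at this
    rwa [add_comm]
  rw [ha, hb, sub_add_sub_comm, ← add_smul, hab, zero_smul, sub_zero]

/-- In characteristic zero, a connected graded bialgebra with finitely many non-zero components
is trivial. -/
theorem IsConnectedGrading.bot_eq_top [CharZero K] {𝒜 : ℤ → Submodule K H}
    (h : IsConnectedGrading 𝒜) {N : ℕ} (hN : ∀ n : ℤ, N < n → 𝒜 n = ⊥) :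
    (⊥ : Subalgebra K H) = ⊤ := by
  have hbot : ∀ n : ℕ, 0 < n → 𝒜 n = ⊥ := by
    intro n
    induction n using Nat.strong_induction_on with
    | _ n ih =>
    intro hn
    rw [eq_bot_iff]
    intro x hx
    rw [Submodule.mem_bot]
    by_contra h0
    have hprim : x ∈ primitives K H := by
      refine h.mem_primitives (by exact_mod_cast hn) (fun m hm hmn => ?_) hx
      obtain ⟨m, rfl⟩ := Int.eq_ofNat_of_zero_le hm.le
      exact ih m (by exact_mod_cast hmn) (by exact_mod_cast hm)
    -- As `n ≥ 1`, this power has degree `(N + 1)n > N`, where the grading vanishes.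
    refine pow_ne_zero_of_mem_primitives hprim h0 (N + 1) ?_
    have := h.pow_mem hx (N + 1)
    rwa [hN _ (by push_cast; nlinarith), Submodule.mem_bot] at this
  rw [eq_comm, eq_bot_iff]
  intro a _
  have : (⊤ : Submodule K H) ≤ Subalgebra.toSubmodule ⊥ := by
    rw [← h.iSup_eq_top]
    refine iSup_le fun n y hy => ?_
    rcases lt_trichotomy n 0 with hn | rfl | hn
    · rw [h.eq_bot_of_neg hn] at hy
      rw [(Submodule.mem_bot K).1 hy]; exact zero_mem _
    · obtain ⟨c, rfl⟩ := Submodule.mem_span_singleton.1 (h.zero_le hy)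
      exact Submodule.smul_mem _ c (Subalgebra.one_mem ⊥)
    · obtain ⟨n, rfl⟩ := Int.eq_ofNat_of_zero_le hn.le
      rw [hbot n (by exact_mod_cast hn)] at hy
      rw [(Submodule.mem_bot K).1 hy]; exact zero_mem _
  exact this trivial

theorem AssocGraded.piece_eq_bot {F : ℤ → Submodule K H} {n : ℤ} (h : F n ≤ F (n - 1)) :
    AssocGraded.piece F n = ⊥ := by
  rw [eq_bot_iff]
  rintro _ ⟨x, rfl⟩
  exact (Submodule.mem_bot K).2 (AssocGraded.symbol_eq_zero x.2 (h x.2))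

theorem exists_piece_deltaFiltration_eq_bot [Module.Finite K H] :
    ∃ N : ℕ, ∀ n : ℤ, N < n → AssocGraded.piece (deltaFiltration K H) n = ⊥ := by
  obtain ⟨N, hN⟩ := monotone_stabilizes_iff_noetherian.2 (inferInstance : IsNoetherian K H)
    ⟨fun k : ℕ => deltaFiltration K H k, fun a b hab => deltaFiltration_monotone (by omega)⟩
  refine ⟨N, fun n hn => AssocGraded.piece_eq_bot ?_⟩
  obtain ⟨k, hk⟩ := Int.eq_ofNat_of_zero_le (show 0 ≤ n by omega)
  obtain ⟨l, hl⟩ := Int.eq_ofNat_of_zero_le (show 0 ≤ n - 1 by omega)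
  have h1 : deltaFiltration K H N = deltaFiltration K H k := hN k (by omega)
  have h2 : deltaFiltration K H N = deltaFiltration K H l := hN l (by omega)
  rw [hl, hk, ← h1, ← h2]

end FiniteDimensional

/-! ### Polynomial and truncated polynomial algebras. -/

section FunctionAlgebras

variable {K : Type u} [Field K] {H : Type v} [CommRing H] [Bialgebra K H]
  {𝒜 : ℤ → Submodule K H} (h : IsConnectedGrading 𝒜)

-- In characteristic zero all factorials are invertible, so every polynomial is reduced and
-- evaluation at the generators is injective.
include h in
theorem IsConnectedGrading.nonempty_algEquiv_mvPolynomial [CharZero K] :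
    ∃ I : Type v, Nonempty (H ≃ₐ[K] MvPolynomial I K) := by
  obtain ⟨I, x, d, hx, hd, hdx, htop⟩ := h.exists_generators
  refine ⟨I, ⟨(AlgEquiv.ofBijective (MvPolynomial.aeval x) ⟨?_, ?_⟩).symm⟩⟩
  · rw [injective_iff_map_eq_zero]
    intro f hf
    exact eq_zero_of_aeval_eq_zero hx hd hdx
      (fun a _ i => Nat.cast_ne_zero.2 (Nat.factorial_ne_zero _)) hf
  · rw [← AlgHom.range_eq_top, ← Algebra.adjoin_range_eq_range_aeval, htop]

theorem cast_factorial_ne_zero_of_lt (p : ℕ) [CharP K p] [Fact p.Prime] {n : ℕ} (hn : n < p) :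
    (n.factorial : K) ≠ 0 := by
  rw [Ne, CharP.cast_eq_zero_iff K p, (Fact.out : p.Prime).dvd_factorial]
  omega

-- Modulo the `X_i^p` a polynomial `f` is congruent to the sum `f'` of its monomials with all
-- exponents below `p`. This `f'` is reduced, so independence makes it zero when `f` lies in the
-- kernel of evaluation.
open MvPolynomial in
include h in
theorem IsConnectedGrading.nonempty_algEquiv_truncated (p : ℕ) [CharP K p] [Fact p.Prime]
    (hpow : ∀ f : H, Coalgebra.counit (R := K) f = 0 → f ^ p = 0) :
    ∃ I : Type v, Nonempty (H ≃ₐ[K] MvPolynomial I K ⧸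
      Ideal.span (Set.range fun i : I => (MvPolynomial.X i : MvPolynomial I K) ^ p)) := by
  classical
  obtain ⟨I, x, d, hx, hd, hdx, htop⟩ := h.exists_generators
  have hsurj : Function.Surjective (aeval x : MvPolynomial I K →ₐ[K] H) := by
    rw [← AlgHom.range_eq_top, ← Algebra.adjoin_range_eq_range_aeval, htop]
  set T := Ideal.span (Set.range fun i : I => (MvPolynomial.X i : MvPolynomial I K) ^ p) with hT
  have hTker : T ≤ RingHom.ker (aeval x : MvPolynomial I K →ₐ[K] H) := by
    refine Ideal.span_le.2 ?_
    rintro _ ⟨i, rfl⟩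
    rw [SetLike.mem_coe, RingHom.mem_ker, map_pow, aeval_X]
    exact hpow _ (hx i)
  have hker : RingHom.ker (aeval x : MvPolynomial I K →ₐ[K] H) = T := by
    refine le_antisymm (fun f hf => ?_) hTker
    set s := f.support.filter fun a => ∀ i, a i < p with hs
    set f' := ∑ a ∈ s, monomial a (coeff a f) with hf'
    have hdiff : f - f' ∈ T := by
      have : f - f' = ∑ a ∈ f.support.filter fun a => ¬ ∀ i, a i < p, monomial a (coeff a f) := by
        rw [hf', hs, sub_eq_iff_eq_add', Finset.sum_filter_add_sum_filter_not]
        exact f.as_sum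
      rw [this]
      refine Ideal.sum_mem _ fun a ha => ?_
      obtain ⟨i, hi⟩ := not_forall.1 (Finset.mem_filter.1 ha).2
      have e : a = Finsupp.single i p + (a - Finsupp.single i p) :=
        (add_tsub_cancel_of_le (Finsupp.single_le_iff.2 (not_lt.1 hi))).symm
      have e2 : monomial a (coeff a f) =
          X i ^ p * monomial (a - Finsupp.single i p) (coeff a f) := by
        rw [X_pow_eq_monomial, monomial_mul, one_mul, ← e]
      rw [e2]
      exact Ideal.mul_mem_right _ _ (Ideal.subset_span ⟨i, rfl⟩)
    have h0 : f' = 0 := by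
      refine eq_zero_of_aeval_eq_zero hx hd hdx (fun a ha i => ?_) ?_
      · have : a ∈ s := by
          by_contra has
          apply ha
          rw [hf', coeff_sum]
          refine Finset.sum_eq_zero fun b hb => ?_
          rw [coeff_monomial, if_neg]
          rintro rfl
          exact has hb
        exact cast_factorial_ne_zero_of_lt p ((Finset.mem_filter.1 this).2 i)
      · have h1 := hTker hdiff
        rw [RingHom.mem_ker] at h1 hf
        rwa [map_sub, hf, zero_sub, neg_eq_zero] at h1
    rwa [h0, sub_zero] at hdiff
  exact ⟨I, ⟨((Ideal.quotientEquivAlgOfEq K hker).symm.trans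
    (Ideal.quotientKerAlgEquivOfSurjective hsurj)).symm⟩⟩

-- The `p`-th power map is additive in a commutative algebra of characteristic `p`, so homogeneous
-- elements of positive degree suffice.
include h in
theorem IsConnectedGrading.pow_char_eq_zero (p : ℕ) [CharP K p] [Fact p.Prime]
    (hpow : ∀ n > 0, ∀ a ∈ 𝒜 n, a ^ p = 0) {f : H} (hf : Coalgebra.counit (R := K) f = 0) :
    f ^ p = 0 := by
  have := nontrivial_of_bialgebra K H
  have : CharP H p := charP_of_injective_algebraMap (algebraMap K H).injective p
  have key : ∀ a : H, (augProj K H a) ^ p = 0 := by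
    intro a
    have ha : a ∈ ⨆ n, 𝒜 n := by rw [h.iSup_eq_top]; trivial
    induction ha using Submodule.iSup_induction' with
    | zero => rw [map_zero, zero_pow (Fact.out : p.Prime).ne_zero]
    | add a b _ _ ha hb => rw [map_add, add_pow_char, ha, hb, add_zero]
    | mem n a ha =>
      rw [augProj_apply]
      rcases lt_trichotomy n 0 with hn | rfl | hn
      · rw [h.eq_bot_of_neg hn] at ha
        rw [(Submodule.mem_bot K).1 ha]
        simp [(Fact.out : p.Prime).ne_zero]
      · obtain ⟨c, rfl⟩ := Submodule.mem_span_singleton.1 (h.zero_le ha)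
        simp [Algebra.algebraMap_eq_smul_one, (Fact.out : p.Prime).ne_zero]
      · rw [h.counit_eq_zero hn.ne' ha, map_zero, sub_zero]
        exact hpow n hn a ha
  simpa [augProj_apply, hf] using key f

/-- The maximal ideal `ker ε` consists of nilpotent elements, so it is contained in, and hence equal
to, every prime ideal. -/
theorem ringKrullDim_eq_zero_of_pow_eq_zero {p : ℕ}
    (hpow : ∀ f : H, Coalgebra.counit (R := K) f = 0 → f ^ p = 0) : ringKrullDim H = 0 := by
  have := nontrivial_of_bialgebra K H
  refine le_antisymm ?_ ringKrullDim_nonneg_of_nontrivial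
  have hmax : (RingHom.ker (Bialgebra.counitAlgHom K H)).IsMaximal :=
    RingHom.ker_isMaximal_of_surjective _ fun c => ⟨algebraMap K H c, by simp⟩
  have : Ring.KrullDimLE 0 H := Ring.KrullDimLE.mk₀ fun I hI => by
    have hle : RingHom.ker (Bialgebra.counitAlgHom K H) ≤ I := fun f hf =>
      hI.mem_of_pow_mem p (by rw [hpow f hf]; exact zero_mem _)
    rwa [← hmax.eq_of_le hI.ne_top hle]
  exact_mod_cast Ring.krullDimLE_iff.1 this

/-- The counit sends `e` to `0` or `1`. Accordingly `e` or `1 - e` is an idempotent whose `p`-th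
power vanishes, and it is therefore zero. -/
theorem eq_zero_or_eq_one_of_pow_eq_zero {p : ℕ} (hp : p ≠ 0)
    (hpow : ∀ f : H, Coalgebra.counit (R := K) f = 0 → f ^ p = 0) {e : H} (he : e * e = e) :
    e = 0 ∨ e = 1 := by
  have hid : ∀ f : H, f * f = f → f ^ p = 0 → f = 0 := fun f hf h0 => by
    rwa [(show IsIdempotentElem f from hf).pow_eq hp] at h0
  have hc : Coalgebra.counit (R := K) e * Coalgebra.counit (R := K) e =
      Coalgebra.counit (R := K) e := by rw [← Bialgebra.counit_mul, he]
  rcases IsIdempotentElem.iff_eq_zero_or_one.1 hc with h0 | h1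
  · exact Or.inl (hid e he (hpow e h0))
  · refine Or.inr (sub_eq_zero.1 (hid (1 - e) ?_ (hpow _ ?_))).symm
    · linear_combination he
    · rw [map_sub, Bialgebra.counit_one, h1, sub_self]

end FunctionAlgebras

/-! ### The Poisson group of a connected graded Poisson Hopf algebra. -/

section PoissonGroups

variable {K : Type u} [Field K] {H : Type v} [Ring H] [Bialgebra K H]

theorem IsConnectedGrading.exists_poissonGroup {𝒜 : ℤ → Submodule K H}
    (h : IsConnectedGrading 𝒜) (p : ℕ) [CharP K p] {S : H →ₗ[K] H} (hS : IsAntipode S)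
    {br : H →ₗ[K] H →ₗ[K] H} (hbr : IsPoissonHopf S br)
    (hpow : 0 < p → ∀ n > 0, ∀ a ∈ 𝒜 n, a ^ p = 0) :
    ∃ (G : PoissonGroup.{u, v} K) (φ : H ≃ₐc[K] G.functionAlgebra),
      (∀ a b, φ (br a b) = G.bracket (φ a) (φ b)) ∧
      G.IsConnected ∧
      (p = 0 → G.IsAffineSpace) ∧
      ((⊥ : Subalgebra K H) = ⊤ → G.IsTrivial) ∧
      (0 < p → G.dim = 0 ∧ G.HasHeightOne p) ∧
      (0 < p → G.IsTruncatedPolynomial p) := by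
  let _ : CommRing H := { (inferInstance : Ring H) with mul_comm := hbr.mul_comm }
  have hp0 : p ≠ 0 → Fact p.Prime := fun hp =>
    ⟨(CharP.char_is_prime_or_zero K p).resolve_right hp⟩
  have haff : p = 0 → ∃ I : Type v, Nonempty (H ≃ₐ[K] MvPolynomial I K) := fun hp => by
    subst hp
    have := CharP.charP_to_charZero K
    exact h.nonempty_algEquiv_mvPolynomial
  have hht : 0 < p → ∀ f : H, Coalgebra.counit (R := K) f = 0 → f ^ p = 0 := fun hp f hf => by
    have := hp0 hp.ne'
    exact h.pow_char_eq_zero p (hpow hp) hf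
  let _ : HopfAlgebra K H := hS.hopfAlgebra
  refine ⟨{ functionAlgebra := H, bracket := br, isPoissonHopf := hbr }, BialgEquiv.refl K H,
    fun _ _ => rfl, fun e he => ?_, haff, fun hb => ?_, fun hp => ?_, fun hp => ?_⟩
  · rcases Nat.eq_zero_or_pos p with hp | hp
    -- A polynomial ring over a field is a domain, so its only idempotents are `0` and `1`.
    · obtain ⟨I, ⟨f⟩⟩ := haff hp
      have : f e * f e = f e := by rw [← map_mul]; exact congrArg f he
      rcases IsIdempotentElem.iff_eq_zero_or_one.1 this with h0 | h1
      · exact Or.inl (f.injective (h0.trans (map_zero f).symm))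
      · exact Or.inr (f.injective (h1.trans (map_one f).symm))
    · exact eq_zero_or_eq_one_of_pow_eq_zero hp.ne' (hht hp) he
  · have := nontrivial_of_bialgebra K H
    exact Algebra.bijective_algebraMap_iff.2 hb.symm
  · exact ⟨ringKrullDim_eq_zero_of_pow_eq_zero (hht hp), hht hp⟩
  · have := hp0 hp.ne'
    exact h.nonempty_algEquiv_truncated p (hht hp)

theorem AssocGraded.symbol_pow {F : ℤ → Submodule K H} [IsBialgebraFiltration F] {n : ℤ}
    (x : F n) (k : ℕ) : ∃ hx : (x : H) ^ k ∈ F (k * n),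
      AssocGraded.symbol F n x ^ k = AssocGraded.symbol F (k * n) ⟨(x : H) ^ k, hx⟩ := by
  induction k with
  | zero =>
    have : (x : H) ^ 0 ∈ F ((0 : ℕ) * n) := by
      simpa using IsBialgebraFiltration.one_mem (F := F)
    refine ⟨this, ?_⟩
    rw [pow_zero, AssocGraded.one_def]
    exact AssocGraded.symbol_congr (by simp) _ _ (pow_zero _).symm
  | succ k ih =>
    obtain ⟨hx, e⟩ := ih
    have h1 : ((k + 1 : ℕ) : ℤ) * n = k * n + n := by push_cast; ring
    have h2 : (x : H) ^ (k + 1) ∈ F ((k + 1 : ℕ) * n) := by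
      rw [pow_succ, h1]; exact IsBialgebraFiltration.mul_mem hx x.2
    refine ⟨h2, ?_⟩
    rw [pow_succ, e, AssocGraded.symbol_mul_symbol]
    exact AssocGraded.symbol_congr h1.symm _ _ (pow_succ _ _).symm

theorem pow_char_eq_zero_of_mem_piece_deltaFiltration (p : ℕ) [CharP K p] [Fact p.Prime] {n : ℤ}
    (hn : 0 < n) {a : AssocGraded (deltaFiltration K H)}
    (ha : a ∈ AssocGraded.piece (deltaFiltration K H) n) : a ^ p = 0 := by
  obtain ⟨x, rfl⟩ := ha
  obtain ⟨hx, e⟩ := AssocGraded.symbol_pow x p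
  rw [e]
  exact AssocGraded.symbol_eq_zero _ (pow_char_mem_deltaFiltration p hn x.2)

end PoissonGroups

/-! ### Assembly for the δ_•-filtration. -/

section DeltaFiltration

variable {K : Type u} [Field K] (p : ℕ) [CharP K p] (B : Type v) [Ring B] [Bialgebra K B]

theorem deltaFiltration_graded :
    ∃ (S : AssocGraded (deltaFiltration K B) →ₗ[K] AssocGraded (deltaFiltration K B))
      (br : AssocGraded (deltaFiltration K B) →ₗ[K]
        AssocGraded (deltaFiltration K B) →ₗ[K] AssocGraded (deltaFiltration K B)),
      IsAntipode S ∧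
      IsGradedHopf S (AssocGraded.piece (deltaFiltration K B)) ∧
      IsInducedBracket (deltaFiltration K B) br ∧
      IsPoissonHopf S br ∧
      (∀ (m n : ℤ), ∀ a ∈ AssocGraded.piece (deltaFiltration K B) m,
        ∀ b ∈ AssocGraded.piece (deltaFiltration K B) n,
          br a b ∈ AssocGraded.piece (deltaFiltration K B) (m + n - 1)) ∧
      ∃ (G : PoissonGroup.{u, v} K)
        (φ : AssocGraded (deltaFiltration K B) ≃ₐc[K] G.functionAlgebra),
        (∀ a b, φ (br a b) = G.bracket (φ a) (φ b)) ∧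
        G.IsConnected ∧
        (p = 0 → G.IsAffineSpace) ∧
        (p = 0 → Module.Finite K B →
          (⊥ : Subalgebra K (AssocGraded (deltaFiltration K B))) = ⊤ ∧ G.IsTrivial) ∧
        (0 < p → G.dim = 0 ∧ G.HasHeightOne p) ∧
        (0 < p → G.IsTruncatedPolynomial p) := by
  have hF : ∀ {m n : ℤ} {x y : B}, x ∈ deltaFiltration K B m → y ∈ deltaFiltration K B n →
      x * y - y * x ∈ deltaFiltration K B (m + n - 1) := commutator_mem_deltaFiltration
  have hconn := isConnectedGrading_deltaFiltration (K := K) (B := B)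
  obtain ⟨S, hS, hgr⟩ := hconn.exists_isGradedHopf
  have hP := AssocGraded.isPoissonHopf_bracketHom hF hS
  obtain ⟨G, φ, h1, h2, h3, h4, h5, h6⟩ := hconn.exists_poissonGroup p hS hP (fun hp n hn a ha => by
    have : Fact p.Prime := ⟨(CharP.char_is_prime_or_zero K p).resolve_right hp.ne'⟩
    exact pow_char_eq_zero_of_mem_piece_deltaFiltration p hn ha)
  refine ⟨S, AssocGraded.bracketHom hF, hS, hgr, AssocGraded.isInducedBracket_bracketHom hF, hP,
    fun m n a ha b hb => AssocGraded.bracketHom_mem_piece hF ha hb, G, φ, h1, h2, h3,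
    fun hp _ => ?_, h5, h6⟩
  subst hp
  have := CharP.charP_to_charZero K
  obtain ⟨N, hN⟩ := exists_piece_deltaFiltration_eq_bot (K := K) (H := B)
  have hb := hconn.bot_eq_top hN
  exact ⟨hb, h4 hb⟩

end DeltaFiltration

/-! ### The map `Δ - Δᵒᵖ` on a coalgebra. -/

section Cocommutator

variable {K : Type u} [Field K]

/-- Grouping the diagonal terms and the symmetric pairs of off-diagonal terms is what later proves
alternation in every characteristic, including `2`. -/
theorem sum_sum_mem {M : Type w} [AddCommGroup M] [Module K M] (A : Submodule K M) {κ : Type*}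
    (f : κ → κ → M) (hd : ∀ a, f a a ∈ A) (ho : ∀ a b, f a b + f b a ∈ A) (R : Finset κ) :
    ∑ r ∈ R, ∑ s ∈ R, f r s ∈ A := by
  classical
  induction R using Finset.induction_on with
  | empty => simp
  | insert a R ha ih =>
    have e : ∑ r ∈ insert a R, ∑ s ∈ insert a R, f r s =
        f a a + (∑ s ∈ R, (f a s + f s a) + ∑ r ∈ R, ∑ s ∈ R, f r s) := by
      simp only [Finset.sum_insert ha, Finset.sum_add_distrib]
      abel
    rw [e]
    exact add_mem (hd a) (add_mem (sum_mem fun s _ => ho a s) ih)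

section Perm

variable (K) (V : Type v) [AddCommGroup V] [Module K V]

/-- The cyclic permutation `a ⊗ (b ⊗ c) ↦ b ⊗ (c ⊗ a)`. -/
def rotate : V ⊗[K] (V ⊗[K] V) →ₗ[K] V ⊗[K] (V ⊗[K] V) :=
  (TensorProduct.assoc K V V V).toLinearMap ∘ₗ (TensorProduct.comm K V (V ⊗[K] V)).toLinearMap

variable {K V}

theorem assoc_cyclicPerm (t : (V ⊗[K] V) ⊗[K] V) :
    TensorProduct.assoc K V V V (cyclicPerm K V t) = rotate K V (TensorProduct.assoc K V V V t) :=
  rfl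

theorem rotate_rotate_rotate (t : V ⊗[K] (V ⊗[K] V)) :
    rotate K V (rotate K V (rotate K V t)) = t := by
  have : rotate K V ∘ₗ rotate K V ∘ₗ rotate K V = LinearMap.id := by
    ext a b c; rfl
  exact LinearMap.congr_fun this t

theorem leftComm_rotate (t : V ⊗[K] (V ⊗[K] V)) :
    TensorProduct.leftComm K V V V (rotate K V t) =
      rotate K V (rotate K V (TensorProduct.leftComm K V V V t)) := by
  have : (TensorProduct.leftComm K V V V).toLinearMap ∘ₗ rotate K V =
      rotate K V ∘ₗ rotate K V ∘ₗ (TensorProduct.leftComm K V V V).toLinearMap := by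
    ext a b c; rfl
  exact LinearMap.congr_fun this t

theorem leftComm_lTensor_comm (t : V ⊗[K] (V ⊗[K] V)) :
    TensorProduct.leftComm K V V V ((TensorProduct.comm K V V).toLinearMap.lTensor V t) =
      rotate K V (rotate K V t) := by
  have : (TensorProduct.leftComm K V V V).toLinearMap ∘ₗ
      (TensorProduct.comm K V V).toLinearMap.lTensor V = rotate K V ∘ₗ rotate K V := by
    ext a b c; rfl
  exact LinearMap.congr_fun this t

theorem assoc_rTensor_comm (t : (V ⊗[K] V) ⊗[K] V) :
    TensorProduct.assoc K V V V ((TensorProduct.comm K V V).toLinearMap.rTensor V t) =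
      TensorProduct.leftComm K V V V (TensorProduct.assoc K V V V t) := by
  have : (TensorProduct.assoc K V V V).toLinearMap ∘ₗ
      (TensorProduct.comm K V V).toLinearMap.rTensor V =
      (TensorProduct.leftComm K V V V).toLinearMap ∘ₗ (TensorProduct.assoc K V V V).toLinearMap :=
    TensorProduct.ext_threefold fun a b c => rfl
  exact LinearMap.congr_fun this t

theorem assoc_rTensor_comm_apply (f : V →ₗ[K] V ⊗[K] V) (t : V ⊗[K] V) :
    TensorProduct.assoc K V V V (f.rTensor V (TensorProduct.comm K V V t)) =
      rotate K V (f.lTensor V t) := by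
  have : (TensorProduct.assoc K V V V).toLinearMap ∘ₗ f.rTensor V ∘ₗ
      (TensorProduct.comm K V V).toLinearMap = rotate K V ∘ₗ f.lTensor V := by
    ext a b; rfl
  exact LinearMap.congr_fun this t

theorem lTensor_comm_apply (f : V →ₗ[K] V ⊗[K] V) (t : V ⊗[K] V) :
    f.lTensor V (TensorProduct.comm K V V t) =
      rotate K V (rotate K V (TensorProduct.assoc K V V V (f.rTensor V t))) := by
  have : f.lTensor V ∘ₗ (TensorProduct.comm K V V).toLinearMap =
      rotate K V ∘ₗ rotate K V ∘ₗ (TensorProduct.assoc K V V V).toLinearMap ∘ₗ f.rTensor V := by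
    refine TensorProduct.ext' fun a b => ?_
    simp only [LinearMap.comp_apply, LinearEquiv.coe_coe, TensorProduct.comm_tmul,
      LinearMap.lTensor_tmul, LinearMap.rTensor_tmul]
    induction f a using TensorProduct.induction_on with
    | zero => simp
    | add s s' h h' => simp only [TensorProduct.tmul_add, TensorProduct.add_tmul, map_add, h, h']
    | tmul x y => rfl
  exact LinearMap.congr_fun this t

end Perm

variable (K) (C : Type v) [AddCommGroup C] [Module K C] [Coalgebra K C]

/-- The map `Δ - Δᵒᵖ`. -/
def cocommutator : C →ₗ[K] C ⊗[K] C :=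
  Coalgebra.comul - (TensorProduct.comm K C C).toLinearMap ∘ₗ Coalgebra.comul

variable {K C}

theorem cocommutator_apply (x : C) : cocommutator K C x =
    Coalgebra.comul (R := K) x - TensorProduct.comm K C C (Coalgebra.comul x) := rfl

theorem comm_cocommutator (x : C) :
    TensorProduct.comm K C C (cocommutator K C x) = -cocommutator K C x := by
  rw [cocommutator_apply, map_sub, neg_sub, ← LinearEquiv.trans_apply]
  simp

theorem assoc_rTensor_cocommutator (t : C ⊗[K] C) :
    TensorProduct.assoc K C C C ((cocommutator K C).rTensor C t) =
      TensorProduct.assoc K C C C (Coalgebra.comul.rTensor C t) -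
      TensorProduct.leftComm K C C C
        (TensorProduct.assoc K C C C (Coalgebra.comul.rTensor C t)) := by
  rw [cocommutator, LinearMap.rTensor_sub, LinearMap.sub_apply, LinearMap.rTensor_comp,
    LinearMap.comp_apply, map_sub, assoc_rTensor_comm]

/-- By coassociativity every term is a permutation of `(id ⊗ Δ)Δx`, and the signed sum cancels; this
is dual to the Jacobi identity for commutators. -/
theorem cocommutator_coJacobi (x : C) :
    TensorProduct.assoc K C C C ((cocommutator K C).rTensor C (cocommutator K C x)) +
      rotate K C (TensorProduct.assoc K C C C
        ((cocommutator K C).rTensor C (cocommutator K C x))) +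
      rotate K C (rotate K C (TensorProduct.assoc K C C C
        ((cocommutator K C).rTensor C (cocommutator K C x)))) = 0 := by
  have h1 : TensorProduct.assoc K C C C (Coalgebra.comul.rTensor C (cocommutator K C x)) =
      Coalgebra.comul.lTensor C (Coalgebra.comul x) -
        rotate K C (Coalgebra.comul.lTensor C (Coalgebra.comul x)) := by
    rw [cocommutator_apply, map_sub, map_sub, Coalgebra.coassoc_apply, assoc_rTensor_comm_apply]
  rw [assoc_rTensor_cocommutator, h1]
  simp only [map_sub, leftComm_rotate, rotate_rotate_rotate]
  abel

theorem cocommutator_coLeibniz (x : C) :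
    Coalgebra.comul.lTensor C (cocommutator K C x) =
      TensorProduct.assoc K C C C ((cocommutator K C).rTensor C (Coalgebra.comul x)) +
      TensorProduct.leftComm K C C C ((cocommutator K C).lTensor C (Coalgebra.comul x)) := by
  rw [assoc_rTensor_cocommutator, cocommutator_apply, map_sub, lTensor_comm_apply,
    Coalgebra.coassoc_apply, cocommutator, LinearMap.lTensor_sub, LinearMap.sub_apply,
    LinearMap.lTensor_comp, LinearMap.comp_apply, map_sub, leftComm_lTensor_comm]
  abel

/-- The opposite coproduct in the second term becomes `Δ` on an associated graded bialgebra that is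
cocommutative, which yields the co-Poisson product rule. -/
theorem cocommutator_mul {A : Type v} [Ring A] [Bialgebra K A] (x y : A) :
    cocommutator K A (x * y) = cocommutator K A x * Coalgebra.comul (R := K) y +
      TensorProduct.comm K A A (Coalgebra.comul x) * cocommutator K A y := by
  have h : ∀ s t : A ⊗[K] A, TensorProduct.comm K A A (s * t) =
      TensorProduct.comm K A A s * TensorProduct.comm K A A t :=
    fun s t => map_mul (Algebra.TensorProduct.comm K A A) s t
  rw [cocommutator_apply, cocommutator_apply, cocommutator_apply, Bialgebra.comul_mul, h]
  noncomm_ring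

end Cocommutator

/-! ### Co-Poisson structures and primitive elements. -/

section CoPoisson

variable {K : Type u} [Field K] {H : Type v} [Ring H] [Bialgebra K H]

theorem IsLieCobracket.comm_apply {V : Type v} [AddCommGroup V] [Module K V]
    {δ : V →ₗ[K] V ⊗[K] V} (h : IsLieCobracket δ) (x : V) :
    TensorProduct.comm K V V (δ x) = -δ x := by
  obtain ⟨t, ht⟩ := h.alternating ⟨x, rfl⟩
  rw [← ht, LinearMap.sub_apply, map_sub, LinearMap.id_apply, LinearEquiv.coe_coe,
    ← LinearEquiv.trans_apply]
  simp

theorem IsLieCobracket.map_apply_eq_zero {V : Type v} [AddCommGroup V] [Module K V]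
    {δ : V →ₗ[K] V ⊗[K] V} (h : IsLieCobracket δ) (f : V →ₗ[K] K) (x : V) :
    TensorProduct.map f f (δ x) = 0 := by
  obtain ⟨t, ht⟩ := h.alternating ⟨x, rfl⟩
  rw [← ht, LinearMap.sub_apply, map_sub, LinearMap.id_apply, LinearEquiv.coe_coe, sub_eq_zero]
  have : TensorProduct.map f f =
      TensorProduct.map f f ∘ₗ (TensorProduct.comm K V V).toLinearMap := by
    refine TensorProduct.ext' fun a b => ?_
    apply (TensorProduct.lid K K).injective
    simp [mul_comm]
  exact LinearMap.congr_fun this t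

variable (K H) in
/-- The space of primitive elements. -/
def primitiveSubmodule : Submodule K H :=
  LinearMap.ker (comulSubTmulOne K H - TensorProduct.mk K H H 1)

theorem mem_primitiveSubmodule {x : H} : x ∈ primitiveSubmodule K H ↔ x ∈ primitives K H := by
  rw [primitiveSubmodule, LinearMap.mem_ker, LinearMap.sub_apply, comulSubTmulOne_apply,
    mem_primitives, TensorProduct.mk_apply, sub_sub, sub_eq_zero]

variable {δ : H →ₗ[K] H ⊗[K] H}
  (hmul : ∀ a b, δ (a * b) = δ a * Coalgebra.comul (R := K) b + Coalgebra.comul (R := K) a * δ b)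

include hmul in
theorem cobracket_one : δ 1 = 0 := by
  simpa using hmul 1 1

-- At a primitive `a` the co-Leibniz rule, with `δ(1) = 0`, says that `id ⊗ Δ` sends `δ(a) = ∑ x ⊗
-- y` to `∑ x ⊗ (y ⊗ 1 + 1 ⊗ y)`. So `δ(a)` lies in `H ⊗ P`, by antisymmetry also in `P ⊗ H`, and
-- hence in `P ⊗ P`.
include hmul in
theorem cobracket_mem_primitives (hLie : IsLieCobracket δ)
    (hcoL : ∀ a, Coalgebra.comul.lTensor H (δ a) =
      TensorProduct.assoc K H H H (δ.rTensor H (Coalgebra.comul a)) +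
        TensorProduct.leftComm K H H H (δ.lTensor H (Coalgebra.comul a)))
    {a : H} (ha : a ∈ primitives K H) :
    δ a ∈ tensorSub (primitiveSubmodule K H) (primitiveSubmodule K H) := by
  have h1 : δ a ∈ tensorSub ⊤ (primitiveSubmodule K H) := by
    rw [primitiveSubmodule, ← lTensor_apply_eq_zero_iff]
    have h2 := hcoL a
    rw [mem_primitives.1 ha] at h2
    simp only [map_add, LinearMap.rTensor_tmul, LinearMap.lTensor_tmul, cobracket_one hmul,
      TensorProduct.zero_tmul, TensorProduct.tmul_zero, add_zero, zero_add] at h2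
    have h3 : ∀ t : H ⊗[K] H, ((TensorProduct.mk K H H).flip 1).lTensor H t =
        TensorProduct.assoc K H H H (t ⊗ₜ[K] 1) := fun t => by
      induction t using TensorProduct.induction_on with
      | zero => simp
      | add s s' h h' => simp only [TensorProduct.add_tmul, map_add, h, h']
      | tmul x y => rfl
    have h4 : ∀ t : H ⊗[K] H, (TensorProduct.mk K H H 1).lTensor H t =
        TensorProduct.leftComm K H H H (1 ⊗ₜ[K] t) := fun t => by
      induction t using TensorProduct.induction_on with
      | zero => simp
      | add s s' h h' => simp only [TensorProduct.tmul_add, map_add, h, h']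
      | tmul x y => rfl
    rw [comulSubTmulOne, LinearMap.lTensor_sub, LinearMap.lTensor_sub, LinearMap.sub_apply,
      LinearMap.sub_apply, h2, h3, h4]
    abel
  refine mem_tensorSub_of_mem_of_mem ?_ h1
  have h5 : tensorSub ⊤ (primitiveSubmodule K H) ≤
      (tensorSub (primitiveSubmodule K H) ⊤).comap (TensorProduct.comm K H H).toLinearMap :=
    tensorSub_le fun x _ y hy => tmul_mem_tensorSub hy trivial
  have h6 : TensorProduct.comm K H H (δ a) ∈ tensorSub (primitiveSubmodule K H) ⊤ := h5 h1
  rw [hLie.comm_apply] at h6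
  simpa using neg_mem h6

theorem IsAntipode.apply_one {S : H →ₗ[K] H} (hS : IsAntipode S) : S 1 = 1 := by
  let : HopfAlgebra K H := hS.hopfAlgebra
  exact HopfAlgebra.antipode_one

theorem IsAntipode.apply_mul {S : H →ₗ[K] H} (hS : IsAntipode S) (a b : H) :
    S (a * b) = S b * S a := by
  let : HopfAlgebra K H := hS.hopfAlgebra
  exact HopfAlgebra.antipode_mul_antidistrib a b

theorem counit_of_mem_primitives {x : H} (hx : x ∈ primitives K H) :
    Coalgebra.counit (R := K) x = 0 := by
  have h := congrArg (TensorProduct.lid K H ∘ Coalgebra.counit.rTensor H) (mem_primitives.1 hx)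
  simp only [Function.comp_apply, Coalgebra.rTensor_counit_comul, map_add, LinearMap.rTensor_tmul,
    TensorProduct.lid_tmul, Bialgebra.counit_one, one_smul, right_eq_add] at h
  simpa using congrArg (Coalgebra.counit (R := K)) h

theorem IsAntipode.apply_primitive {S : H →ₗ[K] H} (hS : IsAntipode S) {x : H}
    (hx : x ∈ primitives K H) : S x = -x := by
  have h := LinearMap.congr_fun hS.left x
  simp only [LinearMap.comp_apply, mem_primitives.1 hx, map_add, LinearMap.rTensor_tmul,
    LinearMap.mul'_apply, mul_one, hS.apply_one, one_mul, counit_of_mem_primitives hx,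
    map_zero] at h
  exact eq_neg_of_add_eq_zero_left h

theorem map_antipode_mul {S : H →ₗ[K] H} (hS : IsAntipode S) (s t : H ⊗[K] H) :
    TensorProduct.map S S (s * t) = TensorProduct.map S S t * TensorProduct.map S S s := by
  induction s using TensorProduct.induction_on with
  | zero => simp
  | add s s' h h' => simp only [add_mul, mul_add, map_add, h, h']
  | tmul a b =>
    induction t using TensorProduct.induction_on with
    | zero => simp
    | add s s' h h' => simp only [add_mul, mul_add, map_add, h, h']
    | tmul a' b' => simp [hS.apply_mul]

-- Only the antipode condition needs proof, and it can be checked on generators. On primitive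
-- elements `S = -id`, so `S ⊗ S` is the identity on `P ⊗ P`, which contains the cobracket. The
-- analogous statement for `Δ` is carried through the same induction, because the cobracket of a
-- product involves `Δ`.
include hmul in
theorem isCoPoissonHopf_of_primitives {S : H →ₗ[K] H} (hS : IsAntipode S)
    (hcocomm : Coalgebra.IsCocomm K H) (hLie : IsLieCobracket δ)
    (hcoL : ∀ a, Coalgebra.comul.lTensor H (δ a) =
      TensorProduct.assoc K H H H (δ.rTensor H (Coalgebra.comul a)) +
        TensorProduct.leftComm K H H H (δ.lTensor H (Coalgebra.comul a)))
    (hgen : Algebra.adjoin K (primitives K H) = ⊤) : IsCoPoissonHopf S δ where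
  cocomm := hcocomm
  isLieCobracket := hLie
  coLeibniz := hcoL
  cobracket_mul := hmul
  counit_cobracket := hLie.map_apply_eq_zero _
  antipode_cobracket := by
    have hcm : ∀ s t : H ⊗[K] H, TensorProduct.comm K H H (s * t) =
        TensorProduct.comm K H H s * TensorProduct.comm K H H t :=
      fun s t => map_mul (Algebra.TensorProduct.comm K H H) s t
    suffices h : ∀ a, Coalgebra.comul (R := K) (S a) =
        TensorProduct.comm K H H (TensorProduct.map S S (Coalgebra.comul a)) ∧
        δ (S a) = TensorProduct.comm K H H (TensorProduct.map S S (δ a)) from fun a => (h a).2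
    intro a
    have ha : a ∈ Algebra.adjoin K (primitives K H) := by rw [hgen]; trivial
    induction ha using Algebra.adjoin_induction with
    | mem x hx =>
      constructor
      · rw [hS.apply_primitive hx, map_neg, mem_primitives.1 hx]
        simp [hS.apply_primitive hx, hS.apply_one, TensorProduct.neg_tmul, TensorProduct.tmul_neg,
          add_comm]
      · have h1 : ∀ t ∈ tensorSub (primitiveSubmodule K H) (primitiveSubmodule K H),
            TensorProduct.map S S t = t := fun t ht => by
          have : tensorSub (primitiveSubmodule K H) (primitiveSubmodule K H) ≤
              LinearMap.ker (TensorProduct.map S S - LinearMap.id) :=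
            tensorSub_le fun x hx y hy => by
              simp [hS.apply_primitive (mem_primitiveSubmodule.1 hx),
                hS.apply_primitive (mem_primitiveSubmodule.1 hy), TensorProduct.neg_tmul,
                TensorProduct.tmul_neg]
          exact sub_eq_zero.1 (this ht)
        rw [hS.apply_primitive hx, h1 _ (cobracket_mem_primitives hmul hLie hcoL hx),
          hLie.comm_apply, map_neg]
    | algebraMap r =>
      rw [Algebra.algebraMap_eq_smul_one]
      constructor
      · simp [hS.apply_one, Algebra.TensorProduct.one_def]
      · simp [hS.apply_one, cobracket_one hmul]
    | add a b _ _ ha hb =>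
      constructor
      · simp only [map_add, ha.1, hb.1]
      · simp only [map_add, ha.2, hb.2]
    | mul a b _ _ ha hb =>
      constructor
      · rw [hS.apply_mul, Bialgebra.comul_mul, Bialgebra.comul_mul, map_antipode_mul hS, hcm,
          ha.1, hb.1]
      · rw [hS.apply_mul, hmul, hmul, map_add, map_add, map_antipode_mul hS, map_antipode_mul hS,
          hcm, hcm, ha.1, hb.1, ha.2, hb.2, add_comm]

end CoPoisson

theorem exists_sum_map {K : Type u} [Field K] {M : Type v} [AddCommGroup M] [Module K M]
    (π : ℤ → M →ₗ[K] M)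
    (hπ : ∀ a, ∃ R : Finset ℤ, ∀ R' : Finset ℤ, R ⊆ R' → ∑ r ∈ R', π r a = a) (t : M ⊗[K] M) :
    ∃ R : Finset ℤ, ∀ R' : Finset ℤ, R ⊆ R' →
      ∑ r ∈ R', ∑ s ∈ R', TensorProduct.map (π r) (π s) t = t := by
  classical
  induction t using TensorProduct.induction_on with
  | zero => exact ⟨∅, by simp⟩
  | tmul a b =>
    obtain ⟨R, hR⟩ := hπ a
    obtain ⟨R', hR'⟩ := hπ b
    refine ⟨R ∪ R', fun R'' h => ?_⟩
    simp only [TensorProduct.map_tmul, ← TensorProduct.tmul_sum, ← TensorProduct.sum_tmul]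
    rw [hR _ (Finset.union_subset_left h), hR' _ (Finset.union_subset_right h)]
  | add a b ha hb =>
    obtain ⟨R, hR⟩ := ha
    obtain ⟨R', hR'⟩ := hb
    refine ⟨R ∪ R', fun R'' h => ?_⟩
    simp only [map_add, Finset.sum_add_distrib]
    rw [hR _ (Finset.union_subset_left h), hR' _ (Finset.union_subset_right h)]

/-! ### The cobracket induced by `Δ - Δᵒᵖ`. -/

section InducedCobracket

variable {K : Type u} [Field K] {B : Type v} [Ring B] [Bialgebra K B] {F : ℤ → Submodule K B}

namespace AssocGraded

theorem comm_mem_tensorSymbol {z : ℤ} {t : B ⊗[K] B} {T : AssocGraded F ⊗[K] AssocGraded F}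
    (h : (t, T) ∈ tensorSymbol F z) :
    (TensorProduct.comm K B B t, TensorProduct.comm K _ _ T) ∈ tensorSymbol F z := by
  suffices H : tensorSymbol F z ≤ (tensorSymbol F z).comap
      ((TensorProduct.comm K B B).toLinearMap.prodMap
        (TensorProduct.comm K (AssocGraded F) (AssocGraded F)).toLinearMap) from H h
  refine Submodule.span_le.2 ?_
  rintro _ ⟨r, s, rfl, x, y, rfl⟩
  exact Submodule.subset_span ⟨s, r, add_comm _ _, y, x, rfl⟩

variable [IsBialgebraFiltration F]

theorem rotate_mem_tripleSymbol {z : ℤ} {t : B ⊗[K] (B ⊗[K] B)}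
    {T : AssocGraded F ⊗[K] (AssocGraded F ⊗[K] AssocGraded F)} (h : (t, T) ∈ tripleSymbol F z) :
    (rotate K B t, rotate K _ T) ∈ tripleSymbol F z := by
  suffices H : tripleSymbol F z ≤ (tripleSymbol F z).comap
      ((rotate K B).prodMap (rotate K (AssocGraded F))) from H h
  refine Submodule.span_le.2 ?_
  rintro _ ⟨r, s, l, rfl, x, y, w, rfl⟩
  exact Submodule.subset_span ⟨s, l, r, by ring, y, w, x, rfl⟩

theorem leftComm_mem_tripleSymbol {z : ℤ} {t : B ⊗[K] (B ⊗[K] B)}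
    {T : AssocGraded F ⊗[K] (AssocGraded F ⊗[K] AssocGraded F)} (h : (t, T) ∈ tripleSymbol F z) :
    (TensorProduct.leftComm K _ _ _ t, TensorProduct.leftComm K _ _ _ T) ∈ tripleSymbol F z := by
  suffices H : tripleSymbol F z ≤ (tripleSymbol F z).comap
      ((TensorProduct.leftComm K B B B).toLinearMap.prodMap
        (TensorProduct.leftComm K (AssocGraded F) (AssocGraded F) (AssocGraded F)).toLinearMap)
    from H h
  refine Submodule.span_le.2 ?_
  rintro _ ⟨r, s, l, rfl, x, y, w, rfl⟩
  exact Submodule.subset_span ⟨s, r, l, by ring, y, x, w, rfl⟩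

section

variable {f : B →ₗ[K] B ⊗[K] B} {f' : AssocGraded F →ₗ[K] AssocGraded F ⊗[K] AssocGraded F} {d : ℤ}
  (hf : ∀ z (x : F z), (f x, f' (symbol F z x)) ∈ tensorSymbol F (z + d))

include hf

theorem rTensor_mem_tripleSymbol {z : ℤ} {t : B ⊗[K] B} {T : AssocGraded F ⊗[K] AssocGraded F}
    (h : (t, T) ∈ tensorSymbol F z) :
    (TensorProduct.assoc K B B B (f.rTensor B t),
      TensorProduct.assoc K _ _ _ (f'.rTensor _ T)) ∈ tripleSymbol F (z + d) := by
  suffices H : tensorSymbol F z ≤ (tripleSymbol F (z + d)).comap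
      (((TensorProduct.assoc K B B B).toLinearMap ∘ₗ f.rTensor B).prodMap
        ((TensorProduct.assoc K _ _ _).toLinearMap ∘ₗ f'.rTensor _)) from H h
  refine Submodule.span_le.2 ?_
  rintro _ ⟨i, j, rfl, y, w, rfl⟩
  have := assoc_tmul_mem_tripleSymbol w (hf i y)
  rwa [add_right_comm] at this

theorem lTensor_mem_tripleSymbol {z : ℤ} {t : B ⊗[K] B} {T : AssocGraded F ⊗[K] AssocGraded F}
    (h : (t, T) ∈ tensorSymbol F z) :
    (f.lTensor B t, f'.lTensor _ T) ∈ tripleSymbol F (z + d) := by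
  suffices H : tensorSymbol F z ≤ (tripleSymbol F (z + d)).comap
      ((f.lTensor B).prodMap (f'.lTensor _)) from H h
  refine Submodule.span_le.2 ?_
  rintro _ ⟨i, j, rfl, y, w, rfl⟩
  have := tmul_mem_tripleSymbol y (hf j w)
  rwa [← add_assoc] at this

end

theorem exists_map_proj_sum (t : AssocGraded F ⊗[K] AssocGraded F) :
    ∃ R : Finset ℤ, ∀ R' : Finset ℤ, R ⊆ R' →
      ∑ r ∈ R', ∑ s ∈ R', TensorProduct.map (proj F r) (proj F s) t = t :=
  exists_sum_map (proj F) exists_proj_sum t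

variable (hD : ∀ (z : ℤ), ∀ x ∈ F z, cocommutator K B x ∈ tensorDegree F (z - 1))

/-- The class in `G_F(B) ⊗ G_F(B)` of `Δ x - Δᵒᵖ x`, for `x ∈ F_z`. -/
def cobracketPiece (z : ℤ) (x : F z) : AssocGraded F ⊗[K] AssocGraded F :=
  (exists_tensorSymbol (hD z x x.2)).choose

theorem cobracketPiece_spec (z : ℤ) (x : F z) :
    (cocommutator K B (x : B), cobracketPiece hD z x) ∈ tensorSymbol F (z - 1) :=
  (exists_tensorSymbol (hD z x x.2)).choose_spec

theorem cobracketPiece_eq {z : ℤ} {x : F z} {T : AssocGraded F ⊗[K] AssocGraded F}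
    (h : (cocommutator K B (x : B), T) ∈ tensorSymbol F (z - 1)) : cobracketPiece hD z x = T :=
  tensorSymbol_unique IsBialgebraFiltration.monotone (cobracketPiece_spec hD z x) h

/-- The cobracket of `G_F(B)` induced by `Δ - Δᵒᵖ`. -/
def cobracketHom : AssocGraded F →ₗ[K] AssocGraded F ⊗[K] AssocGraded F :=
  lift (fun z =>
    { toFun := cobracketPiece hD z
      map_add' := fun x y => cobracketPiece_eq hD (by
        simpa using add_mem (cobracketPiece_spec hD z x) (cobracketPiece_spec hD z y))
      map_smul' := fun c x => cobracketPiece_eq hD (by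
        simpa using Submodule.smul_mem _ c (cobracketPiece_spec hD z x)) })
    fun z x hx => cobracketPiece_eq hD (zero_mem_tensorSymbol IsBialgebraFiltration.monotone
      (hD (z - 1) x hx))

theorem cobracketHom_spec (z : ℤ) (x : F z) :
    (cocommutator K B (x : B), cobracketHom hD (symbol F z x)) ∈ tensorSymbol F (z - 1) := by
  rw [cobracketHom, lift_symbol]
  exact cobracketPiece_spec hD z x

theorem isInducedCobracket_cobracketHom : IsInducedCobracket F (cobracketHom hD) :=
  cobracketHom_spec hD

theorem cobracketHom_mem_tensorDegree {z : ℤ} {a : AssocGraded F} (ha : a ∈ piece F z) :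
    cobracketHom hD a ∈ tensorDegree (piece F) (z - 1) := by
  obtain ⟨x, rfl⟩ := ha
  exact snd_mem_tensorDegree_piece (cobracketHom_spec hD z x)

-- For `x ∈ F_z` the difference `Δx - Δᵒᵖx` lies in degree `z - 1`, so its class in degree `z` is
-- zero; this is cocommutativity.
include hD in
theorem comm_comulHom (a : AssocGraded F) :
    TensorProduct.comm K _ _ (comulHom F a) = comulHom F a := by
  induction a using induction_on with
  | hadd a b ha hb => simp only [map_add, ha, hb]
  | h z x =>
    have h1 := comulHom_spec z x
    have h2 := sub_mem h1 (comm_mem_tensorSymbol h1)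
    have h3 := zero_mem_tensorSymbol (IsBialgebraFiltration.monotone (K := K)) (hD z x x.2)
    have h4 := tensorSymbol_unique IsBialgebraFiltration.monotone h3 h2
    exact (sub_eq_zero.1 h4.symm).symm

theorem comm_cobracketHom (a : AssocGraded F) :
    TensorProduct.comm K _ _ (cobracketHom hD a) = -cobracketHom hD a := by
  induction a using induction_on with
  | hadd a b ha hb => simp only [map_add, ha, hb, neg_add]
  | h z x =>
    have h1 := cobracketHom_spec hD z x
    have h2 := comm_mem_tensorSymbol h1
    rw [comm_cocommutator] at h2
    exact tensorSymbol_unique IsBialgebraFiltration.monotone h2 (neg_mem h1)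

/-- Antisymmetry is not enough in characteristic `2`. The components of bidegrees `(r, s)` and `(s,
r)` combine to `t - tᵒᵖ` by antisymmetry. The component of bidegree `(r, r)` is read off from `Δx -
Δᵒᵖx` by one map applied to both factors, so it visibly has this form. -/
theorem cobracketHom_alternating (a : AssocGraded F) : cobracketHom hD a ∈
    LinearMap.range (LinearMap.id -
      (TensorProduct.comm K (AssocGraded F) (AssocGraded F)).toLinearMap) := by
  induction a using induction_on with
  | hadd a b ha hb => rw [map_add]; exact add_mem ha hb
  | h z x =>
    obtain ⟨R, hR⟩ := exists_map_proj_sum (cobracketHom hD (symbol F z x))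
    rw [← hR R subset_rfl]
    have hcomm : ∀ (g g' : AssocGraded F →ₗ[K] AssocGraded F)
        (t : AssocGraded F ⊗[K] AssocGraded F),
        TensorProduct.map g g' (TensorProduct.comm K _ _ t) =
          TensorProduct.comm K _ _ (TensorProduct.map g' g t) := fun g g' t =>
      TensorProduct.map_comm g g' t
    refine sum_sum_mem _ (fun r s => TensorProduct.map (proj F r) (proj F s)
      (cobracketHom hD (symbol F z x))) (fun r => ?_) (fun r s => ?_) R
    · rw [map_proj_of_mem IsBialgebraFiltration.monotone (cobracketHom_spec hD z x)]
      split_ifs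
      · refine ⟨TensorProduct.map (ext F r) (ext F r) (Coalgebra.comul (x : B)), ?_⟩
        rw [cocommutator_apply, map_sub, TensorProduct.map_comm]
        rfl
      · exact zero_mem _
    · refine ⟨TensorProduct.map (proj F r) (proj F s) (cobracketHom hD (symbol F z x)), ?_⟩
      have h1 := hcomm (proj F s) (proj F r) (cobracketHom hD (symbol F z x))
      rw [comm_cobracketHom, map_neg] at h1
      rw [LinearMap.sub_apply, LinearMap.id_apply, LinearEquiv.coe_coe, ← h1, sub_neg_eq_add]

/-- The identity holds in `B` for `Δ - Δᵒᵖ`, and it passes to classes because the class of a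
threefold tensor is unique. -/
theorem cobracketHom_coJacobi (a : AssocGraded F) :
    (cobracketHom hD).rTensor _ (cobracketHom hD a) +
      cyclicPerm K _ ((cobracketHom hD).rTensor _ (cobracketHom hD a)) +
      cyclicPerm K _ (cyclicPerm K _ ((cobracketHom hD).rTensor _ (cobracketHom hD a))) = 0 := by
  induction a using induction_on with
  | hadd a b ha hb =>
    have := congrArg₂ (· + ·) ha hb
    simp only [map_add, add_zero] at this ⊢
    rw [← this]
    abel
  | h z x =>
    apply (TensorProduct.assoc K _ _ _).injective
    rw [map_add, map_add, assoc_cyclicPerm, assoc_cyclicPerm, assoc_cyclicPerm, map_zero]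
    have h1 := rTensor_mem_tripleSymbol (d := -1) (cobracketHom_spec hD) (cobracketHom_spec hD z x)
    have h2 := rotate_mem_tripleSymbol h1
    have h3 := add_mem (add_mem h1 h2) (rotate_mem_tripleSymbol h2)
    rw [Prod.mk_add_mk, Prod.mk_add_mk, cocommutator_coJacobi] at h3
    exact tripleSymbol_unique IsBialgebraFiltration.monotone h3 (zero_mem _)

theorem isLieCobracket_cobracketHom : IsLieCobracket (cobracketHom hD) where
  alternating := by
    rintro _ ⟨a, rfl⟩
    exact cobracketHom_alternating hD a
  coJacobi := cobracketHom_coJacobi hD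

theorem cobracketHom_coLeibniz (a : AssocGraded F) :
    (comulHom F).lTensor _ (cobracketHom hD a) =
      TensorProduct.assoc K _ _ _ ((cobracketHom hD).rTensor _ (comulHom F a)) +
        TensorProduct.leftComm K _ _ _ ((cobracketHom hD).lTensor _ (comulHom F a)) := by
  induction a using induction_on with
  | hadd a b ha hb => simp only [map_add, ha, hb]; abel
  | h z x =>
    have h1 := coassoc_right_mem (cobracketHom_spec hD z x)
    have h2 := rTensor_mem_tripleSymbol (d := -1) (cobracketHom_spec hD) (comulHom_spec z x)
    have h3 := lTensor_mem_tripleSymbol (d := -1) (cobracketHom_spec hD) (comulHom_spec z x)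
    have h4 := add_mem h2 (leftComm_mem_tripleSymbol h3)
    rw [cocommutator_coLeibniz] at h1
    exact tripleSymbol_unique IsBialgebraFiltration.monotone h1 h4

theorem cobracketHom_mul (a b : AssocGraded F) : cobracketHom hD (a * b) =
    cobracketHom hD a * Coalgebra.comul (R := K) b +
      Coalgebra.comul (R := K) a * cobracketHom hD b := by
  induction a using induction_on with
  | hadd a a' h h' => simp only [add_mul, map_add, h, h']; abel
  | h m x =>
  induction b using induction_on with
  | hadd a a' h h' => simp only [mul_add, map_add, h, h']; abel
  | h n y =>
    rw [symbol_mul_symbol]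
    have h0 := cobracketHom_spec hD (m + n) ⟨x * y, IsBialgebraFiltration.mul_mem x.2 y.2⟩
    have h1 := mul_mem_tensorSymbol (cobracketHom_spec hD m x) (comulHom_spec n y)
    have hc := comm_mem_tensorSymbol (comulHom_spec m x)
    rw [comm_comulHom hD] at hc
    have h2 := mul_mem_tensorSymbol hc (cobracketHom_spec hD n y)
    rw [show m - 1 + n = m + n - 1 by ring] at h1
    rw [show m + (n - 1) = m + n - 1 by ring] at h2
    have h3 := add_mem h1 h2
    simp only [cocommutator_mul] at h0
    exact tensorSymbol_unique IsBialgebraFiltration.monotone h0 h3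

theorem isCoPoissonHopf_cobracketHom {S : AssocGraded F →ₗ[K] AssocGraded F} (hS : IsAntipode S)
    (hgen : Algebra.adjoin K (primitives K (AssocGraded F)) = ⊤) :
    IsCoPoissonHopf S (cobracketHom hD) :=
  isCoPoissonHopf_of_primitives (cobracketHom_mul hD) hS
    ⟨LinearMap.ext fun a => comm_comulHom hD a⟩ (isLieCobracket_cobracketHom hD)
    (cobracketHom_coLeibniz hD) hgen

end AssocGraded

end InducedCobracket

/-! ### The ε-filtration is a bialgebra filtration. -/

section EpsilonFiltration

variable {K : Type u} [Field K] {B : Type v} [Ring B] [Bialgebra K B]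

theorem mul_mem_tensorDegree {F : ℤ → Submodule K B}
    (hF : ∀ {m n : ℤ} {x y : B}, x ∈ F m → y ∈ F n → x * y ∈ F (m + n)) {m n : ℤ}
    {s t : B ⊗[K] B} (hs : s ∈ tensorDegree F m) (ht : t ∈ tensorDegree F n) :
    s * t ∈ tensorDegree F (m + n) := by
  have h1 : ∀ i j, i + j = m → ∀ x ∈ F i, ∀ y ∈ F j, tensorDegree F n ≤
      (tensorDegree F (m + n)).comap (LinearMap.mulLeft K (x ⊗ₜ[K] y)) := by
    intro i j hij x hx y hy
    refine tensorDegree_le fun r l hrl x' hx' y' hy' => ?_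
    rw [Submodule.mem_comap, LinearMap.mulLeft_apply, Algebra.TensorProduct.tmul_mul_tmul]
    exact tmul_mem_tensorDegree (by omega) (hF hx hx') (hF hy hy')
  have h2 : tensorDegree F m ≤ (tensorDegree F (m + n)).comap (LinearMap.mulRight K t) :=
    tensorDegree_le fun i j hij x hx y hy => h1 i j hij x hx y hy ht
  exact h2 hs

theorem tensorDegree_mono {F : ℤ → Submodule K B} (hF : Monotone F) {m n : ℤ} (hmn : m ≤ n) :
    tensorDegree F m ≤ tensorDegree F n :=
  tensorDegree_le fun r s hrs x hx y hy =>
    tmul_mem_tensorDegree (r := r + (n - m)) (by omega) (hF (by omega) hx) hy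

theorem comm_mem_tensorDegree {F : ℤ → Submodule K B} {n : ℤ} {t : B ⊗[K] B}
    (ht : t ∈ tensorDegree F n) : TensorProduct.comm K B B t ∈ tensorDegree F n := by
  have : tensorDegree F n ≤ (tensorDegree F n).comap (TensorProduct.comm K B B).toLinearMap :=
    tensorDegree_le fun r s hrs x hx y hy => tmul_mem_tensorDegree (by omega) hy hx
  exact this ht

theorem mem_augmentationIdeal {x : B} :
    x ∈ augmentationIdeal K B ↔ Coalgebra.counit (R := K) x = 0 := Iff.rfl

theorem augProj_mem_augmentationIdeal (x : B) : augProj K B x ∈ augmentationIdeal K B := by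
  rw [mem_augmentationIdeal, augProj_apply, map_sub, Bialgebra.counit_algebraMap, sub_self]

theorem epsilonFiltration_of_nonneg {z : ℤ} (hz : 0 ≤ z) : epsilonFiltration K B z = ⊤ :=
  if_pos hz

theorem epsilonFiltration_neg_succ (n : ℕ) :
    epsilonFiltration K B (-(n + 1 : ℕ)) = augmentationIdeal K B ^ (n + 1) := by
  rw [epsilonFiltration, if_neg (by omega)]
  congr 1

theorem epsilonFiltration_neg_one : epsilonFiltration K B (-1) = augmentationIdeal K B := by
  have := epsilonFiltration_neg_succ (K := K) (B := B) 0
  rwa [zero_add, pow_one] at this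

theorem top_mul_augmentationIdeal_pow (n : ℕ) :
    ⊤ * augmentationIdeal K B ^ (n + 1) ≤ augmentationIdeal K B ^ (n + 1) := by
  rw [pow_succ', ← mul_assoc]
  refine mul_le_mul_left (Submodule.mul_le.2 fun x _ y hy => ?_) _
  rw [mem_augmentationIdeal, Bialgebra.counit_mul, mem_augmentationIdeal.1 hy, mul_zero]

theorem augmentationIdeal_pow_mul_top (n : ℕ) :
    augmentationIdeal K B ^ (n + 1) * ⊤ ≤ augmentationIdeal K B ^ (n + 1) := by
  rw [pow_succ, mul_assoc]
  refine mul_le_mul_right (Submodule.mul_le.2 fun x hx y _ => ?_) _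
  rw [mem_augmentationIdeal, Bialgebra.counit_mul, mem_augmentationIdeal.1 hx, zero_mul]

theorem epsilonFiltration_monotone : Monotone (epsilonFiltration K B) := by
  refine monotone_int_of_le_succ fun z => ?_
  rcases lt_or_ge z (-1) with hz | hz
  · obtain ⟨n, hn⟩ := Int.eq_ofNat_of_zero_le (show 0 ≤ -z - 2 by omega)
    rw [show z = -(n + 1 + 1 : ℕ) by push_cast; omega,
      show -(n + 1 + 1 : ℕ) + 1 = -((n + 1 : ℕ) : ℤ) by push_cast; omega,
      epsilonFiltration_neg_succ, epsilonFiltration_neg_succ, pow_succ' _ (n + 1)]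
    exact (mul_le_mul_left le_top _).trans (top_mul_augmentationIdeal_pow n)
  · rw [epsilonFiltration_of_nonneg (show 0 ≤ z + 1 by omega)]
    exact le_top

theorem mul_mem_epsilonFiltration {m n : ℤ} {x y : B} (hx : x ∈ epsilonFiltration K B m)
    (hy : y ∈ epsilonFiltration K B n) : x * y ∈ epsilonFiltration K B (m + n) := by
  have hneg : ∀ z : ℤ, z < 0 → ∃ k : ℕ, z = -(k + 1 : ℕ) := fun z hz => by
    obtain ⟨k, hk⟩ := Int.eq_ofNat_of_zero_le (show 0 ≤ -z - 1 by omega)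
    exact ⟨k, by push_cast; omega⟩
  rcases lt_or_ge m 0 with hm | hm
  · obtain ⟨k, rfl⟩ := hneg m hm
    rw [epsilonFiltration_neg_succ] at hx
    rcases lt_or_ge n 0 with hn | hn
    · obtain ⟨l, rfl⟩ := hneg n hn
      rw [epsilonFiltration_neg_succ] at hy
      rw [show -((k + 1 : ℕ) : ℤ) + -(l + 1 : ℕ) = -(k + 1 + l + 1 : ℕ) by push_cast; ring,
        epsilonFiltration_neg_succ, add_assoc (k + 1), pow_add]
      exact Submodule.mul_mem_mul hx hy
    · refine epsilonFiltration_monotone (le_add_of_nonneg_right hn) ?_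
      rw [epsilonFiltration_neg_succ]
      exact augmentationIdeal_pow_mul_top k (Submodule.mul_mem_mul hx trivial)
  · rcases lt_or_ge n 0 with hn | hn
    · refine epsilonFiltration_monotone (le_add_of_nonneg_left hm) ?_
      obtain ⟨l, rfl⟩ := hneg n hn
      rw [epsilonFiltration_neg_succ] at hy ⊢
      exact top_mul_augmentationIdeal_pow l (Submodule.mul_mem_mul trivial hy)
    · rw [epsilonFiltration_of_nonneg (by omega)]
      trivial

/-- With `π = id - uε`, one has `(π ⊗ π)Δx = Δx - x ⊗ 1 - 1 ⊗ πx`, so `∇x` is the antisymmetrization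
of `(π ⊗ π)Δx` and lies in `J ⊗ J` for every `x ∈ B`. This settles `n ≤ 1`, and the product rule for
`∇` propagates the estimate to higher powers of `J`. -/
theorem comul_mem_tensorDegree_epsilonFiltration_pow (n : ℕ) :
    ∀ x ∈ epsilonFiltration K B (-n), Coalgebra.comul (R := K) x ∈
        tensorDegree (epsilonFiltration K B) (-n) ∧
      cocommutator K B x ∈ tensorDegree (epsilonFiltration K B) (-n - 1) := by
  have htop : ∀ z : ℤ, 0 ≤ z → ∀ t : B ⊗[K] B, t ∈ tensorDegree (epsilonFiltration K B) z := by
    intro z hz t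
    induction t using TensorProduct.induction_on with
    | zero => exact zero_mem _
    | add s t hs ht => exact add_mem hs ht
    | tmul x y =>
      refine tmul_mem_tensorDegree (add_zero z) ?_ ?_
      · rw [epsilonFiltration_of_nonneg hz]; trivial
      · rw [epsilonFiltration_of_nonneg le_rfl]; trivial
  have haug : ∀ t : B ⊗[K] B, (augProj K B).rTensor B t ∈
      tensorDegree (epsilonFiltration K B) (-1) := by
    intro t
    induction t using TensorProduct.induction_on with
    | zero => rw [map_zero]; exact zero_mem _
    | add s t hs ht => rw [map_add]; exact add_mem hs ht
    | tmul x y =>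
      refine tmul_mem_tensorDegree (add_zero (-1)) ?_ ?_
      · rw [epsilonFiltration_neg_one]; exact augProj_mem_augmentationIdeal x
      · rw [epsilonFiltration_of_nonneg le_rfl]; trivial
  have haug2 : ∀ t : B ⊗[K] B, TensorProduct.map (augProj K B) (augProj K B) t ∈
      tensorDegree (epsilonFiltration K B) (-2) := by
    intro t
    induction t using TensorProduct.induction_on with
    | zero => rw [map_zero]; exact zero_mem _
    | add s t hs ht => rw [map_add]; exact add_mem hs ht
    | tmul x y =>
      refine tmul_mem_tensorDegree (show (-1 : ℤ) + -1 = -2 by norm_num) ?_ ?_ <;>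
      · rw [epsilonFiltration_neg_one]; exact augProj_mem_augmentationIdeal _
  have hunit : ∀ x : B, (augProj K B).rTensor B (Coalgebra.comul (R := K) x) =
      Coalgebra.comul (R := K) x - 1 ⊗ₜ[K] x := by
    intro x
    have h : (Algebra.linearMap K B ∘ₗ Coalgebra.counit).rTensor B (Coalgebra.comul (R := K) x) =
        1 ⊗ₜ[K] x := by
      rw [LinearMap.rTensor_comp, LinearMap.comp_apply, Coalgebra.rTensor_counit_comul,
        LinearMap.rTensor_tmul, Algebra.linearMap_apply, map_one]
    rw [augProj, LinearMap.rTensor_sub, LinearMap.sub_apply, LinearMap.rTensor_id, h,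
      LinearMap.id_apply]
  have hnab : ∀ x : B, cocommutator K B x ∈ tensorDegree (epsilonFiltration K B) (-2) := by
    intro x
    have h1 : TensorProduct.map (augProj K B) (augProj K B) (Coalgebra.comul (R := K) x) =
        Coalgebra.comul (R := K) x - x ⊗ₜ[K] 1 - 1 ⊗ₜ[K] augProj K B x := by
      rw [← LinearMap.lTensor_comp_rTensor, LinearMap.comp_apply, hunit, map_sub,
        lTensor_augProj_comul, comulSubTmulOne_apply, LinearMap.lTensor_tmul]
    have h2 : cocommutator K B x =
        TensorProduct.map (augProj K B) (augProj K B) (Coalgebra.comul (R := K) x) -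
        TensorProduct.comm K B B
          (TensorProduct.map (augProj K B) (augProj K B) (Coalgebra.comul (R := K) x)) := by
      rw [h1, cocommutator_apply, augProj_apply, Algebra.algebraMap_eq_smul_one]
      simp only [map_sub, TensorProduct.comm_tmul, TensorProduct.tmul_sub,
        TensorProduct.tmul_smul, TensorProduct.smul_tmul']
      abel
    rw [h2]
    exact sub_mem (haug2 _) (comm_mem_tensorDegree (haug2 _))
  have hcomul : ∀ x ∈ augmentationIdeal K B, Coalgebra.comul (R := K) x ∈
      tensorDegree (epsilonFiltration K B) (-1) := by
    intro x hx
    have h1 := haug (Coalgebra.comul (R := K) x)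
    rw [hunit] at h1
    have h2 : (1 : B) ⊗ₜ[K] x ∈ tensorDegree (epsilonFiltration K B) (-1) := by
      refine tmul_mem_tensorDegree (zero_add (-1)) ?_ ?_
      · rw [epsilonFiltration_of_nonneg le_rfl]; trivial
      · rwa [epsilonFiltration_neg_one]
    simpa using add_mem h1 h2
  have hmono := epsilonFiltration_monotone (K := K) (B := B)
  induction n with
  | zero =>
    intro x _
    exact ⟨htop _ (by simp) _, tensorDegree_mono hmono (by norm_num) (hnab x)⟩
  | succ n ih =>
    intro x hx
    -- The first power of `J` is treated directly; from then on `J^{n+1} = J^n J` with `n ≥ 1`.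
    rcases Nat.eq_zero_or_pos n with rfl | hn
    · refine ⟨hcomul x ?_, tensorDegree_mono hmono (by norm_num) (hnab x)⟩
      simpa [epsilonFiltration_neg_one] using hx
    · obtain ⟨k, rfl⟩ := Nat.exists_eq_succ_of_ne_zero hn.ne'
      rw [epsilonFiltration_neg_succ, pow_succ] at hx
      induction hx using Submodule.mul_induction_on' with
      | add a _ b _ ha hb =>
        simp only [map_add]
        exact ⟨add_mem ha.1 hb.1, add_mem ha.2 hb.2⟩
      | mem_mul_mem a ha b hb =>
        obtain ⟨h1, h2⟩ := ih a (by rw [Nat.succ_eq_add_one, epsilonFiltration_neg_succ]; exact ha)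
        rw [Bialgebra.comul_mul, cocommutator_mul]
        constructor
        · have := mul_mem_tensorDegree mul_mem_epsilonFiltration h1 (hcomul b hb)
          rwa [show -((k.succ : ℕ) : ℤ) + -1 = -((k.succ + 1 : ℕ) : ℤ) by push_cast; ring] at this
        · have h3 := mul_mem_tensorDegree mul_mem_epsilonFiltration h2 (hcomul b hb)
          have h4 := mul_mem_tensorDegree mul_mem_epsilonFiltration (comm_mem_tensorDegree h1)
            (hnab b)
          rw [show -((k.succ : ℕ) : ℤ) - 1 + -1 = -((k.succ + 1 : ℕ) : ℤ) - 1 by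
            push_cast; ring] at h3
          rw [show -((k.succ : ℕ) : ℤ) + -2 = -((k.succ + 1 : ℕ) : ℤ) - 1 by
            push_cast; ring] at h4
          exact add_mem h3 h4

theorem comul_cocommutator_mem_tensorDegree_epsilonFiltration {z : ℤ} {x : B}
    (hx : x ∈ epsilonFiltration K B z) :
    Coalgebra.comul (R := K) x ∈ tensorDegree (epsilonFiltration K B) z ∧
      cocommutator K B x ∈ tensorDegree (epsilonFiltration K B) (z - 1) := by
  rcases le_or_gt z 0 with hz | hz
  · obtain ⟨n, hn⟩ := Int.eq_ofNat_of_zero_le (show 0 ≤ -z by omega)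
    obtain rfl : z = -n := by omega
    exact comul_mem_tensorDegree_epsilonFiltration_pow n x hx
  · have := comul_mem_tensorDegree_epsilonFiltration_pow (K := K) (B := B) 0 x (by
      rw [epsilonFiltration_of_nonneg (by simp)]; trivial)
    have hmono := epsilonFiltration_monotone (K := K) (B := B)
    exact ⟨tensorDegree_mono hmono (by simpa using hz.le) this.1,
      tensorDegree_mono hmono (by simp; omega) this.2⟩

instance isBialgebraFiltration_epsilonFiltration :
    IsBialgebraFiltration (epsilonFiltration K B) where
  monotone := epsilonFiltration_monotone
  mul_mem := mul_mem_epsilonFiltration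
  comul_mem := fun hx => (comul_cocommutator_mem_tensorDegree_epsilonFiltration hx).1
  one_mem := by rw [epsilonFiltration_of_nonneg le_rfl]; trivial
  counit_eq_zero := fun hx => by rwa [epsilonFiltration_neg_one] at hx

theorem isConnectedGrading_epsilonFiltration :
    IsConnectedGrading (fun n => AssocGraded.piece (epsilonFiltration K B) (-n)) :=
  AssocGraded.isConnectedGrading_piece_neg
    (fun z hz => by rw [epsilonFiltration_of_nonneg (show 0 ≤ z - 1 by omega)]; exact le_top)
    (fun x _ => ⟨Coalgebra.counit (R := K) x, by
      rw [epsilonFiltration_neg_one, ← Algebra.algebraMap_eq_smul_one, ← augProj_apply]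
      exact augProj_mem_augmentationIdeal x⟩)

/-- The graded algebra is generated by its component `J/J²` of degree one, and elements of the
lowest possible positive degree are primitive. -/
theorem adjoin_primitives_epsilonFiltration :
    Algebra.adjoin K (primitives K (AssocGraded (epsilonFiltration K B))) = ⊤ := by
  have hconn := isConnectedGrading_epsilonFiltration (K := K) (B := B)
  set A := Algebra.adjoin K (primitives K (AssocGraded (epsilonFiltration K B))) with hA
  have hone : ∀ a ∈ AssocGraded.piece (epsilonFiltration K B) (-1), a ∈ A := fun a ha =>
    Algebra.subset_adjoin (hconn.mem_primitives one_pos (fun m h1 h2 => by omega) ha)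
  have hpos : ∀ n : ℕ, ∀ x : epsilonFiltration K B (-(n + 1 : ℕ)),
      AssocGraded.symbol _ _ x ∈ A := by
    intro n
    induction n with
    | zero => intro x; exact hone _ (AssocGraded.symbol_mem_piece _ x)
    | succ n ih =>
      rintro ⟨x, hx⟩
      have hx' := hx
      rw [epsilonFiltration_neg_succ, pow_succ] at hx'
      induction hx' using Submodule.mul_induction_on' with
      | add a ha b hb iha ihb =>
        rw [← pow_succ, ← epsilonFiltration_neg_succ] at ha hb
        have := add_mem (iha ha) (ihb hb)
        rwa [← map_add] at this
      | mem_mul_mem a ha b hb =>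
        rw [← epsilonFiltration_neg_succ] at ha
        rw [← epsilonFiltration_neg_one] at hb
        have := mul_mem (ih ⟨a, ha⟩) (hone _ (AssocGraded.symbol_mem_piece _ ⟨b, hb⟩))
        rw [AssocGraded.symbol_mul_symbol] at this
        convert! this using 1
  have : (⊤ : Submodule K (AssocGraded (epsilonFiltration K B))) ≤ Subalgebra.toSubmodule A := by
    rw [← hconn.iSup_eq_top]
    refine iSup_le fun n a ha => ?_
    rcases lt_trichotomy n 0 with hn | rfl | hn
    · rw [hconn.eq_bot_of_neg hn] at ha
      rw [(Submodule.mem_bot K).1 ha]; exact zero_mem _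
    · obtain ⟨c, rfl⟩ := Submodule.mem_span_singleton.1 (hconn.zero_le ha)
      exact Submodule.smul_mem _ c (Subalgebra.one_mem A)
    · obtain ⟨k, hk⟩ := Int.eq_ofNat_of_zero_le (show 0 ≤ n - 1 by omega)
      obtain rfl : n = (k + 1 : ℕ) := by push_cast; omega
      obtain ⟨x, rfl⟩ := ha
      exact hpos k x
  exact Algebra.toSubmodule_eq_top.1 (eq_top_iff.2 this)

theorem exists_piece_epsilonFiltration_eq_bot [Module.Finite K B] :
    ∃ N : ℕ, ∀ n : ℤ, N < n → AssocGraded.piece (epsilonFiltration K B) (-n) = ⊥ := by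
  obtain ⟨N, hN⟩ := monotone_stabilizes_iff_artinian.2 (inferInstance : IsArtinian K B)
    ⟨fun k : ℕ => OrderDual.toDual (epsilonFiltration K B (-k)),
      fun a b hab => epsilonFiltration_monotone (K := K) (B := B) (by omega)⟩
  refine ⟨N, fun n hn => AssocGraded.piece_eq_bot ?_⟩
  obtain ⟨k, hk⟩ := Int.eq_ofNat_of_zero_le (show 0 ≤ n by omega)
  have h1 : epsilonFiltration K B (-N) = epsilonFiltration K B (-k) := hN k (by omega)
  have h2 : epsilonFiltration K B (-N) = epsilonFiltration K B (-(k + 1 : ℕ)) :=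
    hN (k + 1) (by omega)
  rw [show -n - 1 = -((k + 1 : ℕ) : ℤ) by push_cast; omega, hk, ← h1, ← h2]

end EpsilonFiltration

/-! ### Jacobson's formula for `p`-th powers. -/

section Jacobson

variable {K : Type u} [Field K] (p : ℕ) [CharP K p] [Fact p.Prime]
  {A : Type w} [Ring A] [Algebra K A] {g : Type v} [LieRing g] [LieAlgebra K g]

theorem charP_of_algebra (K : Type u) [Field K] (p : ℕ) [CharP K p] (A : Type w) [Ring A]
    [Algebra K A] [Nontrivial A] : CharP A p :=
  charP_of_injective_algebraMap (algebraMap K A).injective p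

/-- Left and right multiplication commute, so the `p`-th power of their difference is the difference
of their `p`-th powers. -/
theorem commutator_iterate_char [CharP A p] (x y : A) :
    (fun z => x * z - z * x)^[p] y = x ^ p * y - y * x ^ p := by
  have : CharP (Module.End ℤ A) p :=
    charP_of_injective_ringHom (f := (Algebra.lmul ℤ A).toRingHom) Algebra.lmul_injective p
  have h := sub_pow_char_of_commute (p := p)
    (show Commute (LinearMap.mulLeft ℤ x) (LinearMap.mulRight ℤ x) from
      LinearMap.commute_mulLeft_right x x)
  have h2 := LinearMap.congr_fun h y
  rw [Module.End.pow_apply, LinearMap.pow_mulLeft, LinearMap.pow_mulRight] at h2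
  exact h2

open Polynomial in
theorem derivative_pow_eq_sum (P : A[X]) (n : ℕ) : derivative (P ^ n) =
    ∑ i ∈ Finset.range n, P ^ i * derivative P * P ^ (n - 1 - i) := by
  induction n with
  | zero => simp
  | succ n ih =>
    rw [pow_succ', derivative_mul, ih, Finset.sum_range_succ', Finset.mul_sum, pow_zero, one_mul,
      Nat.add_sub_cancel, Nat.sub_zero, add_comm]
    congr 1
    refine Finset.sum_congr rfl fun i _ => ?_
    rw [pow_succ', show n - (i + 1) = n - 1 - i by omega]
    simp only [mul_assoc]

variable (j : g →ₗ[K] A) (hj : ∀ x y, j ⁅x, y⁆ = j x * j y - j y * j x)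

open Polynomial in
include hj in
theorem coeff_commutator_iterate (x y : g) (n : ℕ) : ∀ i,
    ((fun z => (C (j x) * X + C (j y)) * z - z * (C (j x) * X + C (j y)))^[n] (C (j x))).coeff i =
      j (adPowCoeff x y n i) := by
  induction n with
  | zero =>
    intro i
    cases i with
    | zero => simp [adPowCoeff]
    | succ i => simp [adPowCoeff]
  | succ n ih =>
    intro i
    rw [Function.iterate_succ_apply']
    set Q := (fun z => (C (j x) * X + C (j y)) * z - z * (C (j x) * X + C (j y)))^[n] (C (j x))
    have e : (C (j x) * X + C (j y)) * Q - Q * (C (j x) * X + C (j y)) =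
        (C (j x) * Q - Q * C (j x)) * X + (C (j y) * Q - Q * C (j y)) := by
      rw [add_mul, mul_add, mul_assoc, X_mul, sub_mul, mul_assoc, mul_assoc]
      abel
    rw [e, coeff_add, coeff_sub, coeff_C_mul, coeff_mul_C, ih i]
    cases i with
    | zero =>
      rw [coeff_mul_X_zero, zero_add, adPowCoeff, hj]
    | succ i =>
      rw [coeff_mul_X, coeff_sub, coeff_C_mul, coeff_mul_C, ih i, adPowCoeff, map_add, hj, hj,
        add_comm]

open Polynomial in
include hj in
/-- Jacobson's formula. -/
theorem add_pow_eq_add_jacobsonSum [CharP A p] (x y : g) :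
    (j x + j y) ^ p = j x ^ p + j y ^ p + j (jacobsonSum K p x y) := by
  have hp := (Fact.out : p.Prime)
  set P : A[X] := C (j x) * X + C (j y) with hP
  have hdeg : P.natDegree ≤ 1 := natDegree_linear_le
  -- With `P = tx + y`, the derivative of `P^p` is `∑ P^i x P^{p-1-i} = (ad P)^{p-1}(x)`. Comparing
  -- coefficients of `t^i` determines `i + 1` times the wanted coefficient, and `i + 1 < p` is
  -- invertible.
  have hcoeff : ∀ i, i < p - 1 → (P ^ p).coeff (i + 1) =
      ((i + 1 : ℕ) : K)⁻¹ • j (adPowCoeff x y (p - 1) i) := by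
    intro i hi
    have h1 : derivative (P ^ p) = (fun z => P * z - z * P)^[p - 1] (C (j x)) := by
      rw [derivative_pow_eq_sum, ← sum_pow_mul_pow_eq_iterate p]
      simp [hP]
    have h2 := congrArg (fun f => coeff f i) h1
    simp only [coeff_derivative] at h2
    rw [coeff_commutator_iterate j hj] at h2
    have hne : ((i + 1 : ℕ) : K) ≠ 0 := by
      rw [Ne, CharP.cast_eq_zero_iff K p]
      exact Nat.not_dvd_of_pos_of_lt (by omega) (by omega)
    rw [← h2, eq_inv_smul_iff₀ hne, Nat.cast_smul_eq_nsmul, nsmul_eq_mul', Nat.cast_succ]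
  -- Evaluation at `t = 1` is multiplicative over the noncommutative ring `A` because `1` is
  -- central.
  let ev : A[X] →+* A := eval₂RingHom' (RingHom.id A) 1 fun a => Commute.one_right _
  have hev : ∀ f : A[X], ev f = eval 1 f := fun f => rfl
  have h1 : (j x + j y) ^ p = eval 1 (P ^ p) := by
    rw [← hev, map_pow, hev]
    simp [hP]
  have h0 : (P ^ p).coeff 0 = j y ^ p := by
    rw [← constantCoeff_apply, map_pow]
    simp [hP]
  have htop : (P ^ p).coeff (p - 1 + 1) = j x ^ p := by
    rw [Nat.sub_add_cancel hp.one_le]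
    have := coeff_pow_of_natDegree_le (m := p) hdeg
    rw [mul_one] at this
    rw [this]
    simp [hP, coeff_C]
  rw [h1, eval_eq_sum_range' (n := p - 1 + 1 + 1)
    (lt_of_le_of_lt (natDegree_pow_le_of_le p hdeg) (by omega))]
  simp only [one_pow, mul_one]
  rw [Finset.sum_range_succ', Finset.sum_range_succ, h0, htop,
    Finset.sum_congr rfl fun i hi => hcoeff i (Finset.mem_range.1 hi)]
  have h2 : j (jacobsonSum K p x y) = ∑ i ∈ Finset.range (p - 1),
      ((i + 1 : ℕ) : K)⁻¹ • j (adPowCoeff x y (p - 1) i) := by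
    have h3 := Finset.sum_Ico_add' (fun i : ℕ => (i : K)⁻¹ • j (adPowCoeff x y (p - 1) (i - 1)))
      0 (p - 1) 1
    simp only [Nat.add_sub_cancel, ← Finset.range_eq_Ico] at h3
    rw [h3, jacobsonSum, map_sum]
    refine Finset.sum_congr (by ext; simp) fun i _ => ?_
    rw [map_smul]
  rw [h2]
  abel

end Jacobson

/-! ### The restricted Lie algebra of primitive elements. -/

section PrimitiveLie

variable {K : Type u} [Field K] {H : Type v} [Ring H] [Bialgebra K H]

theorem commutator_mem_primitives {x y : H} (hx : x ∈ primitives K H) (hy : y ∈ primitives K H) :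
    x * y - y * x ∈ primitives K H := by
  rw [mem_primitives, map_sub, Bialgebra.comul_mul, Bialgebra.comul_mul, mem_primitives.1 hx,
    mem_primitives.1 hy]
  simp only [mul_add, add_mul, Algebra.TensorProduct.tmul_mul_tmul, mul_one, one_mul,
    TensorProduct.sub_tmul, TensorProduct.tmul_sub]
  abel

theorem pow_char_mem_primitives (p : ℕ) [CharP K p] [Fact p.Prime] {x : H}
    (hx : x ∈ primitives K H) : x ^ p ∈ primitives K H := by
  have := nontrivial_of_bialgebra K (H ⊗[K] H)
  have := charP_of_algebra K p (H ⊗[K] H)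
  have hpow : Coalgebra.comul (R := K) (x ^ p) = (Coalgebra.comul (R := K) x) ^ p :=
    map_pow (Bialgebra.comulAlgHom K H) x p
  rw [mem_primitives, hpow, mem_primitives.1 hx, add_pow_char_of_commute]
  · simp only [Algebra.TensorProduct.tmul_pow, one_pow]
  · simp [Commute, SemiconjBy]

variable (K H) in
/-- The Lie algebra of primitive elements of a bialgebra. -/
instance primitiveLieRing : LieRing (primitiveSubmodule K H) where
  bracket x y := ⟨(x : H) * y - y * x, mem_primitiveSubmodule.2 (commutator_mem_primitives
    (mem_primitiveSubmodule.1 x.2) (mem_primitiveSubmodule.1 y.2))⟩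
  add_lie x y z := Subtype.ext (by
    change ((x : H) + y) * z - z * (x + y) = x * z - z * x + (y * z - z * y)
    noncomm_ring)
  lie_add x y z := Subtype.ext (by
    change (x : H) * (y + z) - (y + z) * x = x * y - y * x + (x * z - z * x)
    noncomm_ring)
  lie_self x := Subtype.ext (sub_self _)
  leibniz_lie x y z := Subtype.ext (by
    change (x : H) * (y * z - z * y) - (y * z - z * y) * x =
      (x * y - y * x) * z - z * (x * y - y * x) + (y * (x * z - z * x) - (x * z - z * x) * y)
    noncomm_ring)

theorem coe_lie (x y : primitiveSubmodule K H) :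
    ((⁅x, y⁆ : primitiveSubmodule K H) : H) = (x : H) * y - y * x := rfl

variable (K H) in
instance primitiveLieAlgebra : LieAlgebra K (primitiveSubmodule K H) where
  lie_smul c x y := Subtype.ext (by
    rw [coe_lie, Submodule.coe_smul, Submodule.coe_smul, coe_lie, smul_sub, mul_smul_comm,
      smul_mul_assoc])

variable (K H) in
open Classical in
/-- The `p`-operation on primitive elements. -/
def primitivePMap (p : ℕ) (x : primitiveSubmodule K H) : primitiveSubmodule K H :=
  -- In positive characteristic `p` the condition always holds; the default value only serves `p =
  -- 0`, where the operation plays no role.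
  if h : (x : H) ^ p ∈ primitiveSubmodule K H then ⟨(x : H) ^ p, h⟩ else 0

theorem coe_primitivePMap (p : ℕ) [CharP K p] (hp : p ≠ 0) (x : primitiveSubmodule K H) :
    (primitivePMap K H p x : H) = (x : H) ^ p := by
  have : Fact p.Prime := ⟨(CharP.char_is_prime_or_zero K p).resolve_right hp⟩
  rw [primitivePMap, dif_pos (mem_primitiveSubmodule.2
    (pow_char_mem_primitives p (mem_primitiveSubmodule.1 x.2)))]

variable (K H) in
/-- The restricted Lie algebra of primitive elements of a bialgebra. -/
def primitiveRestricted (p : ℕ) [CharP K p] :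
    RestrictedLieStructure K p (primitiveSubmodule K H) where
  pMap := primitivePMap K H p
  pMap_smul hp c x := Subtype.ext (by
    rw [coe_primitivePMap p hp, Submodule.coe_smul, Submodule.coe_smul, coe_primitivePMap p hp,
      smul_pow])
  pMap_add hp x y := Subtype.ext (by
    have : Fact p.Prime := ⟨(CharP.char_is_prime_or_zero K p).resolve_right hp⟩
    have := nontrivial_of_bialgebra K H
    have := charP_of_algebra K p H
    have h := add_pow_eq_add_jacobsonSum p (primitiveSubmodule K H).subtype coe_lie x y
    simp only [Submodule.subtype_apply] at h
    rw [coe_primitivePMap p hp, Submodule.coe_add, h, Submodule.coe_add, Submodule.coe_add,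
      coe_primitivePMap p hp, coe_primitivePMap p hp])
  pMap_lie hp x y := Subtype.ext (by
    have : Fact p.Prime := ⟨(CharP.char_is_prime_or_zero K p).resolve_right hp⟩
    have := nontrivial_of_bialgebra K H
    have := charP_of_algebra K p H
    rw [coe_lie, coe_primitivePMap p hp, ← commutator_iterate_char p (x : H) y,
      Module.End.pow_apply]
    exact (Function.Semiconj.iterate_right (f := ((↑) : primitiveSubmodule K H → H))
      (fun z => (rfl : ((LieAlgebra.ad K _ x z : primitiveSubmodule K H) : H) =
        (x : H) * z - z * x)) p y).symm)

end PrimitiveLie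

/-! ### The Lie bialgebra of primitive elements. -/

section PrimitiveCobracket

variable {K : Type u} [Field K] {H : Type v} [Ring H] [Bialgebra K H]

variable (K H) in
theorem exists_primitiveRetraction : ∃ e : H →ₗ[K] primitiveSubmodule K H,
    e ∘ₗ (primitiveSubmodule K H).subtype = LinearMap.id :=
  LinearMap.exists_leftInverse_of_injective _ (Submodule.ker_subtype _)

variable (K H) in
/-- A projection onto the space of primitive elements. -/
def primitiveRetraction : H →ₗ[K] primitiveSubmodule K H := (exists_primitiveRetraction K H).choose

theorem primitiveRetraction_coe (x : primitiveSubmodule K H) :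
    primitiveRetraction K H (x : H) = x :=
  LinearMap.congr_fun (exists_primitiveRetraction K H).choose_spec x

/-- The restriction of a cobracket to the primitive elements. -/
def primitiveCobracket (δ : H →ₗ[K] H ⊗[K] H) :
    primitiveSubmodule K H →ₗ[K] primitiveSubmodule K H ⊗[K] primitiveSubmodule K H :=
  TensorProduct.map (primitiveRetraction K H) (primitiveRetraction K H) ∘ₗ δ ∘ₗ
    (primitiveSubmodule K H).subtype

variable (K H) in
/-- The inclusion `P ⊗ P → H ⊗ H`. -/
def primitiveIncl₂ : primitiveSubmodule K H ⊗[K] primitiveSubmodule K H →ₗ[K] H ⊗[K] H :=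
  TensorProduct.map (primitiveSubmodule K H).subtype (primitiveSubmodule K H).subtype

theorem map_retraction_primitiveIncl₂ (t : primitiveSubmodule K H ⊗[K] primitiveSubmodule K H) :
    TensorProduct.map (primitiveRetraction K H) (primitiveRetraction K H)
      (primitiveIncl₂ K H t) = t := by
  induction t using TensorProduct.induction_on with
  | zero => simp
  | add s t hs ht => simp only [map_add, hs, ht]
  | tmul x y => simp [primitiveIncl₂, primitiveRetraction_coe]

theorem primitiveIncl₂_injective : Function.Injective (primitiveIncl₂ K H) :=
  Function.LeftInverse.injective map_retraction_primitiveIncl₂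

theorem primitiveIncl₂_map_retraction {t : H ⊗[K] H}
    (ht : t ∈ tensorSub (primitiveSubmodule K H) (primitiveSubmodule K H)) :
    primitiveIncl₂ K H
      (TensorProduct.map (primitiveRetraction K H) (primitiveRetraction K H) t) = t := by
  have : tensorSub (primitiveSubmodule K H) (primitiveSubmodule K H) ≤
      LinearMap.ker (primitiveIncl₂ K H ∘ₗ
        TensorProduct.map (primitiveRetraction K H) (primitiveRetraction K H) - LinearMap.id) :=
    tensorSub_le fun x hx y hy => by
      have h1 := primitiveRetraction_coe (⟨x, hx⟩ : primitiveSubmodule K H)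
      have h2 := primitiveRetraction_coe (⟨y, hy⟩ : primitiveSubmodule K H)
      simp only at h1 h2
      simp [primitiveIncl₂, h1, h2]
  exact sub_eq_zero.1 (this ht)

/-- Since `Δx = x ⊗ 1 + 1 ⊗ x`, the adjoint action on `P ⊗ P` becomes a commutator with `Δx`. This
turns the product rule of the cobracket into the `1`-cocycle condition. -/
theorem primitiveIncl₂_lie (x : primitiveSubmodule K H)
    (t : primitiveSubmodule K H ⊗[K] primitiveSubmodule K H) :
    primitiveIncl₂ K H ⁅x, t⁆ = Coalgebra.comul (R := K) (x : H) * primitiveIncl₂ K H t -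
      primitiveIncl₂ K H t * Coalgebra.comul (R := K) (x : H) := by
  induction t using TensorProduct.induction_on with
  | zero => simp
  | add s t hs ht => simp only [map_add, lie_add, mul_add, add_mul, hs, ht]; abel
  | tmul y z =>
    rw [mem_primitives.1 (mem_primitiveSubmodule.1 x.2), TensorProduct.LieModule.lie_tmul_right]
    simp only [primitiveIncl₂, map_add, TensorProduct.map_tmul, Submodule.subtype_apply, coe_lie,
      add_mul, mul_add, Algebra.TensorProduct.tmul_mul_tmul, one_mul, mul_one,
      TensorProduct.sub_tmul, TensorProduct.tmul_sub]
    abel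

variable {S : H →ₗ[K] H} {δ : H →ₗ[K] H ⊗[K] H} (h : IsCoPoissonHopf S δ)

include h

theorem primitiveIncl₂_primitiveCobracket (x : primitiveSubmodule K H) :
    primitiveIncl₂ K H (primitiveCobracket δ x) = δ x :=
  primitiveIncl₂_map_retraction (cobracket_mem_primitives h.cobracket_mul h.isLieCobracket
    h.coLeibniz (mem_primitiveSubmodule.1 x.2))

theorem isLieCobracket_primitiveCobracket : IsLieCobracket (primitiveCobracket δ) where
  alternating := by
    rintro _ ⟨x, rfl⟩
    obtain ⟨t, ht⟩ := h.isLieCobracket.alternating ⟨x, rfl⟩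
    refine ⟨TensorProduct.map (primitiveRetraction K H) (primitiveRetraction K H) t, ?_⟩
    change _ = TensorProduct.map _ _ (δ x)
    rw [← ht, LinearMap.sub_apply, LinearMap.sub_apply, map_sub, LinearMap.id_apply,
      LinearMap.id_apply, LinearEquiv.coe_coe, LinearEquiv.coe_coe, TensorProduct.map_comm]
  coJacobi := by
    intro x
    let i := (primitiveSubmodule K H).subtype
    let I := TensorProduct.map (primitiveIncl₂ K H) i
    have hinj : Function.Injective I := by
      refine Function.LeftInverse.injective (g := TensorProduct.map
        (TensorProduct.map (primitiveRetraction K H) (primitiveRetraction K H))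
        (primitiveRetraction K H)) fun t => ?_
      induction t using TensorProduct.induction_on with
      | zero => simp
      | add s t hs ht => simp only [map_add, hs, ht]
      | tmul s y =>
        simp only [I, TensorProduct.map_tmul, map_retraction_primitiveIncl₂]
        exact congrArg (s ⊗ₜ[K] ·) (primitiveRetraction_coe y)
    have hcyc : ∀ t, I (cyclicPerm K _ t) = cyclicPerm K _ (I t) := by
      have : I ∘ₗ cyclicPerm K _ = cyclicPerm K _ ∘ₗ I :=
        TensorProduct.ext_threefold fun a b c => rfl
      exact LinearMap.congr_fun this
    have hδ : ∀ t, I ((primitiveCobracket δ).rTensor _ t) =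
        δ.rTensor _ (primitiveIncl₂ K H t) := by
      intro t
      induction t using TensorProduct.induction_on with
      | zero => simp
      | add s t hs ht => simp only [map_add, hs, ht]
      | tmul a b =>
        simp only [I, LinearMap.rTensor_tmul, TensorProduct.map_tmul,
          primitiveIncl₂_primitiveCobracket h]
        rfl
    apply hinj
    rw [map_add, map_add, hcyc, hcyc, hcyc, hδ, primitiveIncl₂_primitiveCobracket h, map_zero]
    exact h.isLieCobracket.coJacobi x

theorem cobracket_pow (x : H) (n : ℕ) : δ (x ^ n) = ∑ i ∈ Finset.range n,
    Coalgebra.comul (R := K) x ^ i * δ x * Coalgebra.comul (R := K) x ^ (n - 1 - i) := by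
  induction n with
  | zero => simpa using cobracket_one h.cobracket_mul
  | succ n ih =>
    have hpow : Coalgebra.comul (R := K) (x ^ n) = (Coalgebra.comul (R := K) x) ^ n :=
      map_pow (Bialgebra.comulAlgHom K H) x n
    rw [pow_succ', h.cobracket_mul, ih, hpow, Finset.sum_range_succ', Finset.mul_sum, pow_zero,
      one_mul, Nat.add_sub_cancel, Nat.sub_zero, add_comm]
    congr 1
    refine Finset.sum_congr rfl fun i _ => ?_
    rw [pow_succ' _ i, show n - (i + 1) = n - 1 - i by omega]
    simp only [mul_assoc]

variable (p : ℕ) [CharP K p]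

/-- The restricted Lie bialgebra of primitive elements of a co-Poisson Hopf algebra. -/
def primitiveLieBialgebra : RestrictedLieBialgebra K p (primitiveSubmodule K H) where
  __ := primitiveRestricted K H p
  cobracket := primitiveCobracket δ
  isLieCobracket := isLieCobracket_primitiveCobracket h
  cobracket_lie x y := primitiveIncl₂_injective (by
    rw [map_sub, primitiveIncl₂_lie, primitiveIncl₂_lie, primitiveIncl₂_primitiveCobracket h,
      primitiveIncl₂_primitiveCobracket h, primitiveIncl₂_primitiveCobracket h, coe_lie, map_sub,
      h.cobracket_mul, h.cobracket_mul]
    abel)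
  cobracket_pMap hp x := primitiveIncl₂_injective (by
    have : Fact p.Prime := ⟨(CharP.char_is_prime_or_zero K p).resolve_right hp⟩
    have := nontrivial_of_bialgebra K (H ⊗[K] H)
    have := charP_of_algebra K p (H ⊗[K] H)
    rw [primitiveIncl₂_primitiveCobracket h]
    change δ (primitivePMap K H p x) = _
    -- The product rule gives `δ(x^p) = ∑ (Δx)^i δ(x) (Δx)^{p-1-i}`, which in characteristic `p` is
    -- `(ad Δx)^{p-1}(δ(x))`.
    rw [coe_primitivePMap p hp, cobracket_pow h,
      sum_pow_mul_pow_eq_iterate, Module.End.pow_apply,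
      ← primitiveIncl₂_primitiveCobracket h]
    exact (Function.Semiconj.iterate_right (f := primitiveIncl₂ K H)
      (fun z => primitiveIncl₂_lie x z) (p - 1) (primitiveCobracket δ x)).symm)

end PrimitiveCobracket

/-! ### Homogeneous components of tensors. -/

section Projections

variable {K : Type u} [Field K] {M : Type v} [AddCommGroup M] [Module K M] {𝒜 : ℤ → Submodule K M}
  {π : ℤ → M →ₗ[K] M}

theorem exists_sum_projections (hπ : ∀ m n, ∀ x ∈ 𝒜 m, π n x = if m = n then x else 0)
    (htop : ⨆ n, 𝒜 n = ⊤) (a : M) :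
    ∃ R : Finset ℤ, ∀ R' : Finset ℤ, R ⊆ R' → ∑ r ∈ R', π r a = a := by
  classical
  have ha : a ∈ ⨆ n, 𝒜 n := by rw [htop]; trivial
  induction ha using Submodule.iSup_induction' with
  | zero => exact ⟨∅, by simp⟩
  | mem n x hx =>
    refine ⟨{n}, fun R hR => ?_⟩
    simp only [hπ n _ x hx]
    rw [Finset.sum_ite_eq, if_pos (hR (by simp))]
  | add a b _ _ ha hb =>
    obtain ⟨R, hR⟩ := ha
    obtain ⟨R', hR'⟩ := hb
    refine ⟨R ∪ R', fun R'' h => ?_⟩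
    simp only [map_add, Finset.sum_add_distrib]
    rw [hR _ (Finset.union_subset_left h), hR' _ (Finset.union_subset_right h)]

theorem projection_mem (hπ : ∀ m n, ∀ x ∈ 𝒜 m, π n x = if m = n then x else 0)
    (htop : ⨆ n, 𝒜 n = ⊤) (n : ℤ) (a : M) : π n a ∈ 𝒜 n := by
  have : (⊤ : Submodule K M) ≤ (𝒜 n).comap (π n) := by
    rw [← htop]
    refine iSup_le fun m x hx => ?_
    rw [Submodule.mem_comap, hπ m n x hx]
    split_ifs with h
    · exact h ▸ hx
    · exact zero_mem _
  exact this trivial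

theorem map_projections_eq_zero (hπ : ∀ m n, ∀ x ∈ 𝒜 m, π n x = if m = n then x else 0)
    {z r s : ℤ} (hrs : r + s ≠ z) {t : M ⊗[K] M} (ht : t ∈ tensorDegree 𝒜 z) :
    TensorProduct.map (π r) (π s) t = 0 := by
  have : tensorDegree 𝒜 z ≤ LinearMap.ker (TensorProduct.map (π r) (π s)) := by
    refine tensorDegree_le fun i j hij x hx y hy => ?_
    rw [LinearMap.mem_ker, TensorProduct.map_tmul, hπ i r x hx]
    split_ifs with h
    · rw [hπ j s y hy, if_neg (by omega), TensorProduct.tmul_zero]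
    · rw [TensorProduct.zero_tmul]
  exact this ht

theorem mem_tensorDegree_of_map_projections
    (hπ : ∀ m n, ∀ x ∈ 𝒜 m, π n x = if m = n then x else 0) (htop : ⨆ n, 𝒜 n = ⊤) {z : ℤ}
    {t : M ⊗[K] M} (ht : ∀ r s, r + s ≠ z → TensorProduct.map (π r) (π s) t = 0) :
    t ∈ tensorDegree 𝒜 z := by
  obtain ⟨R, hR⟩ := exists_sum_map π (exists_sum_projections hπ htop) t
  rw [← hR R subset_rfl]
  refine sum_mem fun r _ => sum_mem fun s _ => ?_
  by_cases h : r + s = z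
  · have : ∀ t : M ⊗[K] M, TensorProduct.map (π r) (π s) t ∈ tensorDegree 𝒜 z := fun t => by
      induction t using TensorProduct.induction_on with
      | zero => rw [map_zero]; exact zero_mem _
      | add a b ha hb => rw [map_add]; exact add_mem ha hb
      | tmul a b =>
        exact tmul_mem_tensorDegree h (projection_mem hπ htop r a) (projection_mem hπ htop s b)
    exact this t
  · rw [ht r s h]
    exact zero_mem _

end Projections

/-! ### The grading of the primitive elements. -/

section GradedPrimitives

variable {K : Type u} [Field K] {H : Type v} [Ring H] [Bialgebra K H] {𝒜 : ℤ → Submodule K H}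
  (h𝒜 : IsConnectedGrading 𝒜) {π : ℤ → H →ₗ[K] H}
  (hπ : ∀ m n, ∀ x ∈ 𝒜 m, π n x = if m = n then x else 0)

include h𝒜 hπ

/-- The map `x ↦ Δx - x ⊗ 1 - 1 ⊗ x` preserves degrees, so its value at the degree `n` part of `x`
is the degree `n` part of its value at `x`, which is zero. -/
theorem projection_mem_primitiveSubmodule (n : ℤ) {x : H} (hx : x ∈ primitiveSubmodule K H) :
    π n x ∈ primitiveSubmodule K H := by
  set D := comulSubTmulOne K H - TensorProduct.mk K H H 1 with hD
  have hDmem : ∀ m, ∀ x ∈ 𝒜 m, D x ∈ tensorDegree 𝒜 m := fun m x hx =>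
    sub_mem (sub_mem (h𝒜.comul_mem hx) (tmul_mem_tensorDegree (add_zero m) hx h𝒜.one_mem))
      (tmul_mem_tensorDegree (zero_add m) h𝒜.one_mem hx)
  have key : ∀ r s, TensorProduct.map (π r) (π s) ∘ₗ D =
      TensorProduct.map (π r) (π s) ∘ₗ D ∘ₗ π (r + s) := by
    intro r s
    rw [← LinearMap.eqLocus_eq_top, eq_top_iff, ← h𝒜.iSup_eq_top]
    refine iSup_le fun m x hx => ?_
    rw [LinearMap.mem_eqLocus, LinearMap.comp_apply, LinearMap.comp_apply, LinearMap.comp_apply,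
      hπ m _ x hx]
    split_ifs with h
    · rfl
    · rw [map_zero, map_zero, map_projections_eq_zero hπ (Ne.symm h) (hDmem m x hx)]
  have hx' : D x = 0 := hx
  change D (π n x) = 0
  obtain ⟨R, hR⟩ := exists_sum_map π (exists_sum_projections hπ h𝒜.iSup_eq_top) (D (π n x))
  rw [← hR R subset_rfl]
  refine Finset.sum_eq_zero fun r _ => Finset.sum_eq_zero fun s _ => ?_
  by_cases h : r + s = n
  · have h1 := LinearMap.congr_fun (key r s) x
    simp only [LinearMap.comp_apply, hx', map_zero, h] at h1
    exact h1.symm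
  · exact map_projections_eq_zero hπ h (hDmem n _ (projection_mem hπ h𝒜.iSup_eq_top n x))

theorem exists_primitiveProjections :
    ∃ π' : ℤ → primitiveSubmodule K H →ₗ[K] primitiveSubmodule K H,
      (∀ n x, (π' n x : H) = π n x) ∧
      ∀ m n, ∀ x ∈ (𝒜 m).comap (primitiveSubmodule K H).subtype,
        π' n x = if m = n then x else 0 := by
  refine ⟨fun n => (π n).restrict fun x hx => projection_mem_primitiveSubmodule h𝒜 hπ n hx,
    fun n x => rfl, fun m n x hx => Subtype.ext ?_⟩
  refine (hπ m n _ hx).trans ?_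
  split_ifs <;> rfl

omit hπ in
theorem iSup_comap_primitiveSubmodule :
    ⨆ n, (𝒜 n).comap (primitiveSubmodule K H).subtype = ⊤ := by
  obtain ⟨π, hπ⟩ := exists_projections h𝒜.isInternal
  obtain ⟨π', hπ', _⟩ := exists_primitiveProjections h𝒜 hπ
  rw [eq_top_iff]
  intro x _
  obtain ⟨R, hR⟩ := exists_sum_projections hπ h𝒜.iSup_eq_top (x : H)
  have hx : x = ∑ r ∈ R, π' r x := Subtype.ext (by
    rw [Submodule.coe_sum, Finset.sum_congr rfl fun r _ => hπ' r x, hR R subset_rfl])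
  rw [hx]
  refine sum_mem fun r _ => Submodule.mem_iSup_of_mem r ?_
  rw [Submodule.mem_comap, Submodule.subtype_apply, hπ']
  exact projection_mem hπ h𝒜.iSup_eq_top r x

omit hπ in
theorem isGraded_primitiveLieBialgebra (p : ℕ) [CharP K p] {S : H →ₗ[K] H}
    {δ : H →ₗ[K] H ⊗[K] H} (h : IsCoPoissonHopf S δ)
    (hδ : ∀ n, ∀ a ∈ 𝒜 n, δ a ∈ tensorDegree 𝒜 (n + 1)) :
    (primitiveLieBialgebra h p).IsGraded
      fun n => (𝒜 n).comap (primitiveSubmodule K H).subtype := by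
  obtain ⟨π, hπ⟩ := exists_projections h𝒜.isInternal
  obtain ⟨π', hπ', hπ''⟩ := exists_primitiveProjections h𝒜 hπ
  have htop := iSup_comap_primitiveSubmodule h𝒜
  refine ⟨isInternal_of_projections _ π' hπ'' htop, fun {m n x y} hx hy => ?_,
    fun hp n x hx => ?_, fun {n x} hx => ?_⟩
  · rw [Submodule.mem_comap, Submodule.subtype_apply, coe_lie]
    refine sub_mem (h𝒜.mul_mem hx hy) ?_
    rw [add_comm]
    exact h𝒜.mul_mem hy hx
  · change (primitivePMap K H p x : H) ∈ 𝒜 (p * n)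
    rw [coe_primitivePMap p hp]
    exact h𝒜.pow_mem hx p
  · refine mem_tensorDegree_of_map_projections hπ'' htop fun r s hrs => ?_
    apply primitiveIncl₂_injective
    have e : ∀ t, primitiveIncl₂ K H (TensorProduct.map (π' r) (π' s) t) =
        TensorProduct.map (π r) (π s) (primitiveIncl₂ K H t) := fun t => by
      induction t using TensorProduct.induction_on with
      | zero => simp
      | add a b ha hb => simp only [map_add, ha, hb]
      | tmul a b => simp [primitiveIncl₂, hπ']
    rw [e, map_zero]
    change TensorProduct.map (π r) (π s) (primitiveIncl₂ K H (primitiveCobracket δ x)) = 0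
    rw [primitiveIncl₂_primitiveCobracket h]
    exact map_projections_eq_zero hπ hrs (hδ n x hx)

end GradedPrimitives

/-! ### Transport of cobrackets along bialgebra isomorphisms. -/

section Transport

variable {K : Type u} [Field K] {H : Type v} [Ring H] [Bialgebra K H] {H' : Type w} [Ring H']
  [Bialgebra K H']

/-- The transport of a cobracket along an isomorphism of bialgebras. -/
def transportCobracket (φ : H ≃ₐc[K] H') (δ : H →ₗ[K] H ⊗[K] H) : H' →ₗ[K] H' ⊗[K] H' :=
  TensorProduct.map (φ : H →ₗ[K] H') (φ : H →ₗ[K] H') ∘ₗ δ ∘ₗ (φ.symm : H' →ₗ[K] H)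

theorem transportCobracket_apply (φ : H ≃ₐc[K] H') (δ : H →ₗ[K] H ⊗[K] H) (a : H) :
    transportCobracket φ δ (φ a) =
      TensorProduct.map (φ : H →ₗ[K] H') (φ : H →ₗ[K] H') (δ a) := by
  change TensorProduct.map (φ : H →ₗ[K] H') (φ : H →ₗ[K] H') (δ (φ.symm (φ a))) = _
  rw [BialgEquiv.symm_apply_apply]

theorem comul_bialgEquiv (φ : H ≃ₐc[K] H') (a : H) : Coalgebra.comul (R := K) (φ a) =
    TensorProduct.map (φ : H →ₗ[K] H') (φ : H →ₗ[K] H') (Coalgebra.comul a) :=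
  (CoalgHomClass.map_comp_comul_apply φ a).symm

/-- Every condition except that on the antipode is carried over by `φ`. The antipode condition
follows from generation by primitive elements, so `φ` need not be compared with the antipodes. -/
theorem isCoPoissonHopf_transportCobracket (φ : H ≃ₐc[K] H') {S : H →ₗ[K] H}
    {δ : H →ₗ[K] H ⊗[K] H} (h : IsCoPoissonHopf S δ) {S' : H' →ₗ[K] H'} (hS' : IsAntipode S')
    (hgen : Algebra.adjoin K (primitives K H') = ⊤) :
    IsCoPoissonHopf S' (transportCobracket φ δ) := by
  set f : H →ₗ[K] H' := (φ : H →ₗ[K] H') with hf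
  have hfφ : ∀ a, φ a = f a := fun a => rfl
  have hδ : ∀ a, transportCobracket φ δ (f a) = TensorProduct.map f f (δ a) :=
    transportCobracket_apply φ δ
  have hΔ : ∀ a, Coalgebra.comul (R := K) (f a) = TensorProduct.map f f (Coalgebra.comul a) :=
    comul_bialgEquiv φ
  have hsurj : Function.Surjective f := φ.surjective
  have hmulf : ∀ s t : H ⊗[K] H, TensorProduct.map f f (s * t) =
      TensorProduct.map f f s * TensorProduct.map f f t := fun s t =>
    map_mul (Algebra.TensorProduct.map (φ : H →ₐ[K] H') (φ : H →ₐ[K] H')) s t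
  have hassoc : ∀ (F : H →ₗ[K] H ⊗[K] H) (F' : H' →ₗ[K] H' ⊗[K] H'),
      (∀ a, F' (f a) = TensorProduct.map f f (F a)) → ∀ t,
      TensorProduct.map f (TensorProduct.map f f) (TensorProduct.assoc K H H H (F.rTensor H t)) =
        TensorProduct.assoc K H' H' H' (F'.rTensor H' (TensorProduct.map f f t)) := by
    intro F F' hF t
    induction t using TensorProduct.induction_on with
    | zero => simp
    | add s t hs ht => simp only [map_add, hs, ht]
    | tmul a b =>
      simp only [LinearMap.rTensor_tmul, TensorProduct.map_tmul, hF]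
      induction F a using TensorProduct.induction_on with
      | zero => simp
      | add s t hs ht => simp only [TensorProduct.add_tmul, map_add, hs, ht]
      | tmul x y => rfl
  have hlT : ∀ (F : H →ₗ[K] H ⊗[K] H) (F' : H' →ₗ[K] H' ⊗[K] H'),
      (∀ a, F' (f a) = TensorProduct.map f f (F a)) → ∀ t,
      TensorProduct.map f (TensorProduct.map f f) (F.lTensor H t) =
        F'.lTensor H' (TensorProduct.map f f t) := by
    intro F F' hF t
    induction t using TensorProduct.induction_on with
    | zero => simp
    | add s t hs ht => simp only [map_add, hs, ht]
    | tmul a b => simp only [LinearMap.lTensor_tmul, TensorProduct.map_tmul, hF]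
  have hcyc : ∀ t, TensorProduct.map (TensorProduct.map f f) f (cyclicPerm K H t) =
      cyclicPerm K H' (TensorProduct.map (TensorProduct.map f f) f t) := by
    have : TensorProduct.map (TensorProduct.map f f) f ∘ₗ cyclicPerm K H =
        cyclicPerm K H' ∘ₗ TensorProduct.map (TensorProduct.map f f) f :=
      TensorProduct.ext_threefold fun a b c => rfl
    exact LinearMap.congr_fun this
  have hleft : ∀ t, TensorProduct.map f (TensorProduct.map f f) (TensorProduct.leftComm K H H H t) =
      TensorProduct.leftComm K H' H' H' (TensorProduct.map f (TensorProduct.map f f) t) := by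
    have : TensorProduct.map f (TensorProduct.map f f) ∘ₗ
        (TensorProduct.leftComm K H H H).toLinearMap =
        (TensorProduct.leftComm K H' H' H').toLinearMap ∘ₗ
          TensorProduct.map f (TensorProduct.map f f) := by
      ext a b c; rfl
    exact LinearMap.congr_fun this
  refine isCoPoissonHopf_of_primitives (fun a b => ?_) hS' ⟨LinearMap.ext fun a => ?_⟩
    ⟨?_, fun a => ?_⟩ (fun a => ?_) hgen
  · obtain ⟨a, rfl⟩ := hsurj a
    obtain ⟨b, rfl⟩ := hsurj b
    rw [← hfφ, ← hfφ, ← map_mul, hfφ, hfφ, hfφ, hδ, hδ, hδ, hΔ, hΔ, h.cobracket_mul, map_add,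
      hmulf, hmulf]
  · obtain ⟨a, rfl⟩ := hsurj a
    have := LinearMap.congr_fun h.cocomm.comm_comp_comul a
    simp only [LinearMap.comp_apply, LinearEquiv.coe_coe] at this ⊢
    rw [hΔ, ← TensorProduct.map_comm, this]
  · rintro _ ⟨a, rfl⟩
    obtain ⟨a, rfl⟩ := hsurj a
    obtain ⟨t, ht⟩ := h.isLieCobracket.alternating ⟨a, rfl⟩
    refine ⟨TensorProduct.map f f t, ?_⟩
    rw [hδ, ← ht, LinearMap.sub_apply, LinearMap.sub_apply, map_sub, LinearMap.id_apply,
      LinearMap.id_apply, LinearEquiv.coe_coe, LinearEquiv.coe_coe, TensorProduct.map_comm]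
  · obtain ⟨a, rfl⟩ := hsurj a
    have hr : ∀ t, (transportCobracket φ δ).rTensor H' (TensorProduct.map f f t) =
        TensorProduct.map (TensorProduct.map f f) f (δ.rTensor H t) := fun t => by
      induction t using TensorProduct.induction_on with
      | zero => simp
      | add s t hs ht => simp only [map_add, hs, ht]
      | tmul a b => simp only [LinearMap.rTensor_tmul, TensorProduct.map_tmul, hδ]
    rw [hδ, hr, ← hcyc, ← hcyc, ← map_add, ← map_add, h.isLieCobracket.coJacobi, map_zero]
  · obtain ⟨a, rfl⟩ := hsurj a
    rw [hδ, hΔ, ← hassoc _ _ hδ, ← hlT _ _ hΔ, ← hlT _ _ hδ, ← hleft, h.coLeibniz, map_add]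

end Transport

/-! ### The induced grading of the enveloping algebra. -/

section EnvelopingGrading

variable {K : Type u} [Field K] {p : ℕ} {g : Type v} [LieRing g] [LieAlgebra K g]
  (𝔤 : RestrictedLieStructure K p g)

theorem adjoin_primitives_enveloping [CharP K p] :
    Algebra.adjoin K (primitives K (Enveloping 𝔤)) = ⊤ := by
  rw [eq_top_iff]
  intro a _
  induction a using Enveloping.induction_on with
  | halg c => exact Subalgebra.algebraMap_mem _ c
  | hι x => exact Algebra.subset_adjoin (Enveloping.comul_ι 𝔤 x)
  | hmul a b ha hb => exact mul_mem (ha trivial) (hb trivial)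
  | hadd a b ha hb => exact add_mem (ha trivial) (hb trivial)

theorem iSup_degreePart {𝓛 : ℤ → Submodule K g} (h𝓛 : ⨆ n, 𝓛 n = ⊤) :
    ⨆ n, Enveloping.degreePart 𝔤 𝓛 n = ⊤ := by
  have hmul : ∀ m n, Enveloping.degreePart 𝔤 𝓛 m * Enveloping.degreePart 𝔤 𝓛 n ≤
      Enveloping.degreePart 𝔤 𝓛 (m + n) := by
    intro m n
    rw [Enveloping.degreePart, Enveloping.degreePart, Submodule.span_mul_span]
    refine Submodule.span_le.2 ?_
    rintro _ ⟨_, ⟨l, hl, rfl, rfl⟩, _, ⟨l', hl', rfl, rfl⟩, rfl⟩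
    refine Submodule.subset_span ⟨l ++ l', fun q hq => ?_, by simp, by simp⟩
    rcases List.mem_append.1 hq with h | h
    · exact hl q h
    · exact hl' q h
  rw [eq_top_iff]
  intro a _
  induction a using Enveloping.induction_on with
  | halg c =>
    rw [Algebra.algebraMap_eq_smul_one]
    exact Submodule.smul_mem _ c (Submodule.mem_iSup_of_mem 0
      (Submodule.subset_span ⟨[], by simp, by simp, by simp⟩))
  | hι x =>
    have hx : x ∈ ⨆ n, 𝓛 n := by rw [h𝓛]; trivial
    have hle : ⨆ n, 𝓛 n ≤ (⨆ n, Enveloping.degreePart 𝔤 𝓛 n).comap (Enveloping.ι 𝔤) :=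
      iSup_le fun n x hx => Submodule.mem_iSup_of_mem n
        (Submodule.subset_span ⟨[(n, x)], by simpa using hx, by simp, by simp⟩)
    exact hle hx
  | hmul a b ha hb =>
    have := Submodule.mul_mem_mul (ha trivial) (hb trivial)
    rw [Submodule.iSup_mul] at this
    refine (iSup_le fun m => ?_ : _ ≤ ⨆ n, Enveloping.degreePart 𝔤 𝓛 n) this
    rw [Submodule.mul_iSup]
    exact iSup_le fun n => (hmul m n).trans (le_iSup (Enveloping.degreePart 𝔤 𝓛) (m + n))
  | hadd a b ha hb => exact add_mem (ha trivial) (hb trivial)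

variable {H : Type w} [Ring H] [Bialgebra K H] {𝒜 : ℤ → Submodule K H}

/-- The inverse of `φ` respects degrees by multiplicativity. For the converse it suffices that the
degree parts span `𝒰(g)`: the projection of `H` onto `𝒜_n`, transported by `φ`, maps each of them
into the one of degree `n`, and it fixes `φ(a)` for `a ∈ 𝒜_n`. -/
theorem mem_iff_mem_degreePart (h𝒜 : IsConnectedGrading 𝒜) {𝓛 : ℤ → Submodule K g}
    (h𝓛 : ⨆ n, 𝓛 n = ⊤) (φ : H ≃ₐ[K] Enveloping 𝔤)
    (hφ : ∀ n, ∀ x ∈ 𝓛 n, φ.symm (Enveloping.ι 𝔤 x) ∈ 𝒜 n) (n : ℤ) (a : H) :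
    a ∈ 𝒜 n ↔ φ a ∈ Enveloping.degreePart 𝔤 𝓛 n := by
  obtain ⟨π, hπ⟩ := exists_projections h𝒜.isInternal
  have hle : ∀ m, ∀ b ∈ Enveloping.degreePart 𝔤 𝓛 m, φ.symm b ∈ 𝒜 m := by
    intro m b hb
    induction hb using Submodule.span_induction with
    | zero => rw [map_zero]; exact zero_mem _
    | add b c _ _ hb hc => rw [map_add]; exact add_mem hb hc
    | smul c b _ hb => rw [map_smul]; exact Submodule.smul_mem _ c hb
    | mem b hb =>
      obtain ⟨l, hl, rfl, rfl⟩ := hb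
      induction l with
      | nil => simpa using h𝒜.one_mem
      | cons q l ih =>
        simp only [List.map_cons, List.prod_cons, map_mul, List.sum_cons]
        exact h𝒜.mul_mem (hφ _ _ (hl q (by simp))) (ih fun q hq => hl q (by simp [hq]))
  refine ⟨fun ha => ?_, fun ha => ?_⟩
  · have key : (⊤ : Submodule K (Enveloping 𝔤)) ≤ (Enveloping.degreePart 𝔤 𝓛 n).comap
        (φ.toLinearMap ∘ₗ π n ∘ₗ φ.symm.toLinearMap) := by
      rw [← iSup_degreePart 𝔤 h𝓛]
      refine iSup_le fun m b hb => ?_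
      rw [Submodule.mem_comap]
      change φ (π n (φ.symm b)) ∈ _
      rw [hπ m n _ (hle m b hb)]
      split_ifs with hmn
      · rw [AlgEquiv.apply_symm_apply, ← hmn]; exact hb
      · rw [map_zero]; exact zero_mem _
    have h1 : φ (π n (φ.symm (φ a))) ∈ Enveloping.degreePart 𝔤 𝓛 n :=
      key (Submodule.mem_top (x := φ a))
    rwa [AlgEquiv.symm_apply_apply, hπ n n a ha, if_pos rfl] at h1
  · have := hle n _ ha
    rwa [AlgEquiv.symm_apply_apply] at this

end EnvelopingGrading

/-! ### Independence of reduced monomials, for products of lists. -/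

section MonomialIndependence

variable {K : Type u} [Field K]

-- A reformulation of `eq_zero_of_aeval_eq_zero` for a ring that is only proved to be commutative,
-- with monomials written as products of lists, the form in which words of the enveloping algebra
-- produce them.
open MvPolynomial in
theorem sum_monomials_eq_zero {G : Type v} [Ring G] [Bialgebra K G] {I : Type w}
    (hc : ∀ a b : G, a * b = b * a) {x : I → G} (hx : ∀ i, Coalgebra.counit (R := K) (x i) = 0)
    {d : I → G →ₗ[K] K} (hd : ∀ i a b, d i (a * b) =
      Coalgebra.counit (R := K) a * d i b + d i a * Coalgebra.counit (R := K) b)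
    (hdx : ∀ i j, d i (x j) = Finsupp.single j (1 : K) i) (c : (I →₀ ℕ) →₀ K)
    (hred : ∀ a ∈ c.support, ∀ i, ((a i).factorial : K) ≠ 0)
    (h : ∑ a ∈ c.support, c a • ((Finsupp.toMultiset a).toList.map x).prod = 0) : c = 0 := by
  classical
  let _ : CommRing G := { (inferInstance : Ring G) with mul_comm := hc }
  set f : MvPolynomial I K := ∑ a ∈ c.support, monomial a (c a) with hf
  have hcoeff : ∀ a, coeff a f = c a := by
    intro a
    rw [hf, coeff_sum]
    simp only [coeff_monomial]
    rw [Finset.sum_ite_eq']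
    split_ifs with ha
    · rfl
    · exact (Finsupp.notMem_support_iff.1 ha).symm
  have h0 : f = 0 := by
    refine eq_zero_of_aeval_eq_zero (x := x) (d := d) hx hd hdx (fun a ha => hred a ?_) ?_
    · rw [hcoeff] at ha
      exact Finsupp.mem_support_iff.2 ha
    · rw [hf, map_sum, ← h]
      refine Finset.sum_congr rfl fun a _ => ?_
      rw [aeval_monomial, ← Algebra.smul_def, ← Multiset.prod_coe, ← Multiset.map_coe,
        Multiset.coe_toList, Finsupp.prod]
      congr 1
      rw [Finsupp.toMultiset_map, Finsupp.prod_toMultiset, Finsupp.prod_mapDomain_index]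
      · rfl
      · exact fun _ => pow_zero _
      · exact fun _ _ _ => pow_add _ _ _
  ext a
  rw [← hcoeff, h0, coeff_zero, Finsupp.zero_apply]

end MonomialIndependence

/-! ### Spanning by standard monomials. -/

section EnvelopingSpan

variable {K : Type u} [Field K] {p : ℕ} {g : Type v} [LieRing g] [LieAlgebra K g]
  (𝔤 : RestrictedLieStructure K p g) {I : Type w} (b : Module.Basis I K g)

/-- The subspace `K + g` of `𝒰(g)`. -/
def envelopingOne : Submodule K (Enveloping 𝔤) := 1 ⊔ LinearMap.range (Enveloping.ι 𝔤)

theorem ι_mem_envelopingOne (x : g) : Enveloping.ι 𝔤 x ∈ envelopingOne 𝔤 :=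
  Submodule.mem_sup_right ⟨x, rfl⟩

theorem envelopingOne_pow_mono {m n : ℕ} (h : m ≤ n) : envelopingOne 𝔤 ^ m ≤ envelopingOne 𝔤 ^ n :=
  pow_le_pow_right₀ (le_sup_left : (1 : Submodule K (Enveloping 𝔤)) ≤ _) h

theorem exists_mem_envelopingOne_pow (u : Enveloping 𝔤) : ∃ n, u ∈ envelopingOne 𝔤 ^ n := by
  induction u using Enveloping.induction_on with
  | halg c =>
    refine ⟨0, ?_⟩
    rw [pow_zero]
    exact Submodule.algebraMap_mem c
  | hι x => exact ⟨1, by rw [pow_one]; exact ι_mem_envelopingOne 𝔤 x⟩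
  | hmul a b ha hb =>
    obtain ⟨m, ha⟩ := ha
    obtain ⟨n, hb⟩ := hb
    exact ⟨m + n, by rw [pow_add]; exact Submodule.mul_mem_mul ha hb⟩
  | hadd a b ha hb =>
    obtain ⟨m, ha⟩ := ha
    obtain ⟨n, hb⟩ := hb
    exact ⟨max m n, add_mem (envelopingOne_pow_mono 𝔤 (le_max_left m n) ha)
      (envelopingOne_pow_mono 𝔤 (le_max_right m n) hb)⟩

variable {𝔤} in
/-- The product in `𝒰(g)` of a list of basis elements of `g`. -/
def envelopingWord (l : List I) : Enveloping 𝔤 := (l.map fun i => Enveloping.ι 𝔤 (b i)).prod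

theorem envelopingWord_cons (i : I) (l : List I) :
    envelopingWord (𝔤 := 𝔤) b (i :: l) = Enveloping.ι 𝔤 (b i) * envelopingWord b l := by
  rw [envelopingWord, List.map_cons, List.prod_cons, envelopingWord]

theorem envelopingWord_append (l l' : List I) : envelopingWord (𝔤 := 𝔤) b (l ++ l') =
    envelopingWord b l * envelopingWord b l' := by
  rw [envelopingWord, List.map_append, List.prod_append, envelopingWord, envelopingWord]

theorem envelopingWord_mem (l : List I) :
    envelopingWord (𝔤 := 𝔤) b l ∈ envelopingOne 𝔤 ^ l.length := by
  induction l with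
  | nil => rw [List.length_nil, pow_zero]; exact Submodule.one_le.1 le_rfl
  | cons i l ih =>
    rw [envelopingWord_cons, List.length_cons, pow_succ']
    exact Submodule.mul_mem_mul (ι_mem_envelopingOne 𝔤 _) ih

/-- Exchanging two neighbouring letters changes the word by one in which both are replaced by their
bracket, and this is shorter by one letter. -/
theorem envelopingWord_sub_mem_of_perm {l l' : List I} (h : l.Perm l') :
    ∀ n, l.length ≤ n + 1 →
      envelopingWord (𝔤 := 𝔤) b l - envelopingWord b l' ∈ envelopingOne 𝔤 ^ n := by
  induction h with
  | nil => intro n _; rw [sub_self]; exact zero_mem _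
  | @cons i l l' h ih =>
    intro n hn
    rw [envelopingWord_cons, envelopingWord_cons, ← mul_sub]
    cases n with
    | zero =>
      obtain rfl : l = [] := List.length_eq_zero_iff.1 (by simpa using hn)
      obtain rfl : l' = [] := h.nil_eq.symm
      rw [sub_self, mul_zero]; exact zero_mem _
    | succ n =>
      rw [pow_succ']
      exact Submodule.mul_mem_mul (ι_mem_envelopingOne 𝔤 _) (ih n (by simpa using hn))
  | swap i j l =>
    intro n hn
    simp only [envelopingWord_cons, ← mul_assoc]
    rw [← sub_mul, ← Enveloping.ι_lie]
    cases n with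
    | zero => simp at hn
    | succ n =>
      rw [pow_succ']
      exact Submodule.mul_mem_mul (ι_mem_envelopingOne 𝔤 _)
        (envelopingOne_pow_mono 𝔤 (by simpa using hn) (envelopingWord_mem 𝔤 b l))
  | @trans l₁ l₂ l₃ h h' ih ih' =>
    intro n hn
    have := add_mem (ih n hn) (ih' n (by rw [← h.length_eq]; exact hn))
    rwa [sub_add_sub_cancel] at this

/-- Collect `p` copies of the letter at the front, up to shorter words; the relation `x^p = x^[p]`
then replaces `p ≥ 2` letters by one element of `g`. -/
theorem envelopingWord_mem_of_le_count [DecidableEq I] (hp : 2 ≤ p) {l : List I} {i : I}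
    (hi : p ≤ l.count i) {n : ℕ} (hn : l.length = n + 1) :
    envelopingWord (𝔤 := 𝔤) b l ∈ envelopingOne 𝔤 ^ n := by
  obtain ⟨l', hl'⟩ := (List.replicate_sublist_iff.2 hi).exists_perm_append
  have h1 := envelopingWord_sub_mem_of_perm 𝔤 b hl' n hn.le
  have h2 : envelopingWord (𝔤 := 𝔤) b (List.replicate p i ++ l') ∈ envelopingOne 𝔤 ^ n := by
    have h3 : envelopingWord (𝔤 := 𝔤) b (List.replicate p i) =
        Enveloping.ι 𝔤 (𝔤.pMap (b i)) := by
      rw [envelopingWord, List.map_replicate, List.prod_replicate, Enveloping.ι_pow 𝔤 (by omega)]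
    have h4 := hl'.length_eq
    rw [List.length_append, List.length_replicate] at h4
    rw [envelopingWord_append, h3]
    refine envelopingOne_pow_mono 𝔤 (show l'.length + 1 ≤ n by omega) ?_
    rw [pow_succ']
    exact Submodule.mul_mem_mul (ι_mem_envelopingOne 𝔤 _) (envelopingWord_mem 𝔤 b l')
  have := add_mem h1 h2
  rwa [sub_add_cancel] at this

theorem envelopingOne_eq : envelopingOne 𝔤 =
    1 ⊔ Submodule.span K (Set.range fun i => Enveloping.ι 𝔤 (b i)) := by
  rw [envelopingOne, LinearMap.range_eq_map, ← b.span_eq, Submodule.map_span, ← Set.range_comp]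
  rfl

theorem envelopingOne_pow_succ_le_span_words (n : ℕ) : envelopingOne 𝔤 ^ (n + 1) ≤
    Submodule.span K (envelopingWord b '' {l : List I | l.length = n + 1}) ⊔
      envelopingOne 𝔤 ^ n := by
  induction n with
  | zero =>
    rw [zero_add, pow_one, pow_zero, envelopingOne_eq 𝔤 b, sup_comm]
    refine sup_le_sup_right (Submodule.span_mono ?_) _
    rintro _ ⟨i, rfl⟩
    exact ⟨[i], rfl, by simp [envelopingWord]⟩
  | succ n ih =>
    have hV : envelopingOne 𝔤 ^ (n + 1 + 1) = envelopingOne 𝔤 ^ (n + 1) ⊔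
        Submodule.span K (Set.range fun i => Enveloping.ι 𝔤 (b i)) * envelopingOne 𝔤 ^ (n + 1) := by
      rw [pow_succ' _ (n + 1)]
      nth_rewrite 1 [envelopingOne_eq 𝔤 b]
      rw [Submodule.sup_mul, one_mul]
    rw [hV]
    refine sup_le le_sup_right ((mul_le_mul_right ih _).trans ?_)
    rw [Submodule.mul_sup, Submodule.span_mul_span]
    refine sup_le_sup (Submodule.span_mono ?_) ?_
    · rintro _ ⟨_, ⟨i, rfl⟩, _, ⟨l, hl, rfl⟩, rfl⟩
      exact ⟨i :: l, by simpa using hl, envelopingWord_cons 𝔤 b i l⟩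
    · rw [pow_succ']
      refine mul_le_mul_left (Submodule.span_le.2 ?_) _
      rintro _ ⟨i, rfl⟩
      exact ι_mem_envelopingOne 𝔤 _

variable [CharP K p]

/-- The standard monomials with reduced exponents span the enveloping algebra. -/
theorem envelopingOne_pow_succ_le_span_monomials (n : ℕ) : envelopingOne 𝔤 ^ (n + 1) ≤
    Submodule.span K ((fun a : I →₀ ℕ => envelopingWord b (Finsupp.toMultiset a).toList) ''
      {a | (∀ i, ((a i).factorial : K) ≠ 0) ∧ (Finsupp.toMultiset a).card = n + 1}) ⊔
      envelopingOne 𝔤 ^ n := by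
  classical
  refine (envelopingOne_pow_succ_le_span_words 𝔤 b n).trans (sup_le ?_ le_sup_right)
  refine Submodule.span_le.2 ?_
  rintro _ ⟨l, hl, rfl⟩
  set a := Multiset.toFinsupp (l : Multiset I) with ha
  have ha' : Finsupp.toMultiset a = (l : Multiset I) := Multiset.toFinsupp_toMultiset _
  by_cases h : ∀ i, ((a i).factorial : K) ≠ 0
  · have hperm : l.Perm (Finsupp.toMultiset a).toList := by
      rw [← Multiset.coe_eq_coe, Multiset.coe_toList, ha']
    have h1 := envelopingWord_sub_mem_of_perm 𝔤 b hperm n (le_of_eq hl)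
    have h2 : envelopingWord (𝔤 := 𝔤) b (Finsupp.toMultiset a).toList ∈ Submodule.span K
        ((fun a : I →₀ ℕ => envelopingWord b (Finsupp.toMultiset a).toList) ''
          {a | (∀ i, ((a i).factorial : K) ≠ 0) ∧ (Finsupp.toMultiset a).card = n + 1}) :=
      Submodule.subset_span ⟨a, ⟨h, by rw [ha', Multiset.coe_card]; exact hl⟩, rfl⟩
    have := add_mem (Submodule.mem_sup_left (T := envelopingOne 𝔤 ^ n) h2)
      (Submodule.mem_sup_right h1)
    rwa [add_sub_cancel] at this
  -- A factorial that vanishes in `K` forces positive characteristic `p` and a letter of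
  -- multiplicity at least `p`, so the word can be shortened.
  · push Not at h
    obtain ⟨i, hi⟩ := h
    have hp0 : p ≠ 0 := by
      rintro rfl
      have := CharP.charP_to_charZero K
      exact Nat.factorial_ne_zero _ (Nat.cast_eq_zero.1 hi)
    have hp := (CharP.char_is_prime_or_zero K p).resolve_right hp0
    rw [CharP.cast_eq_zero_iff K p, hp.dvd_factorial, ha, Multiset.toFinsupp_apply,
      Multiset.coe_count] at hi
    exact Submodule.mem_sup_right (envelopingWord_mem_of_le_count 𝔤 b hp.two_le hi hl)

end EnvelopingSpan

/-! ### Bialgebras generated by primitive elements. -/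

section EnvelopingPrimitives

variable {K : Type u} [Field K] (p : ℕ) [CharP K p] (H : Type v) [Ring H] [Bialgebra K H]

/-- The canonical map `𝒰(P(H)) → H`. -/
def envelopingToHopf : Enveloping (primitiveRestricted K H p) →ₐ[K] H :=
  Enveloping.lift (primitiveSubmodule K H).subtype coe_lie
    fun hp x => (coe_primitivePMap p hp x).symm

theorem envelopingToHopf_ι (x : primitiveSubmodule K H) :
    envelopingToHopf p H (Enveloping.ι (primitiveRestricted K H p) x) = x :=
  Enveloping.lift_ι _ _ _ x

variable {H}

theorem mem_deltaFiltration_one_of_primitive {x : H} (hx : x ∈ primitives K H) :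
    x ∈ deltaFiltration K H 1 := by
  rw [mem_deltaFiltration_iff zero_le_one, comulSubTmulOne_apply, mem_primitives.1 hx,
    add_sub_cancel_left, sub_self]
  exact tmul_mem_tensorSub one_mem_deltaFiltration trivial

theorem envelopingToHopf_mem_deltaFiltration (n : ℕ) :
    ∀ u ∈ envelopingOne (primitiveRestricted K H p) ^ n,
      envelopingToHopf p H u ∈ deltaFiltration K H n := by
  have h1 : ∀ u ∈ envelopingOne (primitiveRestricted K H p),
      envelopingToHopf p H u ∈ deltaFiltration K H 1 := by
    intro u hu
    obtain ⟨c, hc, _, ⟨x, rfl⟩, rfl⟩ := Submodule.mem_sup.1 hu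
    obtain ⟨c, rfl⟩ := Submodule.mem_one.1 hc
    rw [map_add, AlgHom.commutes, envelopingToHopf_ι, Algebra.algebraMap_eq_smul_one]
    exact add_mem (Submodule.smul_mem _ c
      (deltaFiltration_monotone zero_le_one one_mem_deltaFiltration))
      (mem_deltaFiltration_one_of_primitive (mem_primitiveSubmodule.1 x.2))
  induction n with
  | zero =>
    intro u hu
    rw [pow_zero] at hu
    obtain ⟨c, rfl⟩ := Submodule.mem_one.1 hu
    rw [AlgHom.commutes, Algebra.algebraMap_eq_smul_one]
    exact Submodule.smul_mem _ c one_mem_deltaFiltration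
  | succ n ih =>
    intro u hu
    rw [pow_succ] at hu
    induction hu using Submodule.mul_induction_on' with
    | add u _ v _ hu hv => rw [map_add]; exact add_mem hu hv
    | mem_mul_mem u hu v hv =>
      rw [map_mul, Nat.cast_succ]
      exact mul_mem_deltaFiltration (ih u hu) (h1 v hv)

/-- The class of degree one of a primitive element in the graded algebra of the
`δ_•`-filtration. -/
def primitiveSymbol (x : primitiveSubmodule K H) : AssocGraded (deltaFiltration K H) :=
  AssocGraded.symbol (deltaFiltration K H) 1
    ⟨x, mem_deltaFiltration_one_of_primitive (mem_primitiveSubmodule.1 x.2)⟩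

theorem symbol_envelopingWord {I : Type w} (b : Module.Basis I K (primitiveSubmodule K H))
    (l : List I) : ∀ h : envelopingToHopf p H (envelopingWord b l) ∈ deltaFiltration K H l.length,
      AssocGraded.symbol (deltaFiltration K H) l.length ⟨_, h⟩ =
        (l.map fun i => primitiveSymbol (b i)).prod := by
  induction l with
  | nil =>
    intro h
    rw [List.map_nil, List.prod_nil, AssocGraded.one_def]
    exact AssocGraded.symbol_congr (by simp) _ _ (by simp [envelopingWord])
  | cons i l ih =>
    intro h
    have h1 := envelopingToHopf_mem_deltaFiltration p _ _
      (envelopingWord_mem (primitiveRestricted K H p) b l)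
    rw [List.map_cons, List.prod_cons, ← ih h1, primitiveSymbol, AssocGraded.symbol_mul_symbol]
    refine AssocGraded.symbol_congr ?_ _ _ ?_
    · rw [List.length_cons]; push_cast; ring
    · rw [envelopingWord_cons, map_mul, envelopingToHopf_ι]

variable (H) in
/-- The linear form on the graded algebra of the `δ_•`-filtration which is induced in degree one
by a linear form on `H` that vanishes at `1`. -/
def degreeOneForm (f : H →ₗ[K] K) (hf : f 1 = 0) : AssocGraded (deltaFiltration K H) →ₗ[K] K :=
  AssocGraded.lift (fun z => if z = 1 then f.comp (deltaFiltration K H z).subtype else 0)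
    fun z x hx => by
      split_ifs with hz
      · subst hz
        rw [sub_self, deltaFiltration_zero] at hx
        obtain ⟨c, hc⟩ := Submodule.mem_span_singleton.1 hx
        rw [LinearMap.comp_apply, Submodule.subtype_apply, ← hc, map_smul, hf, smul_zero]
      · rfl

theorem degreeOneForm_symbol (f : H →ₗ[K] K) (hf : f 1 = 0) (z : ℤ) (x : deltaFiltration K H z) :
    degreeOneForm H f hf (AssocGraded.symbol _ z x) = if z = 1 then f x else 0 := by
  rw [degreeOneForm, AssocGraded.lift_symbol]; split_ifs <;> rfl

/-- The degree one part of a product only involves the bidegrees `(0, 1)` and `(1, 0)`, and the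
factor of degree `0` is a scalar, given by the counit. So these forms are the point derivations that
the independence result needs. -/
theorem degreeOneForm_mul (f : H →ₗ[K] K) (hf : f 1 = 0)
    (a b : AssocGraded (deltaFiltration K H)) : degreeOneForm H f hf (a * b) =
      Coalgebra.counit (R := K) a * degreeOneForm H f hf b +
        degreeOneForm H f hf a * Coalgebra.counit (R := K) b := by
  induction a using AssocGraded.induction_on with
  | hadd a a' h h' => simp only [add_mul, map_add, h, h']; ring
  | h m x =>
  induction b using AssocGraded.induction_on with
  | hadd a a' h h' => simp only [mul_add, map_add, h, h']; ring
  | h n y =>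
    rw [AssocGraded.symbol_mul_symbol, degreeOneForm_symbol, degreeOneForm_symbol,
      degreeOneForm_symbol, AssocGraded.counit_symbol, AssocGraded.counit_symbol]
    have hscal : ∀ w ∈ deltaFiltration K H 0, w = algebraMap K H (Coalgebra.counit w) := by
      intro w hw
      rw [deltaFiltration_zero] at hw
      obtain ⟨c, rfl⟩ := Submodule.mem_span_singleton.1 hw
      simp [Algebra.algebraMap_eq_smul_one]
    have hneg : ∀ z < 0, ∀ w ∈ deltaFiltration K H z, w = 0 := fun z hz w hw => by
      rw [deltaFiltration_of_neg hz] at hw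
      exact (Submodule.mem_bot K).1 hw
    obtain ⟨x, hx⟩ := x
    obtain ⟨y, hy⟩ := y
    simp only
    rcases lt_trichotomy m 0 with hm | rfl | hm
    · rw [hneg m hm x hx]; simp
    · have hxs := hscal x hx
      rw [if_neg zero_ne_one, zero_mul, add_zero, if_pos rfl, zero_add]
      split_ifs
      · nth_rewrite 1 [hxs]
        rw [← Algebra.smul_def, map_smul, smul_eq_mul]
      · rw [mul_zero]
    · rw [if_neg hm.ne', zero_mul, zero_add]
      rcases lt_trichotomy n 0 with hn | rfl | hn
      · rw [hneg n hn y hy]; simp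
      · have hys := hscal y hy
        rw [if_pos rfl, add_zero]
        split_ifs
        · nth_rewrite 1 [hys]
          rw [← Algebra.commutes, ← Algebra.smul_def, map_smul, smul_eq_mul, mul_comm]
        · rw [zero_mul]
      · rw [if_neg (by omega), if_neg hn.ne', mul_zero]

/-- Let `u` of order `n + 1` be in the kernel and write it as a combination of reduced standard
monomials of length `n + 1` plus a term `w` of order `n`. In degree `n + 1` of the graded algebra of
the δ_•-filtration of `H`, the symbols of the images of these monomials are reduced monomials in the
degree one classes of a basis of `P`. They are independent, so the leading part is zero and `u` has
order `n`. Descending to order `0` leaves a scalar, which the map to `H` detects. -/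
theorem envelopingToHopf_injective : Function.Injective (envelopingToHopf (K := K) p H) := by
  classical
  rw [injective_iff_map_eq_zero]
  let b := Module.Basis.ofVectorSpace K (primitiveSubmodule K H)
  have hstep : ∀ n : ℕ, ∀ u ∈ envelopingOne (primitiveRestricted K H p) ^ (n + 1),
      envelopingToHopf p H u = 0 → u ∈ envelopingOne (primitiveRestricted K H p) ^ n := by
    intro n u hu h0
    obtain ⟨v, hv, w, hw, rfl⟩ :=
      Submodule.mem_sup.1 (envelopingOne_pow_succ_le_span_monomials _ b n hu)
    obtain ⟨c, hc, rfl⟩ := (Finsupp.mem_span_image_iff_linearCombination K).1 hv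
    suffices c = 0 by rw [this, map_zero, zero_add]; exact hw
    have hcs : ∀ a ∈ c.support, (∀ i, ((a i).factorial : K) ≠ 0) ∧
        (Finsupp.toMultiset a).card = n + 1 := fun a ha =>
      (Finsupp.mem_supported K c).1 hc ha
    -- Coordinates on `P`, extended to `H` by a retraction; composing with `id - uε` makes them
    -- vanish at `1` without changing them on `P`.
    let f : _ → H →ₗ[K] K := fun i => b.coord i ∘ₗ primitiveRetraction K H ∘ₗ augProj K H
    have hf : ∀ i, f i 1 = 0 := fun i => by simp [f, augProj_apply]
    refine sum_monomials_eq_zero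
      (AssocGraded.mul_comm_of_commutator_mem (F := deltaFiltration K H)
        commutator_mem_deltaFiltration)
      (x := fun i => primitiveSymbol (b i)) (d := fun i => degreeOneForm H (f i) (hf i))
      (fun i => ?_) (fun i => degreeOneForm_mul (f i) (hf i)) (fun i j => ?_) c
      (fun a ha => (hcs a ha).1) ?_
    · rw [primitiveSymbol, AssocGraded.counit_symbol, if_neg one_ne_zero]
    · rw [primitiveSymbol, degreeOneForm_symbol, if_pos rfl]
      have h1 : augProj K H (b j : H) = b j := by
        rw [augProj_apply, counit_of_mem_primitives (mem_primitiveSubmodule.1 (b j).2), map_zero,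
          sub_zero]
      simp only [f, LinearMap.comp_apply, h1, primitiveRetraction_coe, Module.Basis.coord_apply,
        Module.Basis.repr_self]
    · have hmem : ∀ a ∈ c.support, envelopingToHopf p H
          (envelopingWord b (Finsupp.toMultiset a).toList) ∈
            deltaFiltration K H ((n + 1 : ℕ) : ℤ) := fun a ha => by
        have := envelopingToHopf_mem_deltaFiltration p _ _
          (envelopingWord_mem (primitiveRestricted K H p) b (Finsupp.toMultiset a).toList)
        rwa [Multiset.length_toList, (hcs a ha).2] at this
      have hsym : ∀ a (ha : a ∈ c.support),
          ((Finsupp.toMultiset a).toList.map fun i => primitiveSymbol (b i)).prod =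
            AssocGraded.symbol (deltaFiltration K H) ((n + 1 : ℕ) : ℤ) ⟨_, hmem a ha⟩ := by
        intro a ha
        have h1 := envelopingToHopf_mem_deltaFiltration p _ _
          (envelopingWord_mem (primitiveRestricted K H p) b (Finsupp.toMultiset a).toList)
        rw [← symbol_envelopingWord p b _ h1]
        exact AssocGraded.symbol_congr (by rw [Multiset.length_toList, (hcs a ha).2]) _ _ rfl
      rw [← Finset.sum_attach, Finset.sum_congr rfl fun a _ => by rw [hsym a.1 a.2, ← map_smul],
        ← map_sum]
      -- The combination of symbols vanishes because the corresponding element of `H` is minus the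
      -- image of `w`, which already lies in `D_n`.
      refine (AssocGraded.symbol_eq_zero_iff _).2 ?_
      rw [map_add, Finsupp.linearCombination_apply, Finsupp.sum, map_sum] at h0
      have h2 : ((∑ a ∈ c.support.attach, c a.1 • (⟨_, hmem a.1 a.2⟩ :
          deltaFiltration K H ((n + 1 : ℕ) : ℤ)) : deltaFiltration K H ((n + 1 : ℕ) : ℤ)) : H) =
          -envelopingToHopf p H w := by
        rw [← eq_neg_iff_add_eq_zero.2 h0, Submodule.coe_sum, ← Finset.sum_attach c.support]
        exact Finset.sum_congr rfl fun a _ => by rw [map_smul]; rfl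
      rw [h2, Nat.cast_succ, add_sub_cancel_right]
      exact neg_mem (envelopingToHopf_mem_deltaFiltration p n w hw)
  have hzero : ∀ n : ℕ, ∀ u ∈ envelopingOne (primitiveRestricted K H p) ^ n,
      envelopingToHopf p H u = 0 → u = 0 := by
    intro n
    induction n with
    | zero =>
      intro u hu h0
      rw [pow_zero] at hu
      obtain ⟨c, rfl⟩ := Submodule.mem_one.1 hu
      have := nontrivial_of_bialgebra K H
      rw [AlgHom.commutes, map_eq_zero_iff _ (algebraMap K H).injective] at h0
      rw [h0, map_zero]
    | succ n ih => exact fun u hu h0 => ih u (hstep n u hu h0) h0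
  intro u hu
  obtain ⟨n, hn⟩ := exists_mem_envelopingOne_pow _ u
  exact hzero n u hn hu

variable (H) in
/-- The map from the enveloping algebra of the primitive elements, as a map of bialgebras. -/
def envelopingToHopfBialgHom : Enveloping (primitiveRestricted K H p) →ₐc[K] H :=
  BialgHom.ofAlgHom (envelopingToHopf p H)
    (Enveloping.hom_ext fun x => by
      simp [envelopingToHopf_ι, counit_of_mem_primitives (mem_primitiveSubmodule.1 x.2)])
    (Enveloping.hom_ext fun x => by
      simp [envelopingToHopf_ι, mem_primitives.1 (mem_primitiveSubmodule.1 x.2)])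

theorem envelopingToHopf_bijective (hgen : Algebra.adjoin K (primitives K H) = ⊤) :
    Function.Bijective (envelopingToHopf (K := K) p H) := by
  refine ⟨envelopingToHopf_injective p, ?_⟩
  have h : Algebra.adjoin K (primitives K H) ≤ (envelopingToHopf p H).range := by
    refine Algebra.adjoin_le fun x hx => ?_
    exact ⟨Enveloping.ι _ ⟨x, mem_primitiveSubmodule.2 hx⟩, envelopingToHopf_ι p H _⟩
  rw [hgen] at h
  exact fun x => h trivial

/-- A bialgebra which is generated by its primitive elements is the (restricted) enveloping
algebra of its primitive elements. -/
def hopfEquivEnveloping (hgen : Algebra.adjoin K (primitives K H) = ⊤) :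
    H ≃ₐc[K] Enveloping (primitiveRestricted K H p) :=
  (BialgEquiv.ofBijective (envelopingToHopfBialgHom p H)
    (show Function.Bijective (envelopingToHopf (K := K) p H) from
      envelopingToHopf_bijective p hgen)).symm

theorem hopfEquivEnveloping_symm_ι (hgen : Algebra.adjoin K (primitives K H) = ⊤)
    (x : primitiveSubmodule K H) :
    (hopfEquivEnveloping p hgen).symm (Enveloping.ι (primitiveRestricted K H p) x) = x :=
  envelopingToHopf_ι p H x

end EnvelopingPrimitives

/-! ### Graded co-Poisson Hopf algebras as enveloping algebras. -/

section CoPoissonEnveloping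

variable {K : Type u} [Field K] (p : ℕ) [CharP K p] {H : Type v} [Ring H] [Bialgebra K H]

theorem subsingleton_primitiveSubmodule (h : (⊥ : Subalgebra K H) = ⊤) :
    Subsingleton (primitiveSubmodule K H) := by
  have hz : ∀ x : primitiveSubmodule K H, x = 0 := by
    intro x
    have hx : (x : H) ∈ (⊥ : Subalgebra K H) := h ▸ trivial
    obtain ⟨c, hc⟩ := Algebra.mem_bot.1 hx
    have h0 := counit_of_mem_primitives (mem_primitiveSubmodule.1 x.2)
    rw [← hc, Bialgebra.counit_algebraMap] at h0
    exact Subtype.ext (by rw [← hc, h0, map_zero]; rfl)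
  exact ⟨fun x y => (hz x).trans (hz y).symm⟩

/-- A graded co-Poisson Hopf algebra which is generated by its primitive elements is, as such, the
(restricted) enveloping algebra of the graded restricted Lie bialgebra of these elements. -/
theorem IsConnectedGrading.exists_restrictedLieBialgebra {𝒜 : ℤ → Submodule K H}
    (h𝒜 : IsConnectedGrading 𝒜) {S : H →ₗ[K] H} {δ : H →ₗ[K] H ⊗[K] H} (h : IsCoPoissonHopf S δ)
    (hδ : ∀ n, ∀ a ∈ 𝒜 n, δ a ∈ tensorDegree 𝒜 (n + 1))
    (hgen : Algebra.adjoin K (primitives K H) = ⊤) :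
    ∃ (g : Type v) (_ : LieRing g) (_ : LieAlgebra K g) (𝔤 : RestrictedLieBialgebra K p g)
      (𝓛 : ℤ → Submodule K g)
      (δU : Enveloping 𝔤.toRestrictedLieStructure →ₗ[K]
        Enveloping 𝔤.toRestrictedLieStructure ⊗[K] Enveloping 𝔤.toRestrictedLieStructure)
      (φ : H ≃ₐc[K] Enveloping 𝔤.toRestrictedLieStructure),
      𝔤.IsGraded 𝓛 ∧
      IsCoPoissonHopf (HopfAlgebra.antipode K) δU ∧
      (∀ x : g, δU (Enveloping.ι 𝔤.toRestrictedLieStructure x) =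
        TensorProduct.map (Enveloping.ι _) (Enveloping.ι _) (𝔤.cobracket x)) ∧
      (∀ a, δU (φ a) = TensorProduct.map (φ : _ →ₗ[K] _) (φ : _ →ₗ[K] _) (δ a)) ∧
      (∀ (n : ℤ) (a : H), a ∈ 𝒜 n ↔
        φ a ∈ Enveloping.degreePart 𝔤.toRestrictedLieStructure 𝓛 n) ∧
      ((⊥ : Subalgebra K H) = ⊤ → Subsingleton g) := by
  set φ := hopfEquivEnveloping p hgen
  have hι : ∀ x : primitiveSubmodule K H, φ x = Enveloping.ι (primitiveRestricted K H p) x := by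
    intro x
    rw [← hopfEquivEnveloping_symm_ι p hgen x]
    exact φ.apply_symm_apply _
  have hcomp : (φ : H →ₗ[K] Enveloping (primitiveRestricted K H p)) ∘ₗ
      (primitiveSubmodule K H).subtype = Enveloping.ι (primitiveRestricted K H p) :=
    LinearMap.ext hι
  refine ⟨primitiveSubmodule K H, inferInstance, inferInstance, primitiveLieBialgebra h p,
    fun n => (𝒜 n).comap (primitiveSubmodule K H).subtype, transportCobracket φ δ, φ,
    isGraded_primitiveLieBialgebra h𝒜 p h hδ,
    isCoPoissonHopf_transportCobracket φ h isAntipode_antipode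
      (adjoin_primitives_enveloping (primitiveRestricted K H p)),
    fun x => ?_, transportCobracket_apply φ δ, fun n a => ?_, subsingleton_primitiveSubmodule⟩
  · change transportCobracket φ δ (Enveloping.ι (primitiveRestricted K H p) x) =
      TensorProduct.map (Enveloping.ι (primitiveRestricted K H p))
        (Enveloping.ι (primitiveRestricted K H p)) (primitiveCobracket δ x)
    rw [← hι, transportCobracket_apply, ← primitiveIncl₂_primitiveCobracket h x, ← hcomp,
      TensorProduct.map_comp]
    rfl
  · refine mem_iff_mem_degreePart (primitiveRestricted K H p) h𝒜
      (iSup_comap_primitiveSubmodule h𝒜) (φ : H ≃ₐ[K] _) (fun m x hx => ?_) n a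
    have h1 : (φ : H ≃ₐ[K] _).symm (Enveloping.ι (primitiveRestricted K H p) x) = (x : H) := by
      rw [AlgEquiv.symm_apply_eq]
      exact (hι x).symm
    rw [h1]
    exact hx

end CoPoissonEnveloping

/-! ### Assembly for the ε-filtration. -/

section EpsilonFiltration

variable {K : Type u} [Field K] (p : ℕ) [CharP K p] (B : Type v) [Ring B] [Bialgebra K B]

theorem epsilonFiltration_graded :
    ∃ (S : AssocGraded (epsilonFiltration K B) →ₗ[K] AssocGraded (epsilonFiltration K B))
      (δ : AssocGraded (epsilonFiltration K B) →ₗ[K]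
        AssocGraded (epsilonFiltration K B) ⊗[K] AssocGraded (epsilonFiltration K B)),
      IsAntipode S ∧
      IsGradedHopf S (fun n => AssocGraded.piece (epsilonFiltration K B) (-n)) ∧
      IsInducedCobracket (epsilonFiltration K B) δ ∧
      IsCoPoissonHopf S δ ∧
      (∀ (n : ℤ), ∀ a ∈ AssocGraded.piece (epsilonFiltration K B) (-n),
        δ a ∈ tensorDegree (fun m => AssocGraded.piece (epsilonFiltration K B) (-m)) (n + 1)) ∧
      Algebra.adjoin K (primitives K (AssocGraded (epsilonFiltration K B))) = ⊤ := by
  have hD : ∀ (z : ℤ), ∀ x ∈ epsilonFiltration K B z,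
      cocommutator K B x ∈ tensorDegree (epsilonFiltration K B) (z - 1) :=
    fun z x hx => (comul_cocommutator_mem_tensorDegree_epsilonFiltration hx).2
  obtain ⟨S, hS, hgr⟩ :=
    (isConnectedGrading_epsilonFiltration (K := K) (B := B)).exists_isGradedHopf
  have hgen := adjoin_primitives_epsilonFiltration (K := K) (B := B)
  refine ⟨S, AssocGraded.cobracketHom hD, hS, hgr, AssocGraded.isInducedCobracket_cobracketHom hD,
    AssocGraded.isCoPoissonHopf_cobracketHom hD hS hgen, fun n a ha => ?_, hgen⟩
  rw [tensorDegree_neg, neg_add']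
  exact AssocGraded.cobracketHom_mem_tensorDegree hD ha

theorem bot_eq_top_assocGraded_epsilonFiltration [CharZero K] [Module.Finite K B] :
    (⊥ : Subalgebra K (AssocGraded (epsilonFiltration K B))) = ⊤ := by
  obtain ⟨N, hN⟩ := exists_piece_epsilonFiltration_eq_bot (K := K) (B := B)
  exact isConnectedGrading_epsilonFiltration.bot_eq_top hN

end EpsilonFiltration

end CrystalDuality

end

theorem theorem3p5 {K : Type u} [Field K] (p : ℕ) [CharP K p] (B : Type v) [Ring B]
    [Bialgebra K B] :
    (∃ _ : IsBialgebraFiltration (epsilonFiltration K B),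
      ∃ (S : AssocGraded (epsilonFiltration K B) →ₗ[K] AssocGraded (epsilonFiltration K B))
        (δ : AssocGraded (epsilonFiltration K B) →ₗ[K]
          AssocGraded (epsilonFiltration K B) ⊗[K] AssocGraded (epsilonFiltration K B)),
        IsAntipode S ∧
        IsGradedHopf S (fun n => AssocGraded.piece (epsilonFiltration K B) (-n)) ∧
        IsInducedCobracket (epsilonFiltration K B) δ ∧
        IsCoPoissonHopf S δ ∧
        (∀ (n : ℤ), ∀ a ∈ AssocGraded.piece (epsilonFiltration K B) (-n),
          δ a ∈ tensorDegree (fun m => AssocGraded.piece (epsilonFiltration K B) (-m)) (n + 1)) ∧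
        Algebra.adjoin K (primitives K (AssocGraded (epsilonFiltration K B))) = ⊤ ∧
        ∃ (g : Type v) (_ : LieRing g) (_ : LieAlgebra K g) (𝔤 : RestrictedLieBialgebra K p g)
          (𝓛 : ℤ → Submodule K g)
          (δU : Enveloping 𝔤.toRestrictedLieStructure →ₗ[K]
            Enveloping 𝔤.toRestrictedLieStructure ⊗[K] Enveloping 𝔤.toRestrictedLieStructure)
          (φ : AssocGraded (epsilonFiltration K B) ≃ₐc[K] Enveloping 𝔤.toRestrictedLieStructure),
          𝔤.IsGraded 𝓛 ∧
          IsCoPoissonHopf (HopfAlgebra.antipode K) δU ∧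
          (∀ x : g, δU (Enveloping.ι 𝔤.toRestrictedLieStructure x) =
            TensorProduct.map (Enveloping.ι _) (Enveloping.ι _) (𝔤.cobracket x)) ∧
          (∀ a, δU (φ a) = TensorProduct.map (φ : _ →ₗ[K] _) (φ : _ →ₗ[K] _) (δ a)) ∧
          (∀ (n : ℤ) (a : AssocGraded (epsilonFiltration K B)),
            a ∈ AssocGraded.piece (epsilonFiltration K B) (-n) ↔
              φ a ∈ Enveloping.degreePart 𝔤.toRestrictedLieStructure 𝓛 n) ∧
          (p = 0 → Module.Finite K B →
            (⊥ : Subalgebra K (AssocGraded (epsilonFiltration K B))) = ⊤ ∧ Subsingleton g)) ∧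
    (∃ _ : IsBialgebraFiltration (deltaFiltration K B),
      ∃ (S : AssocGraded (deltaFiltration K B) →ₗ[K] AssocGraded (deltaFiltration K B))
        (br : AssocGraded (deltaFiltration K B) →ₗ[K]
          AssocGraded (deltaFiltration K B) →ₗ[K] AssocGraded (deltaFiltration K B)),
        IsAntipode S ∧
        IsGradedHopf S (AssocGraded.piece (deltaFiltration K B)) ∧
        IsInducedBracket (deltaFiltration K B) br ∧
        IsPoissonHopf S br ∧
        (∀ (m n : ℤ), ∀ a ∈ AssocGraded.piece (deltaFiltration K B) m,
          ∀ b ∈ AssocGraded.piece (deltaFiltration K B) n,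
            br a b ∈ AssocGraded.piece (deltaFiltration K B) (m + n - 1)) ∧
        ∃ (G : PoissonGroup.{u, v} K)
          (φ : AssocGraded (deltaFiltration K B) ≃ₐc[K] G.functionAlgebra),
          (∀ a b, φ (br a b) = G.bracket (φ a) (φ b)) ∧
          G.IsConnected ∧
          (p = 0 → G.IsAffineSpace) ∧
          (p = 0 → Module.Finite K B →
            (⊥ : Subalgebra K (AssocGraded (deltaFiltration K B))) = ⊤ ∧ G.IsTrivial) ∧
          (0 < p → G.dim = 0 ∧ G.HasHeightOne p) ∧
          (0 < p → PerfectField K → G.IsTruncatedPolynomial p)) := by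
  constructor
  · obtain ⟨S, δ, hS, hgr, hind, hco, hδ, hgen⟩ := epsilonFiltration_graded (K := K) B
    obtain ⟨g, i₁, i₂, 𝔤, 𝓛, δU, φ, h1, h2, h3, h4, h5, h6⟩ :=
      (isConnectedGrading_epsilonFiltration (K := K) (B := B)).exists_restrictedLieBialgebra
        p hco hδ hgen
    refine ⟨inferInstance, S, δ, hS, hgr, hind, hco, hδ, hgen, g, i₁, i₂, 𝔤, 𝓛, δU, φ, h1, h2, h3,
      h4, h5, fun hp _ => ?_⟩
    subst hp
    have := CharP.charP_to_charZero K
    have hb := bot_eq_top_assocGraded_epsilonFiltration (K := K) B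
    exact ⟨hb, h6 hb⟩
  · obtain ⟨S, br, h1, h2, h3, h4, h5, G, φ, h6, h7, h8, h9, h10, h11⟩ :=
      deltaFiltration_graded (K := K) p B
    exact ⟨inferInstance, S, br, h1, h2, h3, h4, h5, G, φ, h6, h7, h8, h9, h10,
      fun hp _ => h11 hp⟩
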